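/- Let $G$ be a compact, simply connected, simple Lie group of rank $n$, let $\mathfrak g$ be the complexification of its Lie algebra (a finite-dimensional simple complex Lie algebra) and $\mathfrak h\subset\mathfrak g$ a Cartan subalgebra. Let $\Delta\subset\mathfrak h^*$ be the set of roots, and let $\mathfrak t\subset\mathfrak h$ be the real span of the co-roots and $\mathfrak t^*$ the real span of the roots, with the natural pairing $\langle\cdot,\cdot\rangle$, so that $x\mapsto\exp(2\pi i x)$ maps $\mathfrak t$ onto a maximal torus of $G$. Let $\alpha_1,\dots,\alpha_n$ be simple roots with co-roots $\check\alpha_1,\dots,\check\alpha_n$. Let $-\alpha_0=\sum_j m_j\alpha_j$ be the highest root, let $\sum_j\check m_j\check\alpha_j$ be the highest co-root (the highest root of the dual root system), and let $h=1+m_1+\cdots+m_n$ be the Coxeter number. Let $\omega_j\in\mathfrak t^*$ be the fundamental weights, $\langle\omega_j,\check\alpha_k\rangle=\delta_{jk}$, and $\rho=\omega_1+\cdots+\omega_n$. Let $W$ be the Weyl group, with the sign character $w\mapsto(-1)^{l(w)}=\det w$, and let $$\check P=\{y\in\mathfrak t\mid\langle\alpha,y\rangle\in\mathbb Z\text{ for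 all }\alpha\in\Delta\},\quad F=\{x\in\mathfrak t\mid\langle\alpha_j,x\rangle\ge0\ (1\le j\le n),\ \langle-\alpha_0,x\rangle\le1\},$$ and let $F^\circ$ be the set obtained from $F$ by making all the inequalities strict. For $N\ge1$ let $F_N=F\cap\frac1N\check P$ and $F^\circ_N=F^\circ\cap\frac1N\check P$ be the sets of points of adjoint order $N$ (meaning $\mathrm{Ad}(\exp(2\pi i x))^N=1$) in $F$ and $F^\circ$; put $F_0=\{0\}$. A point $x\in\mathfrak t$ is regular if the centralizer of $\exp(2\pi i x)$ has dimension $n$. For $\lambda=\sum_j\lambda_j\omega_j$ with integers $\lambda_j\ge0$, the $m$-degree of $\lambda$, and of the monomial $X_1^{\lambda_1}\cdots X_n^{\lambda_n}$, is $\sum_j\lambda_j\check m_j$. For such $\lambda$ and $x\in\mathfrak t$ let $$S_{\lambda+\rho}(x)=\sum_{w\in W}(-1)^{l(w)}e^{2\pi i\langle w(\lambda+\rho),x\rangle},\qquad \chi_\lambda(x)=\operatorname{tr}_{L(\lambda)}\exp(2\pi i x)=\sum_\mu\dim L(\lambda)^\mu\,e^{2\pi i\langle\mu,x\rangle},$$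 where $L(\lambda)$ is the finite-dimensional irreducible representation with highest weight $\lambda$ and $\mu$ runs over its weights. **Theorem.** Let $M\ge0$ be an integer. The regular points of $F$ of adjoint order $M+h$ are exactly the points of $F^\circ_{M+h}$. This set is finite, and its number of elements equals the number of monomials in $\mathbb C[X_1,\dots,X_n]$ of $m$-degree at most $M$, and also equals the number of elements of $F_M$: $|F^\circ_{M+h}|=|F_M|$. Moreover, every $x\in F^\circ_{M+h}$ is a common zero of all the functions $S_{\lambda+\rho}$ and of all the characters $\chi_\lambda$ for which $\lambda=\sum_j\lambda_j\omega_j$ (with integers $\lambda_j\ge0$) has $m$-degree exactly $M+1$. -/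

import Mathlib

noncomputable section

namespace EFO

open Module

section RootData

/-! ### Constructions from a real root system `P` with a simple system `b`

`V` plays the role of `𝔱*` and `T` that of `𝔱`. -/

variable {ι V T : Type*} [Finite ι] [AddCommGroup V] [Module ℝ V] [AddCommGroup T] [Module ℝ T]
  {P : RootPairing ι ℝ V T}

/-- The natural pairing `⟨v, x⟩` of `𝔱*` and `𝔱`. -/
def pair (P : RootPairing ι ℝ V T) (v : V) (x : T) : ℝ := P.toLinearMap v x

/-- The (index of the) highest root `-α₀`, that is, the root of greatest height. -/
def highestRoot [Nonempty ι] (b : P.Base) : ι :=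
  (Finite.exists_max b.height).choose

/-- The mark `m_j`: the coefficient of the simple root `α_j` in the highest root `-α₀`.
These coefficients are positive integers, so that `Int.toNat` only changes the type. -/
def mark [Nonempty ι] (b : P.Base) (j : b.support) : ℕ :=
  (b.toWeightBasisInt.repr (P.rootSpanMem ℤ (highestRoot b)) j).toNat

/-- The co-mark `m̌_j`: the mark of the dual root system, that is, the coefficient of the simple
co-root `α̌_j` in the highest co-root. -/
def comark [Nonempty ι] (b : P.Base) (j : b.support) : ℕ := mark b.flip j

/-- The Coxeter number `h = m₀ + m₁ + ⋯ + m_n`, where `m₀ = 1`. -/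
def coxeterNumber [Nonempty ι] (b : P.Base) : ℕ := 1 + ∑ j : b.support, mark b j

/-- The fundamental simplex `F` of the affine Weyl group. -/
def chamber [Nonempty ι] (b : P.Base) : Set T :=
  {x | (∀ j ∈ b.support, 0 ≤ pair P (P.root j) x) ∧ pair P (P.root (highestRoot b)) x ≤ 1}

/-- The interior `F°` of the simplex `F`. -/
def openChamber [Nonempty ι] (b : P.Base) : Set T :=
  {x | (∀ j ∈ b.support, 0 < pair P (P.root j) x) ∧ pair P (P.root (highestRoot b)) x < 1}

/-- The co-weight lattice `P̌`: the `ℤ`-dual of the root lattice. -/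
def coweightLattice (P : RootPairing ι ℝ V T) : Set T :=
  {y | ∀ i, ∃ z : ℤ, pair P (P.root i) y = z}

/-- The points of adjoint order (dividing) `N`: the set `(1/N) P̌`.
For `N = 0` the set is `{0}`, by the convention `1 / 0 = 0`. -/
def adjointOrder (P : RootPairing ι ℝ V T) (N : ℕ) : Set T :=
  {x | ∃ y ∈ coweightLattice P, x = (1 / (N : ℝ)) • y}

/-- `F_N`: the points of `F` of adjoint order `N`. -/
def chamberEFO [Nonempty ι] (b : P.Base) (N : ℕ) : Set T := chamber b ∩ adjointOrder P N

/-- `F°_N`: the points of `F°` of adjoint order `N`. -/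
def openChamberEFO [Nonempty ι] (b : P.Base) (N : ℕ) : Set T := openChamber b ∩ adjointOrder P N

/-- The `m`-degree `∑ λ_j m̌_j` of `λ = (λ_1, …, λ_n)`. -/
def mDegree [Nonempty ι] (b : P.Base) (l : b.support →₀ ℕ) : ℕ := Finsupp.weight (comark b) l

/-- The monomials `X^λ` of `ℂ[X_1, …, X_n]` of `m`-degree at most `M`, where `X_j` has
degree `m̌_j`. -/
def monomialsLE [Nonempty ι] (b : P.Base) (M : ℕ) : Set (MvPolynomial b.support ℂ) :=
  {p | ∃ l : b.support →₀ ℕ, mDegree b l ≤ M ∧ p = MvPolynomial.monomial l 1}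

/-- The fundamental weight `ω_j`, defined by `⟨ω_j, α̌_k⟩ = δ_jk`. -/
def fundamentalWeight [P.IsRootSystem] (b : P.Base) (j : b.support) : V :=
  P.toLinearMap.toPerfPair.symm (b.toCoweightBasis.coord j)

/-- The dominant weight `λ = ∑ λ_j ω_j`. -/
def dominantWeight [P.IsRootSystem] (b : P.Base) (l : b.support →₀ ℕ) : V :=
  ∑ j, (l j : ℝ) • fundamentalWeight b j

/-- The weight `ρ = ∑ ω_j`. -/
def rho [P.IsRootSystem] (b : P.Base) : V := ∑ j, fundamentalWeight b j

lemma finite_weylGroup (P : RootPairing ι ℝ V T) [P.IsRootSystem] : Finite P.weylGroup := by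
  refine Finite.of_injective (fun w => P.weylGroupToPerm w) ?_
  intro g g' h
  apply Subtype.ext
  apply RootPairing.Equiv.weightHom_injective P
  apply LinearEquiv.toLinearMap_injective
  refine LinearMap.ext_on_range (v := P.root) RootPairing.IsRootSystem.span_root_eq_top ?_
  intro i
  have h1 := P.weylGroup_apply_root g i
  have h2 := P.weylGroup_apply_root g' i
  have h3 : P.weylGroupToPerm g = P.weylGroupToPerm g' := h
  rw [h3, ← h2] at h1
  exact h1

instance (P : RootPairing ι ℝ V T) [P.IsRootSystem] : Fintype P.weylGroup :=
  @Fintype.ofFinite _ (finite_weylGroup P)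

/-- The sign `(-1)^{l(w)}`: the determinant of `w` on `𝔱*`, which is the homomorphism
`W → {±1}` that sends every reflection to `-1`. -/
def sign (P : RootPairing ι ℝ V T) (w : P.weylGroup) : ℝ :=
  LinearMap.det (P.weylGroupRootRep w)

/-- The `S`-function `S_μ(x) = ∑_{w ∈ W} (-1)^{l(w)} e^{2πi⟨wμ, x⟩}`. -/
def sFunction (P : RootPairing ι ℝ V T) [P.IsRootSystem] (μ : V) (x : T) : ℂ :=
  ∑ w : P.weylGroup, (sign P w : ℂ) *
    Complex.exp (2 * Real.pi * Complex.I * (pair P (w • μ) x : ℂ))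

end RootData

section LieAlgebra

/-! ### The root system and the characters of a complex simple Lie algebra -/

variable {𝔤 : Type*} [LieRing 𝔤] [LieAlgebra ℂ 𝔤] [FiniteDimensional ℂ 𝔤] [LieAlgebra.IsSimple ℂ 𝔤]
  (H : LieSubalgebra ℂ 𝔤) [H.IsCartanSubalgebra]

/-- The real form `𝔱 ⊆ H`, the real span of the co-roots. -/
abbrev realCartan : Submodule ℝ H :=
  Submodule.span ℝ (Set.range (LieAlgebra.IsKilling.rootSystem H).coroot)

/-- The real dual `𝔱*`, as the real span of the roots in the dual of `H`. -/
abbrev realDual : Submodule ℝ (Dual ℂ H) :=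
  Submodule.span ℝ (Set.range (LieAlgebra.IsKilling.rootSystem H).root)

/-- The roots and the co-roots of `𝔤` with respect to `H`, as a root system in the real vector
spaces `𝔱*` and `𝔱`. -/
abbrev realRootSystem : RootPairing H.root ℝ (realDual H) (realCartan H) :=
  (LieAlgebra.IsKilling.rootSystem H).restrictScalars ℝ

instance : Nonempty H.root := by
  have h := RootPairing.IsIrreducible.nontrivial (LieAlgebra.IsKilling.rootSystem H)
  by_contra hne
  rw [not_nonempty_iff] at hne
  have h1 := (inferInstance : (LieAlgebra.IsKilling.rootSystem H).IsRootSystem).span_root_eq_top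
  rw [Set.range_eq_empty, Submodule.span_empty] at h1
  exact bot_ne_top h1

variable {H}

/-- The Lie algebra of the centralizer of `exp(2πix)`, complexified: `Ad(exp(2πix))` acts on the
root space of `α` (the space `H` for `α = 0`) as the scalar `e^{2πi⟨α, x⟩}`, and this is its
space of fixed points. -/
def centralizer (x : realCartan H) : Submodule ℂ 𝔤 :=
  ⨆ α : LieModule.Weight ℂ H 𝔤, ⨆ _ : Complex.exp (2 * Real.pi * Complex.I * α (x : H)) = 1,
    (LieAlgebra.rootSpace H α).toSubmodule

/-- The point `x`, or the element `exp(2πix)`, is regular: its centralizer has dimension `n`,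
the rank. -/
def IsRegular (x : realCartan H) : Prop := finrank ℂ (centralizer x) = finrank ℂ H

variable (H) in
/-- The character `χ_L(x) = tr_L exp(2πix) = ∑_μ dim L^μ e^{2πi⟨μ, x⟩}` of a representation `L`,
where `μ` runs over the weights of `L`. -/
def character (L : Type*) [AddCommGroup L] [Module ℂ L] [LieRingModule 𝔤 L] [LieModule ℂ 𝔤 L]
    [FiniteDimensional ℂ L] (x : realCartan H) : ℂ :=
  ∑ μ : LieModule.Weight ℂ H L, (finrank ℂ (LieModule.weightSpace L (μ : H → ℂ)) : ℂ) *
    Complex.exp (2 * Real.pi * Complex.I * μ (x : H))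

/-- `λ` is the highest weight of the representation `L`: it is a weight, and every weight of `L`
has the form `λ - β` with `β` a sum of positive roots. -/
def IsHighestWeight (b : (realRootSystem H).Base) (l : realDual H)
    (L : Type*) [AddCommGroup L] [Module ℂ L] [LieRingModule 𝔤 L] [LieModule ℂ 𝔤 L] : Prop :=
  LieModule.weightSpace L ((l : Dual ℂ H) : H → ℂ) ≠ ⊥ ∧
    ∀ μ : Dual ℂ H, LieModule.weightSpace L (μ : H → ℂ) ≠ ⊥ →
      ∃ β ∈ AddSubmonoid.closure ((realRootSystem H).root '' {i | b.IsPos i}),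
        μ = (l : Dual ℂ H) - (β : Dual ℂ H)

end LieAlgebra

end EFO

end

/-!
The alcove `F` is a fundamental domain for the affine Weyl group, and `W` acts on the finite group
`(1/N) P̌ / Q̌` of the points of adjoint order `N`, where `Q̌` is the co-root lattice. A point which
is not in the `W`-orbit of `F°` is fixed by a reflection, so the signed count
`∑_w (-1)^{l(w)} |Fix w|` is `|W|` times the number of points of `F°_N`. The pairing with values in
`ℝ/ℤ` puts this group in duality with the analogous group of the dual root system, and each
element of `W` fixes equally many points of the two groups. Hence `|F°_N|` is the same for the
two root systems. In coordinates these are the solutions in positive integers of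
`∑ m_j k_j < N` and of `∑ m̌_j k_j < N`. The least `N` for which there is one shows that
`∑ m_j = ∑ m̌_j`, and for `N = M + h` the substitution `k_j = λ_j + 1` turns the solutions of the
second inequality into the monomials of `m`-degree at most `M`, and those of the first into the
points of `F_M`.

If `λ` has `m`-degree `M + 1`, then `⟨λ + ρ, θ̌⟩ = M + h = N` for the highest co-root `θ̌`. The
reflection in `θ̌` therefore moves `λ + ρ` by `N` times a root, which does not change the
exponentials at the points of adjoint order `N` but changes the sign of `S_{λ+ρ}`.

For the characters, the Casimir operator acts on `L(λ)` as a scalar, so the product of the Weyl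
denominator with the formal character is an eigenvector of the Laplacian. It is antisymmetric with
leading exponent `λ + ρ`, and all its exponents have the same norm, so they are conjugates of
`λ + ρ`. The value of this product at `x` is then a multiple of `S_{λ+ρ}(x) = 0`, and the
denominator does not vanish at a regular point.
-/

noncomputable section

namespace EFO

open Module

/-! ### Coefficients of the highest root -/

section RootCoefficients

variable {ι V T : Type*} [AddCommGroup V] [Module ℝ V] [AddCommGroup T] [Module ℝ T]
  {P : RootPairing ι ℝ V T} (b : P.Base)

/-- The coefficient of the simple root `α_j` in the root `α_i`. -/
def rootCoeff (i : ι) (j : b.support) : ℤ := b.toWeightBasisInt.repr (P.rootSpanMem ℤ i) j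

lemma rootCoeff_add {i j k : ι} (h : P.root k = P.root i + P.root j) (l : b.support) :
    rootCoeff b k l = rootCoeff b i l + rootCoeff b j l := by
  have h' : P.rootSpanMem ℤ k = P.rootSpanMem ℤ i + P.rootSpanMem ℤ j := Subtype.ext h
  rw [rootCoeff, h', map_add, Finsupp.add_apply, rootCoeff, rootCoeff]

lemma rootCoeff_sub {i j k : ι} (h : P.root k = P.root i - P.root j) (l : b.support) :
    rootCoeff b k l = rootCoeff b i l - rootCoeff b j l := by
  rw [rootCoeff_add b (eq_add_of_sub_eq h.symm), add_sub_cancel_right]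

lemma rootCoeff_self (j : b.support) : rootCoeff b j j = 1 := by
  have h : P.rootSpanMem ℤ j = b.toWeightBasisInt j :=
    Subtype.ext (b.coe_toWeightBasisInt_apply j).symm
  rw [rootCoeff, h, Basis.repr_self, Finsupp.single_eq_same]

lemma root_eq_sum_rootCoeff (i : ι) :
    P.root i = ∑ j : b.support, rootCoeff b i j • P.root j := by
  have h := congrArg Subtype.val (b.toWeightBasisInt.sum_repr (P.rootSpanMem ℤ i))
  rw [AddSubmonoidClass.coe_finsetSum] at h
  simpa [rootCoeff] using h.symm

lemma exists_rootCoeff_ne_zero (i : ι) : ∃ j, rootCoeff b i j ≠ 0 := by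
  by_contra! h
  exact P.ne_zero i (by simp [root_eq_sum_rootCoeff b i, h])

lemma rootCoeff_eq_of_sum {i : ι} {f : ι → ℤ}
    (h : P.root i = ∑ j ∈ b.support, f j • P.root j) (j : b.support) : rootCoeff b i j = f j := by
  have hli : LinearIndependent ℤ (fun j : b.support ↦ P.root j) :=
    b.linearIndepOn_root.restrict_scalars' ℤ
  rw [root_eq_sum_rootCoeff b i, ← b.support.sum_coe_sort] at h
  exact Fintype.linearIndependent_iffₛ.mp hli _ _ h j

lemma rootCoeff_nonneg_or_nonpos (i : ι) :
    (∀ j, 0 ≤ rootCoeff b i j) ∨ (∀ j, rootCoeff b i j ≤ 0) := by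
  obtain ⟨f, -, h, hf⟩ := b.exists_root_eq_sum_int i
  simp only [rootCoeff_eq_of_sum b hf]
  exact h.imp (fun h j ↦ h.le j) (fun h j ↦ h.le j)

lemma height_eq_sum_rootCoeff (i : ι) : b.height i = ∑ j, rootCoeff b i j := by
  obtain ⟨f, -, -, hf⟩ := b.exists_root_eq_sum_int i
  rw [RootPairing.Base.height_eq_sum hf, ← b.support.sum_coe_sort]
  exact Finset.sum_congr rfl fun j _ ↦ (rootCoeff_eq_of_sum b hf j).symm

lemma pairingIn_eq_sum_rootCoeff [P.IsCrystallographic] (i k : ι) :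
    P.pairingIn ℤ i k = ∑ j, rootCoeff b i j * P.pairingIn ℤ j k := by
  have h := congrArg (P.coroot' k) (root_eq_sum_rootCoeff b i)
  simp only [map_sum, map_zsmul, RootPairing.root_coroot'_eq_pairing,
    ← P.algebraMap_pairingIn ℤ, zsmul_eq_mul, eq_intCast] at h
  exact_mod_cast h

variable {b}

lemma rootCoeff_nonneg {i : ι} (hi : b.IsPos i) (j : b.support) : 0 ≤ rootCoeff b i j := by
  refine (rootCoeff_nonneg_or_nonpos b i).elim (· j) fun h ↦ absurd (b.isPos_iff.mp hi) ?_
  rw [height_eq_sum_rootCoeff]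
  exact not_lt.mpr (Finset.sum_nonpos fun j _ ↦ h j)

lemma rootCoeff_nonpos {i : ι} (hi : ¬ b.IsPos i) (j : b.support) : rootCoeff b i j ≤ 0 := by
  refine (rootCoeff_nonneg_or_nonpos b i).elim (fun h ↦ absurd (b.isPos_iff'.mpr ?_) hi) (· j)
  rw [height_eq_sum_rootCoeff]
  exact Finset.sum_nonneg fun j _ ↦ h j

variable [Finite ι]

section Dominant

variable [P.IsCrystallographic]

lemma pairingIn_nonneg_of_maximal {i : ι} (hi : b.IsPos i)
    (hmax : ∀ k, ∀ j : b.support, P.root k ≠ P.root i + P.root j) (j : b.support) :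
    0 ≤ P.pairingIn ℤ i j := by
  by_contra! h
  have hne : P.root i ≠ -P.root j := by
    rw [Ne, RootPairing.root_eq_neg_iff]
    rintro rfl
    exact (RootPairing.Base.IsPos.neg_iff_not b j).mp hi (b.isPos_of_mem_support j.2)
  obtain ⟨k, hk⟩ := P.root_add_root_mem_of_pairingIn_neg h hne
  exact hmax k j hk

lemma exists_dominant_rootCoeff_le {i : ι} (hi : b.IsPos i) :
    ∃ k, b.IsPos k ∧ (∀ j : b.support, 0 ≤ P.pairingIn ℤ k j) ∧
      ∀ j, rootCoeff b i j ≤ rootCoeff b k j := by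
  let S := {k : ι | b.IsPos k ∧ ∀ j, rootCoeff b i j ≤ rootCoeff b k j}
  obtain ⟨k, ⟨hk, hik⟩, hmax⟩ :=
    S.toFinite.exists_maximalFor b.height S ⟨i, hi, fun _ ↦ le_rfl⟩
  refine ⟨k, hk, pairingIn_nonneg_of_maximal hk fun l j hl ↦ ?_, hik⟩
  have hj := b.isPos_of_mem_support j.2
  have hlS : l ∈ S := ⟨hk.add hj hl, fun m ↦ by
    have := hik m
    have := rootCoeff_add b hl m
    have := rootCoeff_nonneg hj m
    omega⟩
  have := hmax hlS
  have := b.height_add hl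
  have := b.isPos_iff.mp hj
  omega

variable [P.IsReduced] [P.IsIrreducible]

lemma rootCoeff_pos_of_dominant {i : ι} (hi : b.IsPos i)
    (hdom : ∀ j : b.support, 0 ≤ P.pairingIn ℤ i j) (j : b.support) : 0 < rootCoeff b i j := by
  obtain ⟨k, hk⟩ := exists_rootCoeff_ne_zero b i
  -- Positivity spreads along the edges of the Dynkin diagram.
  refine b.induction_on_cartanMatrix (fun j ↦ 0 < rootCoeff b i j)
    ((rootCoeff_nonneg hi k).lt_of_ne' hk) fun l m hl hlm ↦ ?_
  by_contra! hm
  have hm0 : rootCoeff b i m = 0 := le_antisymm hm (rootCoeff_nonneg hi m)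
  have hne : l ≠ m := by rintro rfl; omega
  have hsimple : ∀ {k : b.support}, k ≠ m → P.pairingIn ℤ k m ≤ 0 := fun {k} hkm ↦
    b.pairingIn_le_zero_of_ne (Subtype.coe_ne_coe.mpr hkm) k.2 m.2
  have hlm' : P.pairingIn ℤ l m ≠ 0 := fun h ↦ hlm (P.pairingIn_eq_zero_iff.mp h)
  refine absurd (hdom m) (not_le.mpr ?_)
  rw [pairingIn_eq_sum_rootCoeff b]
  refine Finset.sum_neg' (fun k _ ↦ ?_)
    ⟨l, Finset.mem_univ _, mul_neg_of_pos_of_neg hl ((hsimple hne).lt_of_ne hlm')⟩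
  rcases eq_or_ne k m with rfl | hkm
  · simp only [hm0, zero_mul, le_refl]
  · exact mul_nonpos_of_nonneg_of_nonpos (rootCoeff_nonneg hi k) (hsimple hkm)

lemma pairingIn_pos_of_dominant {i k : ι} (hi : b.IsPos i) (hk : b.IsPos k)
    (hidom : ∀ j : b.support, 0 ≤ P.pairingIn ℤ i j)
    (hkdom : ∀ j : b.support, 0 ≤ P.pairingIn ℤ k j) : 0 < P.pairingIn ℤ i k := by
  have hsimple (j : b.support) : 0 ≤ P.pairingIn ℤ j k := by
    rcases (hkdom j).eq_or_lt with h | h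
    · exact (P.pairingIn_eq_zero_iff.mp h.symm).ge
    · exact ((P.zero_lt_pairingIn_iff' ℤ).mp h).le
  obtain ⟨l, hl, hlk⟩ := hk.exists_mem_support_pos_pairingIn
  rw [pairingIn_eq_sum_rootCoeff b]
  exact Finset.sum_pos' (fun j _ ↦ mul_nonneg (rootCoeff_nonneg hi j) (hsimple j))
    ⟨⟨l, hl⟩, Finset.mem_univ _, mul_pos (rootCoeff_pos_of_dominant hi hidom _) hlk⟩

lemma rootCoeff_le_of_dominant {i k : ι} (hi : b.IsPos i) (hk : b.IsPos k)
    (hidom : ∀ j : b.support, 0 ≤ P.pairingIn ℤ i j)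
    (hkdom : ∀ j : b.support, 0 ≤ P.pairingIn ℤ k j)
    (hik : b.height i ≤ b.height k) (j : b.support) : rootCoeff b i j ≤ rootCoeff b k j := by
  rcases eq_or_ne k i with rfl | hne
  · exact le_rfl
  obtain ⟨m, hm⟩ := P.root_sub_root_mem_of_pairingIn_pos
    (pairingIn_pos_of_dominant hk hi hkdom hidom) hne
  have hmpos : b.IsPos m := b.isPos_iff'.mpr (by rw [b.height_sub hm]; omega)
  have := rootCoeff_sub b hm j
  have := rootCoeff_nonneg hmpos j
  omega

end Dominant

section HighestRoot

variable (b) [Nonempty ι]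

lemma height_le_highestRoot (i : ι) : b.height i ≤ b.height (highestRoot b) :=
  (Finite.exists_max b.height).choose_spec i

lemma isPos_highestRoot : b.IsPos (highestRoot b) := by
  obtain ⟨j, hj⟩ := b.support_nonempty
  exact b.isPos_iff.mpr ((b.isPos_iff.mp (b.isPos_of_mem_support hj)).trans_le
    (height_le_highestRoot b j))

lemma mark_eq (j : b.support) : (mark b j : ℤ) = rootCoeff b (highestRoot b) j :=
  Int.toNat_of_nonneg (rootCoeff_nonneg (isPos_highestRoot b) j)

variable [P.IsCrystallographic]

lemma pairingIn_highestRoot_nonneg (j : b.support) : 0 ≤ P.pairingIn ℤ (highestRoot b) j := by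
  refine pairingIn_nonneg_of_maximal (isPos_highestRoot b) (fun k j hk ↦ ?_) j
  have := b.height_add hk
  have := b.isPos_iff.mp (b.isPos_of_mem_support j.2)
  have := height_le_highestRoot b k
  omega

variable [P.IsReduced] [P.IsIrreducible]

lemma rootCoeff_le_highestRoot (i : ι) (j : b.support) :
    rootCoeff b i j ≤ rootCoeff b (highestRoot b) j := by
  by_cases hi : b.IsPos i
  · obtain ⟨k, hk, hkdom, hik⟩ := exists_dominant_rootCoeff_le hi
    exact (hik j).trans (rootCoeff_le_of_dominant hk (isPos_highestRoot b) hkdom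
      (pairingIn_highestRoot_nonneg b) (height_le_highestRoot b k) j)
  · exact (rootCoeff_nonpos hi j).trans (rootCoeff_nonneg (isPos_highestRoot b) j)

lemma mark_pos (j : b.support) : 0 < mark b j := by
  have := rootCoeff_le_highestRoot b j j
  have := mark_eq b j
  have := rootCoeff_self b j
  omega

end HighestRoot

end RootCoefficients

/-! ### The Weyl group -/

section WeylGroup

open RootPairing

variable {ι V T : Type*} [AddCommGroup V] [Module ℝ V] [AddCommGroup T] [Module ℝ T]
  {P : RootPairing ι ℝ V T}

/-- The action of the automorphisms of `P` on `𝔱` that leaves the pairing of `𝔱*` and `𝔱`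
invariant; `w` acts by the inverse of the transpose of its action on `𝔱*`. -/
instance : DistribMulAction P.Aut T :=
  DistribMulAction.compHom T (MulEquiv.inv' P.Aut).toMonoidHom

lemma pair_smul_smul (w : P.weylGroup) (v : V) (x : T) : pair P (w • v) (w • x) = pair P v x :=
  (LinearMap.congr_fun (Hom.weight_coweight_transpose_apply P P (w • x) w.1.toHom) v).trans
    (congrArg (pair P v) (by exact smul_inv_smul (MulOpposite.op w.1) x))

lemma root_smul (w : P.weylGroup) (i : ι) : P.root (w • i) = w • P.root i :=
  (P.weylGroup_apply_root w i).symm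

lemma coroot_smul (w : P.weylGroup) (i : ι) : P.coroot (w • i) = w • P.coroot i :=
  (Hom.coroot_coweightMap_apply P P i (w.1⁻¹).toHom).symm

lemma weylGroup_ext {w w' : P.weylGroup} (h : ∀ v : V, w • v = w' • v) : w = w' :=
  Subtype.ext (Equiv.weightHom_injective P (LinearEquiv.ext h))

lemma weylGroup_induction {p : P.weylGroup → Prop} (ofIdx : ∀ i, p (weylGroup.ofIdx P i))
    (one : p 1) (mul : ∀ w w', p w → p w' → p (w * w')) (w : P.weylGroup) : p w :=
  weylGroup.induction P (pred := fun g hg ↦ p ⟨g, hg⟩) ofIdx one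
    (fun _ _ _ _ ↦ mul _ _) w.2

lemma ofIdx_smul_weight (i : ι) (v : V) : weylGroup.ofIdx P i • v = P.reflection i v := rfl

lemma ofIdx_smul_index (i k : ι) : weylGroup.ofIdx P i • k = P.reflectionPerm i k := rfl

lemma ofIdx_inv (i : ι) : (weylGroup.ofIdx P i)⁻¹ = weylGroup.ofIdx P i :=
  Subtype.ext (Equiv.reflection_inv P i)

lemma ofIdx_mul_self (i : ι) : weylGroup.ofIdx P i * weylGroup.ofIdx P i = 1 := by
  rw [mul_eq_one_iff_inv_eq, ofIdx_inv]

lemma ofIdx_smul_coweight (i : ι) (x : T) : weylGroup.ofIdx P i • x = P.coreflection i x :=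
  congrArg (fun g : P.Aut ↦ g.coweightMap x) (Equiv.reflection_inv P i)

lemma ofIdx_smul_mul (w : P.weylGroup) (i : ι) :
    weylGroup.ofIdx P (w • i) * w = w * weylGroup.ofIdx P i := by
  refine weylGroup_ext fun v ↦ ?_
  have hc : P.toLinearMap (w • v) (P.coroot (w • i)) = P.toLinearMap v (P.coroot i) := by
    rw [coroot_smul]
    exact pair_smul_smul w v _
  simp only [mul_smul, ofIdx_smul_weight, RootPairing.reflection_apply, coroot',
    LinearMap.flip_apply, hc, smul_sub, smul_comm w, root_smul]

lemma ofIdx_reflectionPerm (i j : ι) :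
    weylGroup.ofIdx P (P.reflectionPerm j i) =
      weylGroup.ofIdx P j * weylGroup.ofIdx P i * weylGroup.ofIdx P j := by
  rw [← ofIdx_smul_index, ← ofIdx_smul_mul (weylGroup.ofIdx P j) i, mul_assoc, ofIdx_mul_self,
    mul_one]

lemma sign_mul (w w' : P.weylGroup) : sign P (w * w') = sign P w * sign P w' := by
  simp only [sign, map_mul]

lemma sign_one : sign P 1 = 1 := by
  simp only [sign, map_one]

lemma sign_ofIdx [Module.Finite ℝ V] (i : ι) : sign P (weylGroup.ofIdx P i) = -1 := by
  have h : P.weylGroupRootRep (weylGroup.ofIdx P i) =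
      LinearMap.transvection (-P.coroot' i) (P.root i) := by
    ext v
    simp only [LinearMap.transvection.apply, LinearMap.neg_apply, neg_smul, ← sub_eq_add_neg]
    exact P.reflection_apply i v
  rw [sign, h, LinearMap.transvection.det, LinearMap.neg_apply, root_coroot'_eq_pairing,
    pairing_same]
  norm_num

section Flip

variable (P) in
/-- The anti-isomorphism from the automorphisms of a root pairing to those of its dual that
exchanges the actions on weights and coweights. -/
def autFlip : P.Aut ≃* P.flip.Autᵐᵒᵖ where
  toFun w := .op {
    weightMap := w.coweightMap
    coweightMap := w.weightMap
    indexEquiv := w.indexEquiv.symm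
    weight_coweight_transpose := LinearMap.ext fun v ↦ LinearMap.ext fun x ↦
      (LinearMap.congr_fun (Hom.weight_coweight_transpose_apply P P x w.toHom) v).symm
    root_weightMap := w.coroot_coweightMap
    coroot_coweightMap := w.root_weightMap
    bijective_weightMap := w.bijective_coweightMap
    bijective_coweightMap := w.bijective_weightMap }
  invFun w := {
    weightMap := w.unop.coweightMap
    coweightMap := w.unop.weightMap
    indexEquiv := w.unop.indexEquiv.symm
    weight_coweight_transpose := LinearMap.ext fun x ↦ LinearMap.ext fun v ↦
      (LinearMap.congr_fun
        (Hom.weight_coweight_transpose_apply P.flip P.flip v w.unop.toHom) x).symm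
    root_weightMap := w.unop.coroot_coweightMap
    coroot_coweightMap := w.unop.root_weightMap
    bijective_weightMap := w.unop.bijective_coweightMap
    bijective_coweightMap := w.unop.bijective_weightMap }
  left_inv _ := rfl
  right_inv _ := rfl
  map_mul' _ _ := rfl

lemma autFlip_reflection_inv (i : ι) :
    (autFlip P (Equiv.reflection P i)).unop⁻¹ = Equiv.reflection P.flip i := by
  have h : (autFlip P (Equiv.reflection P i)).unop = Equiv.reflection P.flip i :=
    Equiv.weightHom_injective _ (LinearEquiv.ext fun _ ↦ rfl)
  rw [h, Equiv.reflection_inv]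

variable (P) in
lemma map_weylGroup_autFlip :
    P.weylGroup.map ((autFlip P).trans (MulEquiv.inv' P.flip.Aut).symm).toMonoidHom =
      P.flip.weylGroup := by
  rw [weylGroup, MonoidHom.map_closure, ← Set.range_comp]
  congr 2
  ext1 i
  exact autFlip_reflection_inv i

variable (P) in
/-- The isomorphism of the Weyl groups of a root pairing and of its dual. -/
def weylGroupFlip : P.weylGroup ≃* P.flip.weylGroup :=
  (((autFlip P).trans (MulEquiv.inv' P.flip.Aut).symm).subgroupMap P.weylGroup).trans
    (MulEquiv.subgroupCongr (map_weylGroup_autFlip P))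

lemma weylGroupFlip_smul_coweight (w : P.weylGroup) (v : V) : weylGroupFlip P w • v = w • v :=
  congrArg (fun g : P.flip.Aut ↦ g.coweightMap v) (inv_inv (autFlip P w.1).unop)

lemma weylGroupFlip_ofIdx (i : ι) :
    weylGroupFlip P (weylGroup.ofIdx P i) = weylGroup.ofIdx P.flip i :=
  Subtype.ext (autFlip_reflection_inv i)

lemma sign_weylGroupFlip [Module.Finite ℝ V] [Module.Finite ℝ T] (w : P.weylGroup) :
    sign P.flip (weylGroupFlip P w) = sign P w := by
  induction w using weylGroup_induction with
  | ofIdx i => rw [weylGroupFlip_ofIdx, sign_ofIdx, sign_ofIdx]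
  | one => rw [map_one, sign_one, sign_one]
  | mul w w' h h' => rw [map_mul, sign_mul, sign_mul, h, h']

end Flip

section Words

variable (b : P.Base)

/-- The product of simple reflections spelled by a list of simple roots. -/
def word (l : List b.support) : P.weylGroup :=
  (l.map fun j : b.support ↦ weylGroup.ofIdx P j).prod

lemma word_append (l l' : List b.support) : word b (l ++ l') = word b l * word b l' := by
  simp only [word, List.map_append, List.prod_append]

lemma word_cons (j : b.support) (l : List b.support) :
    word b (j :: l) = weylGroup.ofIdx P (j : ι) * word b l :=
  List.prod_cons

lemma word_singleton (j : b.support) : word b [j] = weylGroup.ofIdx P (j : ι) :=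
  List.prod_singleton

lemma smul_reflectionPerm_self (w : P.weylGroup) (i : ι) :
    w • P.reflectionPerm i i = P.reflectionPerm (w • i) (w • i) := by
  rw [← ofIdx_smul_index, ← ofIdx_smul_index, ← mul_smul, ← mul_smul, ofIdx_smul_mul]

lemma word_deletion {l₁ l₂ : List b.support} {j k : b.support} (h : word b l₂ • (k : ι) = j) :
    word b (l₁ ++ j :: l₂ ++ [k]) = word b (l₁ ++ l₂) := by
  have hconj := ofIdx_smul_mul (word b l₂) (k : ι)
  rw [h] at hconj
  rw [word_append, word_append, word_cons, word_singleton, hconj, word_append, mul_assoc,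
    mul_assoc, ofIdx_mul_self, mul_one]

variable [Finite ι] [P.IsCrystallographic] [P.IsReduced]

lemma exists_word_eq (w : P.weylGroup) : ∃ l, w = word b l := by
  induction w using weylGroup_induction with
  | one => exact ⟨[], rfl⟩
  | mul w w' h h' =>
    obtain ⟨l, rfl⟩ := h
    obtain ⟨l', rfl⟩ := h'
    exact ⟨l ++ l', (word_append b l l').symm⟩
  | ofIdx i =>
    refine b.induction_reflect i (p := fun i ↦ ∃ l, weylGroup.ofIdx P i = word b l) ?_ ?_ ?_
    · rintro i ⟨l, hl⟩
      exact ⟨l, by rw [ofIdx_reflectionPerm, ofIdx_mul_self, one_mul, hl]⟩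
    · exact fun j hj ↦ ⟨[⟨j, hj⟩], (word_singleton b ⟨j, hj⟩).symm⟩
    · rintro i j ⟨l, hl⟩ hj
      refine ⟨⟨j, hj⟩ :: (l ++ [⟨j, hj⟩]), ?_⟩
      rw [ofIdx_reflectionPerm, word_cons, word_append, word_singleton, ← hl, mul_assoc]

/-- The exchange condition. -/
lemma exists_eq_append_of_not_isPos_word_smul {i : ι} (hi : b.IsPos i) {l : List b.support}
    (hl : ¬ b.IsPos (word b l • i)) :
    ∃ (l₁ : List b.support) (j : b.support) (l₂ : List b.support),
      l = l₁ ++ j :: l₂ ∧ word b l₂ • i = j := by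
  induction l with
  | nil => exact absurd ((one_smul P.weylGroup i).symm ▸ hi) hl
  | cons j l ih =>
    by_cases hpos : b.IsPos (word b l • i)
    · refine ⟨[], j, l, rfl, ?_⟩
      by_contra hne
      rw [word_cons, mul_smul] at hl
      exact hl (hpos.reflectionPerm j.2 hne)
    · obtain ⟨l₁, j', l₂, rfl, h⟩ := ih hpos
      exact ⟨j :: l₁, j', l₂, rfl, h⟩

lemma word_eq_one_of_isPos (l : List b.support)
    (hpos : ∀ j : b.support, b.IsPos (word b l • (j : ι))) : word b l = 1 := by
  induction hn : l.length using Nat.strong_induction_on generalizing l with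
  | h n ih =>
    rcases List.eq_nil_or_concat' l with rfl | ⟨l', k, rfl⟩
    · rfl
    have hneg : ¬ b.IsPos (word b l' • (k : ι)) := by
      have hk := hpos k
      rw [word_append, word_singleton, mul_smul, ofIdx_smul_index, smul_reflectionPerm_self] at hk
      exact (RootPairing.Base.IsPos.neg_iff_not b _).mp hk
    obtain ⟨l₁, j, l₂, rfl, h⟩ :=
      exists_eq_append_of_not_isPos_word_smul b (b.isPos_of_mem_support k.2) hneg
    rw [word_deletion b h] at hpos ⊢
    exact ih _ (by simp at hn ⊢; omega) _ hpos rfl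

lemma eq_one_of_isPos {w : P.weylGroup} (h : ∀ j : b.support, b.IsPos (w • (j : ι))) :
    w = 1 := by
  obtain ⟨l, rfl⟩ := exists_word_eq b w
  exact word_eq_one_of_isPos b l h

end Words

end WeylGroup

/-! ### The co-root form and the co-root lattice -/

section Coreflection

variable {ι V T : Type*} [AddCommGroup V] [Module ℝ V] [AddCommGroup T] [Module ℝ T]
  {P : RootPairing ι ℝ V T}

lemma reflection_eq (i : ι) (v : V) : P.reflection i v = v - pair P v (P.coroot i) • P.root i :=
  P.reflection_apply i v

lemma coreflection_eq (i : ι) (x : T) :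
    P.coreflection i x = x - pair P (P.root i) x • P.coroot i := P.coreflection_apply i x

lemma pair_root_coroot_self (i : ι) : pair P (P.root i) (P.coroot i) = 2 := P.root_coroot_two i

lemma pair_root_coreflection (i j : ι) (x : T) :
    pair P (P.root j) (P.coreflection i x) = pair P (P.root (P.reflectionPerm i j)) x :=
  P.flip.coroot'_reflection x

lemma pair_root_reflectionPerm_self (i : ι) (x : T) :
    pair P (P.root (P.reflectionPerm i i)) x = -pair P (P.root i) x := by
  simp [pair]

lemma pair_root_smul (w : P.weylGroup) (i : ι) (x : T) :
    pair P (P.root i) (w • x) = pair P (P.root (w⁻¹ • i)) x := by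
  rw [← pair_smul_smul w (P.root (w⁻¹ • i)), ← root_smul, smul_inv_smul]

lemma eq_zero_of_forall_pair_root_eq_zero [P.IsRootSystem] {x : T}
    (h : ∀ i, pair P (P.root i) x = 0) : x = 0 :=
  (RootPairing.eq_zero_iff_forall_coroot'_eq_zero (P := P.flip)).mpr h

end Coreflection

section CorootForm

variable {ι V T : Type*} [Fintype ι] [AddCommGroup V] [Module ℝ V] [AddCommGroup T] [Module ℝ T]
  {P : RootPairing ι ℝ V T}

lemma corootForm_self_nonneg (x : T) : 0 ≤ P.CorootForm x x := by
  rw [P.corootForm_apply_apply]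
  exact Finset.sum_nonneg fun _ _ ↦ mul_self_nonneg _

lemma corootForm_self_pos [P.IsRootSystem] {x : T} (hx : x ≠ 0) : 0 < P.CorootForm x x := by
  refine (corootForm_self_nonneg x).lt_of_ne' fun h ↦
    hx (eq_zero_of_forall_pair_root_eq_zero (P := P) fun i ↦ ?_)
  rw [P.corootForm_apply_apply, Finset.sum_eq_zero_iff_of_nonneg fun _ _ ↦ mul_self_nonneg _] at h
  exact mul_self_eq_zero.mp (h i (Finset.mem_univ i))

lemma corootForm_comm (x y : T) : P.CorootForm x y = P.CorootForm y x :=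
  P.flip.rootForm_symmetric.eq x y

lemma two_mul_corootForm_coroot (i : ι) (x : T) :
    2 * P.CorootForm (P.coroot i) x =
      P.CorootForm (P.coroot i) (P.coroot i) * pair P (P.root i) x := by
  have h := congrArg (pair P · x) (P.corootForm_self_smul_root i)
  simpa only [pair, map_smul, LinearMap.smul_apply, smul_eq_mul, two_nsmul, map_add,
    LinearMap.add_apply, P.toLinearMap_apply_CoPolarization, two_mul] using h.symm

lemma corootForm_sub_smul_coroot (x : T) (i : ι) (t : ℝ) :
    P.CorootForm (x - t • P.coroot i) (x - t • P.coroot i) = P.CorootForm x x +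
      P.CorootForm (P.coroot i) (P.coroot i) * (t * (t - pair P (P.root i) x)) := by
  simp only [map_sub, map_smul, LinearMap.sub_apply, LinearMap.smul_apply, smul_eq_mul,
    corootForm_comm x]
  linear_combination (-t) * two_mul_corootForm_coroot (P := P) i x

end CorootForm

section CorootLattice

variable {ι V T : Type*} [AddCommGroup V] [Module ℝ V] [AddCommGroup T] [Module ℝ T]
  {P : RootPairing ι ℝ V T}

lemma exists_intCast_eq_pair_root_of_mem_corootSpan [P.IsCrystallographic] {q : T}
    (hq : q ∈ P.corootSpan ℤ) (i : ι) : ∃ z : ℤ, pair P (P.root i) q = z :=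
  ⟨P.root'In ℤ i ⟨q, hq⟩, (P.algebraMap_root'In_apply ℤ i ⟨q, hq⟩).symm⟩

lemma exists_list_sum_eq_of_mem_corootSpan {q : T} (hq : q ∈ P.corootSpan ℤ) :
    ∃ l : List ι, (l.map P.coroot).sum = q := by
  have hneg : -Set.range P.coroot = Set.range P.coroot :=
    Set.ext fun _ ↦ P.neg_mem_range_coroot_iff
  rw [← Submodule.mem_toAddSubgroup, Submodule.span_int_eq_addSubgroupClosure,
    ← AddSubgroup.mem_toAddSubmonoid, AddSubgroup.closure_toAddSubmonoid, hneg,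
    Set.union_self] at hq
  obtain ⟨l, hl, rfl⟩ := AddSubmonoid.exists_list_of_mem_closure hq
  obtain ⟨l, rfl⟩ := (Set.range_list_map P.coroot).ge hl
  exact ⟨l, rfl⟩

lemma smul_mem_corootSpan (w : P.weylGroup) {q : T} (hq : q ∈ P.corootSpan ℤ) :
    w • q ∈ P.corootSpan ℤ := by
  induction hq using Submodule.span_induction with
  | mem x hx =>
    obtain ⟨i, rfl⟩ := hx
    exact coroot_smul w i ▸ Submodule.subset_span ⟨w • i, rfl⟩
  | zero => rw [smul_zero]; exact zero_mem _
  | add x y _ _ hx hy => exact smul_add w x y ▸ add_mem hx hy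
  | smul n x _ hx => exact smul_comm w n x ▸ Submodule.smul_mem _ n hx

variable [Finite ι] [P.IsRootSystem]

lemma exists_mem_list_pair_root_pos {l : List ι} (hl : (l.map P.coroot).sum ≠ 0) :
    ∃ i ∈ l, 0 < pair P (P.root i) (l.map P.coroot).sum := by
  let := Fintype.ofFinite ι
  set q := (l.map P.coroot).sum with hq
  have hsum : (l.map fun i ↦ P.CorootForm (P.coroot i) q).sum = P.CorootForm q q := by
    nth_rw 2 [hq]
    rw [← LinearMap.flip_apply, map_list_sum, List.map_map]
    rfl
  by_contra! hle
  refine absurd (corootForm_self_pos hl) (not_lt.mpr (hsum.symm.le.trans ?_))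
  refine (List.sum_le_card_nsmul _ 0 fun y hy ↦ ?_).trans_eq (smul_zero _)
  obtain ⟨i, hi, rfl⟩ := List.mem_map.mp hy
  linarith [two_mul_corootForm_coroot (P := P) i q,
    mul_nonpos_of_nonneg_of_nonpos (corootForm_self_nonneg (P := P) (P.coroot i)) (hle i hi)]

lemma eq_zero_of_forall_abs_pair_root_le_one [P.IsCrystallographic] {q : T}
    (hq : q ∈ P.corootSpan ℤ) (h : ∀ i, |pair P (P.root i) q| ≤ 1) : q = 0 := by
  classical
  obtain ⟨l, rfl⟩ := exists_list_sum_eq_of_mem_corootSpan hq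
  induction hn : l.length generalizing l with
  | zero => simp [List.length_eq_zero_iff.mp hn]
  | succ n ih =>
    by_contra hq0
    obtain ⟨i, hil, hi⟩ := exists_mem_list_pair_root_pos hq0
    have hi1 : pair P (P.root i) (l.map P.coroot).sum = 1 := by
      obtain ⟨z, hz⟩ := exists_intCast_eq_pair_root_of_mem_corootSpan hq i
      have hle := (abs_le.mp (h i)).2
      rw [hz] at hi hle ⊢
      norm_cast at hi hle ⊢
      omega
    -- reflecting in a root with value `1` shortens the expression of `q` as a sum of co-roots
    have hs : ((l.erase i).map P.coroot).sum = P.coreflection i (l.map P.coroot).sum := by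
      rw [coreflection_eq, hi1, one_smul, eq_sub_iff_add_eq', ← List.sum_cons, ← List.map_cons]
      exact ((List.perm_cons_erase hil).map _).sum_eq.symm
    have h0 := ih (l.erase i)
      (hs ▸ ofIdx_smul_coweight (P := P) i _ ▸ smul_mem_corootSpan _ hq)
      (fun j ↦ by rw [hs, pair_root_coreflection]; exact h _)
      (by rw [List.length_erase_of_mem hil]; omega)
    rw [hs] at h0
    exact hq0 ((map_eq_zero_iff _ (P.coreflection i).injective).mp h0)

end CorootLattice

/-! ### Coordinates of the elements of finite order -/

section SimplexPoints

variable {κ : Type*} [Fintype κ]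

/-- The lattice points `k` of the simplex `∑ m_j k_j ≤ M` of the closed positive orthant. -/
def closedPoints (m : κ → ℕ) (M : ℕ) : Set (κ → ℕ) := {k | ∑ j, m j * k j ≤ M}

/-- The lattice points `k` of the simplex `∑ m_j k_j < N` of the open positive orthant. -/
def openPoints (m : κ → ℕ) (N : ℕ) : Set (κ → ℕ) := {k | (∀ j, 0 < k j) ∧ ∑ j, m j * k j < N}

lemma finite_closedPoints {m : κ → ℕ} (hm : ∀ j, 0 < m j) (M : ℕ) : (closedPoints m M).Finite := by
  refine (Set.Finite.pi' fun _ ↦ Set.finite_Iic M).subset fun k hk j ↦ ?_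
  calc k j ≤ m j * k j := Nat.le_mul_of_pos_left _ (hm j)
    _ ≤ ∑ j, m j * k j :=
      Finset.single_le_sum (f := fun j ↦ m j * k j) (fun _ _ ↦ Nat.zero_le _) (Finset.mem_univ j)
    _ ≤ M := hk

lemma closedPoints_zero {m : κ → ℕ} (hm : ∀ j, 0 < m j) : closedPoints m 0 = {0} := by
  ext k
  simp [closedPoints, funext_iff, (hm _).ne']

lemma openPoints_add_eq_image (m : κ → ℕ) (M : ℕ) :
    openPoints m (M + (1 + ∑ j, m j)) = (fun k j ↦ k j + 1) '' closedPoints m M := by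
  have hmem (k : κ → ℕ) : (fun j ↦ k j + 1) ∈ openPoints m (M + (1 + ∑ j, m j)) ↔
      k ∈ closedPoints m M := by
    simp only [openPoints, closedPoints, Set.mem_ofPred_eq, Nat.succ_pos, mul_add, mul_one,
      Finset.sum_add_distrib, implies_true, true_and]
    omega
  refine Set.Subset.antisymm (fun k hk ↦ ?_) (Set.image_subset_iff.mpr fun k ↦ (hmem k).mpr)
  have hsucc : (fun j ↦ k j - 1 + 1) = k := funext fun j ↦ Nat.sub_add_cancel (hk.1 j)
  exact ⟨fun j ↦ k j - 1, (hmem _).mp (hsucc.symm ▸ hk), hsucc⟩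

lemma encard_openPoints_add (m : κ → ℕ) (M : ℕ) :
    (openPoints m (M + (1 + ∑ j, m j))).encard = (closedPoints m M).encard := by
  rw [openPoints_add_eq_image]
  exact Function.Injective.encard_image
    (fun k k' h ↦ funext fun j ↦ Nat.succ_injective (congrFun h j)) _

lemma openPoints_nonempty_iff {m : κ → ℕ} {N : ℕ} :
    (openPoints m N).Nonempty ↔ 1 + ∑ j, m j ≤ N := by
  constructor
  · rintro ⟨k, hpos, hk⟩
    have : ∑ j, m j ≤ ∑ j, m j * k j :=
      Finset.sum_le_sum fun j _ ↦ Nat.le_mul_of_pos_right _ (hpos j)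
    omega
  · intro h
    exact ⟨fun _ ↦ 1, fun _ ↦ one_pos, by simp only [mul_one]; omega⟩

end SimplexPoints

section Pair

variable {ι V T : Type*} [AddCommGroup V] [Module ℝ V] [AddCommGroup T] [Module ℝ T]
  {P : RootPairing ι ℝ V T}

lemma pair_sub (v : V) (x y : T) : pair P v (x - y) = pair P v x - pair P v y := map_sub _ _ _

lemma pair_smul (v : V) (c : ℝ) (x : T) : pair P v (c • x) = c * pair P v x := map_smul _ _ _

lemma add_pair (v v' : V) (x : T) : pair P (v + v') x = pair P v x + pair P v' x := by
  simp [pair]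

lemma sub_pair (v v' : V) (x : T) : pair P (v - v') x = pair P v x - pair P v' x := by
  simp [pair]

lemma sum_pair {κ : Type*} (s : Finset κ) (v : κ → V) (x : T) :
    pair P (∑ j ∈ s, v j) x = ∑ j ∈ s, pair P (v j) x := by
  simp [pair]

lemma smul_pair (c : ℝ) (v : V) (x : T) : pair P (c • v) x = c * pair P v x := by
  simp [pair]

end Pair

section FundamentalWeights

variable {ι V T : Type*} [AddCommGroup V] [Module ℝ V] [AddCommGroup T] [Module ℝ T]
  {P : RootPairing ι ℝ V T} [P.IsRootSystem] (b : P.Base)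

lemma pair_fundamentalWeight_eq_repr (j : b.support) (x : T) :
    pair P (fundamentalWeight b j) x = b.toCoweightBasis.repr x j :=
  LinearMap.congr_fun (P.toPerfPair.apply_symm_apply (b.toCoweightBasis.coord j)) x

lemma pair_fundamentalWeight (j k : b.support) [Decidable (j = k)] :
    pair P (fundamentalWeight b j) (P.coroot k) = if j = k then 1 else 0 := by
  classical
  rw [pair_fundamentalWeight_eq_repr, b.toCoweightBasis_repr_coroot, Finsupp.single_apply]
  exact if_congr eq_comm rfl rfl

end FundamentalWeights

section Coordinates

variable {ι V T : Type*} [AddCommGroup V] [Module ℝ V] [AddCommGroup T] [Module ℝ T]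
  {P : RootPairing ι ℝ V T} (b : P.Base)

lemma pair_root_eq_sum (i : ι) (x : T) :
    pair P (P.root i) x = ∑ j : b.support, (rootCoeff b i j : ℝ) * pair P (P.root j) x := by
  conv_lhs => rw [root_eq_sum_rootCoeff b i]
  simp only [sum_pair, ← Int.cast_smul_eq_zsmul ℝ, smul_pair]

lemma pair_highestRoot [Finite ι] [Nonempty ι] (x : T) :
    pair P (P.root (highestRoot b)) x = ∑ j : b.support, (mark b j : ℝ) * pair P (P.root j) x := by
  simp only [pair_root_eq_sum b (highestRoot b), ← mark_eq, Int.cast_natCast]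

lemma mem_coweightLattice_iff {y : T} :
    y ∈ coweightLattice P ↔ ∀ j : b.support, ∃ z : ℤ, pair P (P.root j) y = z := by
  refine ⟨fun h j ↦ h j, fun h i ↦ ?_⟩
  choose z hz using h
  exact ⟨∑ j, rootCoeff b i j * z j, by rw [pair_root_eq_sum b]; simp [hz]⟩

lemma chamberEFO_zero [Finite ι] [Nonempty ι] : chamberEFO b 0 = {0} := by
  refine Set.eq_singleton_iff_unique_mem.mpr ⟨⟨?_, 0, ?_, ?_⟩, ?_⟩
  · simp [chamber, pair]
  · exact fun i ↦ ⟨0, by simp [pair]⟩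
  · simp
  · rintro _ ⟨-, y, -, rfl⟩
    simp

/-- The isomorphism onto `𝔱` that sends `k` to the `x` with `⟨α_j, x⟩ = k_j`. -/
def ofCoords [P.IsRootSystem] : (b.support → ℝ) ≃ₗ[ℝ] T :=
  b.toWeightBasis.constr ℝ ≪≫ₗ P.flip.toPerfPair.symm

@[simp] lemma pair_root_ofCoords [P.IsRootSystem] (k : b.support → ℝ) (j : b.support) :
    pair P (P.root j) (ofCoords b k) = k j := by
  rw [← b.toWeightBasis_apply]
  exact (LinearMap.congr_fun (P.flip.toPerfPair.apply_symm_apply _) _).trans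
    (b.toWeightBasis.constr_basis ℝ k j)

lemma eq_of_forall_pair_simpleRoot_eq [P.IsRootSystem] {x y : T}
    (h : ∀ j : b.support, pair P (P.root j) x = pair P (P.root j) y) : x = y := by
  obtain ⟨k, rfl⟩ := (ofCoords b).surjective x
  obtain ⟨l, rfl⟩ := (ofCoords b).surjective y
  exact congrArg _ (funext fun j ↦ by simpa using h j)

end Coordinates

section EFOPoint

variable {ι V T : Type*} [AddCommGroup V] [Module ℝ V] [AddCommGroup T] [Module ℝ T]
  {P : RootPairing ι ℝ V T} (b : P.Base) [P.IsRootSystem]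

/-- The point `x` of adjoint order `N` with `N⟨α_j, x⟩ = k_j`; it is `0` for `N = 0`. -/
def efoPoint (N : ℕ) (k : b.support → ℕ) : T := (1 / (N : ℝ)) • ofCoords b (fun j ↦ (k j : ℝ))

lemma pair_root_efoPoint (N : ℕ) (k : b.support → ℕ) (j : b.support) :
    pair P (P.root j) (efoPoint b N k) = k j / N := by
  rw [efoPoint, pair_smul, pair_root_ofCoords, one_div_mul_eq_div]

lemma efoPoint_injective {N : ℕ} (hN : N ≠ 0) : Function.Injective (efoPoint b N) := by
  intro k k' h
  funext j
  have hj := congrArg (pair P (P.root j)) h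
  rw [pair_root_efoPoint, pair_root_efoPoint, div_left_inj' (Nat.cast_ne_zero.mpr hN)] at hj
  exact_mod_cast hj

lemma exists_efoPoint_eq {N : ℕ} (hN : N ≠ 0) {x : T} (hx : x ∈ adjointOrder P N)
    (h : ∀ j ∈ b.support, 0 ≤ pair P (P.root j) x) : ∃ k, efoPoint b N k = x := by
  obtain ⟨y, hy, rfl⟩ := hx
  have hNpos : (0 : ℝ) < 1 / N := by positivity
  have hy' : ∀ j : b.support, ∃ n : ℕ, (n : ℝ) = pair P (P.root j) y := by
    intro j
    obtain ⟨z, hz⟩ := hy j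
    have hz0 := h j j.2
    rw [pair_smul, mul_nonneg_iff_of_pos_left hNpos, hz, Int.cast_nonneg_iff] at hz0
    lift z to ℕ using hz0
    exact ⟨z, hz.symm⟩
  choose k hk using hy'
  exact ⟨k, congrArg _ (eq_of_forall_pair_simpleRoot_eq b fun j ↦ by simp [hk])⟩

lemma efoPoint_mem_adjointOrder (N : ℕ) (k : b.support → ℕ) :
    efoPoint b N k ∈ adjointOrder P N :=
  ⟨_, (mem_coweightLattice_iff b).mpr fun j ↦ ⟨k j, by simp⟩, rfl⟩

variable [Finite ι] [Nonempty ι]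

lemma pair_highestRoot_efoPoint (N : ℕ) (k : b.support → ℕ) :
    pair P (P.root (highestRoot b)) (efoPoint b N k) = (∑ j, mark b j * k j : ℕ) / N := by
  simp [pair_highestRoot, pair_root_efoPoint, Finset.sum_div, mul_div_assoc]

lemma efoPoint_mem_openChamberEFO_iff {N : ℕ} (hN : N ≠ 0) (k : b.support → ℕ) :
    efoPoint b N k ∈ openChamberEFO b N ↔ k ∈ openPoints (mark b) N := by
  have hNpos : (0 : ℝ) < N := by positivity
  simp only [openChamberEFO, openChamber, openPoints, Set.mem_inter_iff, Set.mem_ofPred_eq,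
    efoPoint_mem_adjointOrder, and_true, pair_highestRoot_efoPoint, div_lt_one hNpos,
    Nat.cast_lt]
  refine and_congr_left' ⟨fun h j ↦ ?_, fun h j hj ↦ ?_⟩
  · simpa [pair_root_efoPoint, hNpos] using h j j.2
  · simpa [pair_root_efoPoint b N k ⟨j, hj⟩, hNpos] using h ⟨j, hj⟩

lemma efoPoint_mem_chamberEFO_iff {N : ℕ} (hN : N ≠ 0) (k : b.support → ℕ) :
    efoPoint b N k ∈ chamberEFO b N ↔ k ∈ closedPoints (mark b) N := by
  have hNpos : (0 : ℝ) < N := by positivity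
  simp only [chamberEFO, chamber, closedPoints, Set.mem_inter_iff, Set.mem_ofPred_eq,
    efoPoint_mem_adjointOrder, and_true, pair_highestRoot_efoPoint, div_le_one hNpos,
    Nat.cast_le, and_iff_right_iff_imp]
  intro _ j hj
  rw [pair_root_efoPoint b N k ⟨j, hj⟩]
  positivity

lemma encard_openChamberEFO {N : ℕ} (hN : N ≠ 0) :
    (openChamberEFO b N).encard = (openPoints (mark b) N).encard := by
  have himage : efoPoint b N '' openPoints (mark b) N = openChamberEFO b N := by
    refine Set.Subset.antisymm
      (Set.image_subset_iff.mpr fun k ↦ (efoPoint_mem_openChamberEFO_iff b hN k).mpr) fun x hx ↦ ?_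
    obtain ⟨k, rfl⟩ := exists_efoPoint_eq b hN hx.2 fun j hj ↦ (hx.1.1 j hj).le
    exact ⟨k, (efoPoint_mem_openChamberEFO_iff b hN k).mp hx, rfl⟩
  rw [← himage, (efoPoint_injective b hN).encard_image]

lemma encard_openChamberEFO_add (M : ℕ) :
    (openChamberEFO b (M + coxeterNumber b)).encard = (closedPoints (mark b) M).encard := by
  rw [encard_openChamberEFO b (by rw [coxeterNumber]; omega), coxeterNumber, encard_openPoints_add]

variable [P.IsCrystallographic] [P.IsReduced] [P.IsIrreducible]

lemma encard_chamberEFO (M : ℕ) :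
    (chamberEFO b M).encard = (closedPoints (mark b) M).encard := by
  rcases eq_or_ne M 0 with rfl | hM
  · rw [chamberEFO_zero, closedPoints_zero (mark_pos b), Set.encard_singleton,
      Set.encard_singleton]
  have himage : efoPoint b M '' closedPoints (mark b) M = chamberEFO b M := by
    refine Set.Subset.antisymm
      (Set.image_subset_iff.mpr fun k ↦ (efoPoint_mem_chamberEFO_iff b hM k).mpr) fun x hx ↦ ?_
    obtain ⟨k, rfl⟩ := exists_efoPoint_eq b hM hx.2 hx.1.1
    exact ⟨k, (efoPoint_mem_chamberEFO_iff b hM k).mp hx, rfl⟩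
  rw [← himage, (efoPoint_injective b hM).encard_image]

end EFOPoint

section Monomials

variable {ι V T : Type*} [Finite ι] [Nonempty ι] [AddCommGroup V] [Module ℝ V] [AddCommGroup T]
  [Module ℝ T] {P : RootPairing ι ℝ V T} (b : P.Base)

lemma mDegree_eq_sum (l : b.support →₀ ℕ) : mDegree b l = ∑ j, comark b j * l j := by
  rw [mDegree, Finsupp.weight_apply, Finsupp.sum_fintype _ _ (by simp)]
  simp [mul_comm]

lemma encard_monomialsLE (M : ℕ) :
    (monomialsLE b M).encard = (closedPoints (comark b) M).encard := by
  have himage : (fun l ↦ MvPolynomial.monomial l (1 : ℂ)) ''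
      ((⇑) ⁻¹' closedPoints (comark b) M) = monomialsLE b M := by
    ext p
    simp [monomialsLE, mDegree_eq_sum, closedPoints, eq_comm]
  rw [← himage, (MvPolynomial.monomial_left_injective one_ne_zero).encard_image]
  exact Set.encard_preimage_of_bijective Finsupp.equivFunOnFinite.bijective _

end Monomials

/-! ### The action of the Weyl group on the torus points of adjoint order `N` -/

section TorusEFO

variable {ι V T : Type*} [AddCommGroup V] [Module ℝ V] [AddCommGroup T] [Module ℝ T]
  (P : RootPairing ι ℝ V T) (N : ℕ)

lemma exists_intCast_eq_mul_pair_root {P : RootPairing ι ℝ V T} {N : ℕ} {x : T}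
    (hx : x ∈ adjointOrder P N) (i : ι) : ∃ z : ℤ, N * pair P (P.root i) x = z := by
  obtain ⟨y, hy, rfl⟩ := hx
  obtain ⟨z, hz⟩ := hy i
  rcases eq_or_ne N 0 with rfl | hN
  · exact ⟨0, by simp⟩
  · exact ⟨z, by rw [pair_smul, hz]; field_simp⟩

/-- The co-weight lattice as a subgroup of `𝔱`. -/
def coweightSubgroup : AddSubgroup T where
  carrier := coweightLattice P
  zero_mem' i := ⟨0, by simp [pair]⟩
  add_mem' {x y} hx hy i := by
    obtain ⟨z, hz⟩ := hx i
    obtain ⟨z', hz'⟩ := hy i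
    exact ⟨z + z', by rw [Int.cast_add, ← hz, ← hz', pair, map_add]; rfl⟩
  neg_mem' {x} hx i := by
    obtain ⟨z, hz⟩ := hx i
    exact ⟨-z, by rw [Int.cast_neg, ← hz, pair, map_neg]; rfl⟩

/-- The group `(1/N) P̌` of the points of adjoint order `N`. -/
def adjointOrderSubgroup : AddSubgroup T :=
  ((coweightSubgroup P).map (DistribSMul.toAddMonoidHom T (1 / (N : ℝ)))).copy (adjointOrder P N)
    (Set.ext fun _ ↦ exists_congr fun _ ↦ and_congr_right' eq_comm)

/-- The group `(1/N) P̌ / Q̌` of the elements of adjoint order `N` of the maximal torus `𝔱 / Q̌`,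
where `Q̌` is the co-root lattice. -/
abbrev TorusEFO : Type _ :=
  adjointOrderSubgroup P N ⧸
    (P.corootSpan ℤ).toAddSubgroup.addSubgroupOf (adjointOrderSubgroup P N)

variable {P N}

lemma smul_mem_adjointOrder (w : P.weylGroup) {x : T} (hx : x ∈ adjointOrder P N) :
    w • x ∈ adjointOrder P N := by
  obtain ⟨y, hy, rfl⟩ := hx
  refine ⟨w • y, fun i ↦ ?_, smul_comm (MulOpposite.op w.1⁻¹) _ y⟩
  obtain ⟨z, hz⟩ := hy (w⁻¹ • i)
  exact ⟨z, by rw [pair_root_smul, hz]⟩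

lemma corootSpan_subset_adjointOrder [P.IsCrystallographic] (hN : N ≠ 0) {q : T}
    (hq : q ∈ P.corootSpan ℤ) : q ∈ adjointOrder P N := by
  refine ⟨(N : ℝ) • q, fun i ↦ ?_, ?_⟩
  · obtain ⟨z, hz⟩ := exists_intCast_eq_pair_root_of_mem_corootSpan hq i
    exact ⟨N * z, by simp [pair_smul, hz]⟩
  · rw [smul_smul, one_div_mul_cancel (Nat.cast_ne_zero.mpr hN), one_smul]

instance : DistribMulAction P.weylGroup (adjointOrderSubgroup P N) where
  smul w x := ⟨w • (x : T), smul_mem_adjointOrder w x.2⟩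
  one_smul x := Subtype.ext (one_smul P.weylGroup (x : T))
  mul_smul w w' x := Subtype.ext (mul_smul w w' (x : T))
  smul_zero w := Subtype.ext (smul_zero (A := T) w)
  smul_add w x y := Subtype.ext (smul_add w (x : T) y)

lemma coe_smul_adjointOrderSubgroup (w : P.weylGroup) (x : adjointOrderSubgroup P N) :
    ((w • x : adjointOrderSubgroup P N) : T) = w • (x : T) := rfl

instance : DistribMulAction P.weylGroup (TorusEFO P N) where
  smul w := QuotientAddGroup.map _ _ (DistribSMul.toAddMonoidHom _ w)
    fun _ hx ↦ smul_mem_corootSpan w hx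
  one_smul a := QuotientAddGroup.induction_on a fun x ↦ congrArg _ (one_smul P.weylGroup x)
  mul_smul w w' a := QuotientAddGroup.induction_on a fun x ↦ congrArg _ (mul_smul w w' x)
  smul_zero _ := map_zero _
  smul_add _ := map_add _

lemma smul_mk (w : P.weylGroup) (x : adjointOrderSubgroup P N) :
    w • (x : TorusEFO P N) = (w • x : adjointOrderSubgroup P N) := rfl

lemma mk_eq_mk_iff {x y : adjointOrderSubgroup P N} :
    (x : TorusEFO P N) = y ↔ (y - x : T) ∈ P.corootSpan ℤ := by
  rw [QuotientAddGroup.eq, AddSubgroup.mem_addSubgroupOf, AddSubgroup.coe_add, NegMemClass.coe_neg,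
    neg_add_eq_sub, Submodule.mem_toAddSubgroup]

lemma ofIdx_smul_mk_of_pair_root_eq_intCast {i : ι} {x : adjointOrderSubgroup P N} {k : ℤ}
    (hk : pair P (P.root i) x = k) :
    RootPairing.weylGroup.ofIdx P i • (x : TorusEFO P N) = x := by
  rw [smul_mk, mk_eq_mk_iff, coe_smul_adjointOrderSubgroup, ofIdx_smul_coweight, coreflection_eq,
    hk, sub_sub_cancel, Int.cast_smul_eq_zsmul]
  exact Submodule.smul_mem _ _ (Submodule.subset_span ⟨i, rfl⟩)

end TorusEFO

section OpenChamber

variable {ι V T : Type*} [Finite ι] [Nonempty ι] [AddCommGroup V] [Module ℝ V] [AddCommGroup T]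
  [Module ℝ T] {P : RootPairing ι ℝ V T} {b : P.Base}

lemma pair_root_pos_of_mem_openChamber {x : T} (hx : x ∈ openChamber b) {i : ι} (hi : b.IsPos i) :
    0 < pair P (P.root i) x := by
  rw [pair_root_eq_sum b]
  obtain ⟨j, hj⟩ := exists_rootCoeff_ne_zero b i
  refine Finset.sum_pos' (fun j _ ↦ mul_nonneg ?_ (hx.1 j j.2).le)
    ⟨j, Finset.mem_univ _, mul_pos ?_ (hx.1 j j.2)⟩
  · exact_mod_cast rootCoeff_nonneg hi j
  · exact_mod_cast (rootCoeff_nonneg hi j).lt_of_ne' hj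

lemma isPos_of_pair_root_pos {x : T} (hx : x ∈ openChamber b) {i : ι}
    (hi : 0 < pair P (P.root i) x) : b.IsPos i := by
  by_contra hneg
  have h : 0 < pair P (P.root (P.reflectionPerm i i)) x :=
    pair_root_pos_of_mem_openChamber hx ((RootPairing.Base.IsPos.neg_iff_not b i).mpr hneg)
  rw [pair_root_reflectionPerm_self] at h
  linarith

variable [P.IsCrystallographic] [P.IsReduced]

lemma eq_one_of_smul_mem_openChamber {x : T} (hx : x ∈ openChamber b) {w : P.weylGroup}
    (hwx : w • x ∈ openChamber b) : w = 1 :=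
  eq_one_of_isPos b fun j ↦ isPos_of_pair_root_pos hwx <| by
    rw [root_smul, pair_smul_smul]
    exact hx.1 j j.2

variable [P.IsIrreducible]

lemma pair_root_lt_one_of_mem_openChamber {x : T} (hx : x ∈ openChamber b) (i : ι) :
    pair P (P.root i) x < 1 := by
  refine lt_of_le_of_lt ?_ hx.2
  rw [pair_root_eq_sum b, pair_root_eq_sum b (highestRoot b)]
  exact Finset.sum_le_sum fun j _ ↦ mul_le_mul_of_nonneg_right
    (by exact_mod_cast rootCoeff_le_highestRoot b i j) (hx.1 j j.2).le

lemma abs_pair_root_lt_one_of_mem_openChamber {x : T} (hx : x ∈ openChamber b) (i : ι) :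
    |pair P (P.root i) x| < 1 := by
  have hneg := pair_root_lt_one_of_mem_openChamber hx (P.reflectionPerm i i)
  rw [pair_root_reflectionPerm_self] at hneg
  exact abs_lt.mpr ⟨by linarith, pair_root_lt_one_of_mem_openChamber hx i⟩

variable [P.IsRootSystem]

lemma eq_of_sub_mem_corootSpan_of_mem_openChamber {x y : T} (hx : x ∈ openChamber b)
    (hy : y ∈ openChamber b) {w : P.weylGroup} (h : y - w • x ∈ P.corootSpan ℤ) : y = w • x := by
  refine sub_eq_zero.mp (eq_zero_of_forall_abs_pair_root_le_one h fun i ↦ ?_)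
  obtain ⟨z, hz⟩ := exists_intCast_eq_pair_root_of_mem_corootSpan h i
  have hlt : |(z : ℝ)| < 2 := by
    rw [← hz, pair_sub, pair_root_smul]
    linarith [abs_sub (pair P (P.root i) y) (pair P (P.root (w⁻¹ • i)) x),
      abs_pair_root_lt_one_of_mem_openChamber hy i,
      abs_pair_root_lt_one_of_mem_openChamber hx (w⁻¹ • i)]
  rw [hz]
  have : |z| < 2 := by exact_mod_cast hlt
  exact_mod_cast Int.lt_add_one_iff.mp this

lemma eq_one_and_eq_of_smul_mk_eq_mk {N : ℕ} {x y : adjointOrderSubgroup P N}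
    (hx : (x : T) ∈ openChamber b) (hy : (y : T) ∈ openChamber b) {w : P.weylGroup}
    (h : w • (x : TorusEFO P N) = y) : w = 1 ∧ x = y := by
  have hyx := eq_of_sub_mem_corootSpan_of_mem_openChamber hx hy (mk_eq_mk_iff.mp h)
  have hw := eq_one_of_smul_mem_openChamber hx (hyx ▸ hy)
  exact ⟨hw, Subtype.ext (by rw [hyx, hw, one_smul])⟩

end OpenChamber

section AlcoveEnergy

variable {ι V T : Type*} [AddCommGroup V] [Module ℝ V] [AddCommGroup T] [Module ℝ T]
  {P : RootPairing ι ℝ V T} (b : P.Base)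

lemma height_highestRoot_add_one [Finite ι] [Nonempty ι] :
    b.height (highestRoot b) + 1 = coxeterNumber b := by
  rw [height_eq_sum_rootCoeff, coxeterNumber]
  simp [mark_eq, add_comm]

variable [P.IsRootSystem]

/-- The co-weight `ρ̌`, on which all the simple roots take the value `1`. -/
def coRho : T := ofCoords b 1

lemma pair_root_coRho (i : ι) : pair P (P.root i) (coRho b) = b.height i := by
  rw [pair_root_eq_sum b, height_eq_sum_rootCoeff]
  simp [coRho]

variable [Fintype ι] [Nonempty ι]

/-- The squared distance of `h x` from `ρ̌`. Its minimum on an orbit of the affine Weyl group is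
attained in the simplex `F`, since `ρ̌ / h` is an interior point of `F`. -/
def alcoveEnergy (x : T) : ℝ :=
  P.CorootForm ((coxeterNumber b : ℝ) • x - coRho b) ((coxeterNumber b : ℝ) • x - coRho b)

lemma exists_natCast_eq_alcoveEnergy {N : ℕ} {x : T} (hx : x ∈ adjointOrder P N) :
    ∃ n : ℕ, (N : ℝ) ^ 2 * alcoveEnergy b x = n := by
  choose z hz using exists_intCast_eq_mul_pair_root hx
  refine ⟨∑ i, ((coxeterNumber b * z i - N * b.height i) ^ 2).natAbs, ?_⟩
  rw [alcoveEnergy, P.corootForm_apply_apply, Finset.mul_sum]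
  push_cast
  refine Finset.sum_congr rfl fun i _ ↦ ?_
  change _ * (pair P _ _ * pair P _ _) = _
  rw [Nat.cast_natAbs, abs_of_nonneg (sq_nonneg _), pair_sub, pair_smul, pair_root_coRho]
  push_cast
  rw [← hz]
  ring

lemma alcoveEnergy_coreflection_add (x : T) (i : ι) (k : ℤ) :
    alcoveEnergy b (P.coreflection i x + k • P.coroot i) = alcoveEnergy b x +
      P.CorootForm (P.coroot i) (P.coroot i) * (coxeterNumber b *
        ((pair P (P.root i) x - k) * (b.height i - coxeterNumber b * k))) := by
  have hsub : (coxeterNumber b : ℝ) • (P.coreflection i x + k • P.coroot i) - coRho b =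
      ((coxeterNumber b : ℝ) • x - coRho b) -
        ((coxeterNumber b : ℝ) * (pair P (P.root i) x - k)) • P.coroot i := by
    rw [coreflection_eq, ← Int.cast_smul_eq_zsmul ℝ]
    module
  rw [alcoveEnergy, alcoveEnergy, hsub, corootForm_sub_smul_coroot, pair_sub, pair_smul,
    pair_root_coRho]
  ring

lemma mem_chamber_of_forall_alcoveEnergy_le {x : T}
    (h : ∀ i (k : ℤ), alcoveEnergy b x ≤ alcoveEnergy b (P.coreflection i x + k • P.coroot i)) :
    x ∈ chamber b := by
  have key (i : ι) (k : ℤ) :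
      0 ≤ (pair P (P.root i) x - k) * (b.height i - coxeterNumber b * k) := by
    have hcoroot : 0 < P.CorootForm (P.coroot i) (P.coroot i) :=
      corootForm_self_pos (P.flip.ne_zero i)
    have hcox : (0 : ℝ) < coxeterNumber b := by rw [coxeterNumber]; positivity
    have hik := h i k
    rwa [alcoveEnergy_coreflection_add, le_add_iff_nonneg_right, mul_nonneg_iff_of_pos_left hcoroot,
      mul_nonneg_iff_of_pos_left hcox] at hik
  refine ⟨fun j hj ↦ ?_, ?_⟩
  · simpa [RootPairing.Base.height_one_of_mem_support hj] using key j 0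
  · have hheight : (b.height (highestRoot b) : ℝ) + 1 = coxeterNumber b := by
      exact_mod_cast height_highestRoot_add_one b
    have hle := key (highestRoot b) 1
    rw [Int.cast_one, mul_one, ← hheight, sub_add_cancel_left] at hle
    linarith

end AlcoveEnergy

section ClosedChamber

variable {ι V T : Type*} [Finite ι] [Nonempty ι] [AddCommGroup V] [Module ℝ V] [AddCommGroup T]
  [Module ℝ T] {P : RootPairing ι ℝ V T} (b : P.Base) {N : ℕ}

lemma exists_ofIdx_smul_eq_of_notMem_openChamber {x : adjointOrderSubgroup P N}
    (hx : (x : T) ∈ chamber b) (hx' : (x : T) ∉ openChamber b) :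
    ∃ i, RootPairing.weylGroup.ofIdx P i • (x : TorusEFO P N) = x := by
  by_contra! h
  have hne (i : ι) (k : ℤ) : pair P (P.root i) x ≠ k :=
    fun hk ↦ h i (ofIdx_smul_mk_of_pair_root_eq_intCast hk)
  exact hx' ⟨fun j hj ↦ (hx.1 j hj).lt_of_ne' (by simpa using hne j 0),
    hx.2.lt_of_ne (by simpa using hne (highestRoot b) 1)⟩

variable [P.IsRootSystem] [P.IsCrystallographic]

lemma exists_smul_eq_mk_mem_chamber (hN : N ≠ 0) (a : TorusEFO P N) :
    ∃ w : P.weylGroup, ∃ x : adjointOrderSubgroup P N, (x : T) ∈ chamber b ∧ w • a = x := by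
  let := Fintype.ofFinite ι
  choose E hE using fun x : adjointOrderSubgroup P N ↦ exists_natCast_eq_alcoveEnergy b x.2
  set S : Set (adjointOrderSubgroup P N) := {x | ∃ w : P.weylGroup, w • a = x}
  obtain ⟨x₀, rfl⟩ := QuotientAddGroup.mk_surjective a
  have hS : S.Nonempty := ⟨x₀, 1, one_smul _ _⟩
  set x := Function.argminOn E S hS
  obtain ⟨w, hw⟩ : x ∈ S := Function.argminOn_mem E S hS
  refine ⟨w, x, mem_chamber_of_forall_alcoveEnergy_le b fun i k ↦ ?_, hw⟩
  have hk : k • P.coroot i ∈ P.corootSpan ℤ :=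
    Submodule.smul_mem _ _ (Submodule.subset_span ⟨i, rfl⟩)
  let x' : adjointOrderSubgroup P N := RootPairing.weylGroup.ofIdx P i • x +
    ⟨k • P.coroot i, corootSpan_subset_adjointOrder hN hk⟩
  have hx' : (x' : T) = P.coreflection i x + k • P.coroot i :=
    congrArg (· + _) (ofIdx_smul_coweight i (x : T))
  have hmem : x' ∈ S := by
    refine ⟨RootPairing.weylGroup.ofIdx P i * w, ?_⟩
    rw [mul_smul, hw, smul_mk, mk_eq_mk_iff]
    simpa [x'] using hk
  have hle : (E x : ℝ) ≤ E x' := Nat.cast_le.mpr (Function.argminOn_le E S hmem)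
  rwa [← hE, ← hE, mul_le_mul_iff_of_pos_left (by positivity), hx'] at hle

variable [P.IsReduced] [P.IsIrreducible]

lemma finite_chamberEFO : (chamberEFO b N).Finite := by
  rw [← Set.encard_lt_top_iff, encard_chamberEFO, Set.encard_lt_top_iff]
  exact finite_closedPoints (mark_pos b) N

lemma finite_openChamberEFO : (openChamberEFO b N).Finite :=
  (finite_chamberEFO b).subset
    (Set.inter_subset_inter_left _ fun _ hx ↦ ⟨fun j hj ↦ (hx.1 j hj).le, hx.2.le⟩)

include b in
lemma finite_torusEFO (hN : N ≠ 0) : Finite (TorusEFO P N) := by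
  have := finite_weylGroup P
  have := (finite_chamberEFO b (N := N)).to_subtype
  refine Finite.of_surjective (fun p : P.weylGroup × chamberEFO b N ↦
    p.1⁻¹ • ((⟨p.2, p.2.2.2⟩ : adjointOrderSubgroup P N) : TorusEFO P N)) fun a ↦ ?_
  obtain ⟨w, x, hx, h⟩ := exists_smul_eq_mk_mem_chamber b hN a
  exact ⟨(w, ⟨x, hx, x.2⟩), inv_smul_eq_iff.mpr h.symm⟩

end ClosedChamber

/-! ### Signed orbit counting -/

section SignedCount

variable {G X : Type*} [Group G] [Fintype G] [MulAction G X] (ε : G →* ℝ)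

open scoped Classical in
lemma sum_stabilizer_eq_zero {x : X} {s : G} (hs : ε s = -1) (hsx : s • x = x) :
    ∑ g, (if g • x = x then ε g else 0) = 0 := by
  have hne : ε.comp (MulAction.stabilizer G x).subtype ≠ 1 := fun h ↦ by
    have hs1 : ε s = 1 := DFunLike.congr_fun h ⟨s, hsx⟩
    norm_num [hs1] at hs
  rw [← Finset.sum_filter, ← sum_hom_units_eq_zero _ hne]
  exact Finset.sum_subtype _ (by simp [MulAction.mem_stabilizer_iff]) _

variable {D : Set X} (hfree : ∀ x ∈ D, ∀ g : G, g • x ∈ D → g = 1)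

include hfree

lemma card_orbits_eq :
    Nat.card {x : X | ∃ g : G, g • x ∈ D} = Fintype.card G * Nat.card D := by
  rw [← Nat.card_eq_fintype_card, ← Nat.card_prod]
  refine (Nat.card_congr (Equiv.ofBijective
    (fun p : G × D ↦ ⟨p.1 • (p.2 : X), p.1⁻¹, by simp⟩) ⟨?_, ?_⟩)).symm
  · rintro ⟨g, x⟩ ⟨g', x'⟩ h
    have hgx : g • (x : X) = g' • (x' : X) := congrArg Subtype.val h
    have hmem : (g'⁻¹ * g) • (x : X) = x' := by rw [mul_smul, hgx, inv_smul_smul]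
    have hg : g = g' := (inv_mul_eq_one.mp (hfree x x.2 _ (hmem ▸ x'.2))).symm
    subst hg
    exact Prod.ext rfl (Subtype.ext (smul_left_cancel g hgx))
  · rintro ⟨x, g, hg⟩
    exact ⟨(g⁻¹, ⟨g • x, hg⟩), Subtype.ext (inv_smul_smul g x)⟩

/-- Over each point, the sum counts the signs of the stabilizer. -/
lemma sum_mul_card_fixedBy [Finite X]
    (hfix : ∀ x : X, (∃ g : G, g • x ∈ D) ∨ ∃ s : G, ε s = -1 ∧ s • x = x) :
    ∑ g, ε g * Nat.card (MulAction.fixedBy X g) = Fintype.card G * Nat.card D := by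
  classical
  let := Fintype.ofFinite X
  have hstab (x : X) : ∑ g, (if g • x = x then ε g else 0) =
      if ∃ g : G, g • x ∈ D then 1 else 0 := by
    split_ifs with h
    · obtain ⟨u, hu⟩ := h
      have htriv (g : G) : g • x = x ↔ g = 1 := by
        refine ⟨fun hg ↦ ?_, fun hg ↦ hg ▸ one_smul G x⟩
        have := hfree _ hu (u * g * u⁻¹) (by rwa [mul_smul, mul_smul, inv_smul_smul, hg])
        simpa [mul_inv_eq_one] using this
      simp [htriv]
    · obtain ⟨s, hs, hsx⟩ := (hfix x).resolve_left h
      exact sum_stabilizer_eq_zero ε hs hsx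
  calc ∑ g, ε g * Nat.card (MulAction.fixedBy X g)
      = ∑ g, ∑ x : X, if g • x = x then ε g else 0 := by
        refine Finset.sum_congr rfl fun g _ ↦ ?_
        rw [← Finset.sum_filter, Finset.sum_const, nsmul_eq_mul, mul_comm,
          Nat.card_eq_fintype_card, Fintype.card_subtype]
        rfl
    _ = ∑ x : X, if ∃ g : G, g • x ∈ D then 1 else 0 := by
        rw [Finset.sum_comm]
        exact Finset.sum_congr rfl fun x _ ↦ hstab x
    _ = Fintype.card G * Nat.card D := by
        rw [Finset.sum_boole, ← Fintype.card_subtype, ← Nat.cast_mul, ← card_orbits_eq hfree,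
          Nat.card_eq_fintype_card]
        rfl

end SignedCount

section SignedCountEFO

variable {ι V T : Type*} [Finite ι] [AddCommGroup V] [Module ℝ V] [AddCommGroup T] [Module ℝ T]
  {P : RootPairing ι ℝ V T}

variable (P) in
/-- The sign character of the Weyl group as a monoid homomorphism. -/
def signHom : P.weylGroup →* ℝ where
  toFun := sign P
  map_one' := sign_one
  map_mul' := sign_mul

variable [Nonempty ι] [P.IsRootSystem] [P.IsCrystallographic] [P.IsReduced] [P.IsIrreducible]
  (b : P.Base) {N : ℕ}

/-- The images of the points of `F°_N` in `(1/N) P̌ / Q̌`. -/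
def openChamberTorus (N : ℕ) : Set (TorusEFO P N) :=
  (↑) '' {x : adjointOrderSubgroup P N | (x : T) ∈ openChamber b}

lemma card_openChamberTorus : Nat.card (openChamberTorus b N) = Nat.card (openChamberEFO b N) := by
  have hinj : Set.InjOn ((↑) : adjointOrderSubgroup P N → TorusEFO P N)
      {x | (x : T) ∈ openChamber b} := fun x hx y hy h ↦
    (eq_one_and_eq_of_smul_mk_eq_mk hx hy (w := 1) (by rwa [one_smul])).2
  rw [openChamberTorus, Nat.card_image_of_injOn hinj,
    ← Nat.card_image_of_injective Subtype.val_injective]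
  exact congrArg (fun s : Set T ↦ Nat.card s)
    ((Subtype.image_preimage_coe _ _).trans (Set.inter_comm _ _))

lemma sum_sign_mul_card_fixedBy (hN : N ≠ 0) :
    ∑ w, sign P w * Nat.card (MulAction.fixedBy (TorusEFO P N) w) =
      Fintype.card P.weylGroup * Nat.card (openChamberEFO b N) := by
  have := finite_torusEFO b hN
  have := Module.Finite.of_basis b.toWeightBasis
  rw [← card_openChamberTorus b]
  refine sum_mul_card_fixedBy (signHom P) ?_ fun a ↦ ?_
  · rintro _ ⟨x, hx, rfl⟩ w ⟨y, hy, h⟩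
    exact (eq_one_and_eq_of_smul_mk_eq_mk hx hy h.symm).1
  obtain ⟨w, x, hx, hwa⟩ := exists_smul_eq_mk_mem_chamber b hN a
  by_cases hx' : (x : T) ∈ openChamber b
  · exact .inl ⟨w, hwa ▸ ⟨x, hx', rfl⟩⟩
  obtain ⟨i, hi⟩ := exists_ofIdx_smul_eq_of_notMem_openChamber b hx hx'
  refine .inr ⟨RootPairing.weylGroup.ofIdx P (w⁻¹ • i), sign_ofIdx _, ?_⟩
  rw [← smul_left_cancel_iff w, ← mul_smul, ← ofIdx_smul_mul, smul_inv_smul, mul_smul, hwa, hi]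

end SignedCountEFO

section FiniteDuality

variable {A B : Type*} [AddCommGroup A] [AddCommGroup B]

open scoped Classical in
lemma sum_toCircle [Fintype A] (φ : A →+ AddCircle (1 : ℝ)) :
    ∑ a, ((φ a).toCircle : ℂ) = if φ = 0 then (Fintype.card A : ℂ) else 0 := by
  let χ := Circle.coeHom.compAddChar (AddCircle.toCircle_addChar.compAddMonoidHom φ)
  have hχ : χ = 0 ↔ φ = 0 := by
    rw [AddChar.eq_zero_iff, DFunLike.ext_iff]
    refine forall_congr' fun a ↦ ?_
    change ((φ a).toCircle : ℂ) = 1 ↔ _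
    rw [Circle.coe_eq_one, ← AddCircle.toCircle_zero,
      (AddCircle.injective_toCircle one_ne_zero).eq_iff, AddMonoidHom.zero_apply]
  simp only [← hχ]
  exact AddChar.sum_eq_ite χ

variable [Finite A] [Finite B]

lemma card_eq_of_pairing (ψ : A →+ B →+ AddCircle (1 : ℝ)) (hA : Function.Injective ψ)
    (hB : Function.Injective ψ.flip) : Nat.card A = Nat.card B := by
  classical
  let := Fintype.ofFinite A
  let := Fintype.ofFinite B
  have h : ∑ a, ∑ b, ((ψ a b).toCircle : ℂ) = ∑ b, ∑ a, ((ψ.flip b a).toCircle : ℂ) :=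
    Finset.sum_comm
  simp only [sum_toCircle, map_eq_zero_iff _ hA, map_eq_zero_iff _ hB, Finset.sum_ite_eq',
    Finset.mem_univ, if_true] at h
  simpa using h.symm

/-- Both sides are computed from the sum of the pairing of `f a - a` with `b`. -/
lemma card_fixedPoints_eq_of_pairing (ψ : A →+ B →+ AddCircle (1 : ℝ))
    (hA : Function.Injective ψ) (hB : Function.Injective ψ.flip) {f : A → A} {g : B → B}
    (hg : Function.Bijective g) (hfg : ∀ a b, ψ (f a) (g b) = ψ a b) :
    Nat.card {a // f a = a} = Nat.card {b // g b = b} := by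
  classical
  let := Fintype.ofFinite A
  let := Fintype.ofFinite B
  have hkey (a : A) (b : B) : ψ (f a - a) (g b) = ψ.flip (b - g b) a := by simp [hfg]
  have hleft : ∑ a, ∑ b, ((ψ (f a - a) b).toCircle : ℂ) =
      Nat.card B * Nat.card {a // f a = a} := by
    simp only [sum_toCircle, map_eq_zero_iff _ hA, sub_eq_zero]
    simp [← Finset.sum_filter, Fintype.card_subtype, mul_comm]
  have hright : ∑ a, ∑ b, ((ψ (f a - a) b).toCircle : ℂ) =
      Nat.card A * Nat.card {b // g b = b} := by
    simp_rw [← hg.sum_comp fun b ↦ ((ψ (f _ - _) b).toCircle : ℂ), hkey]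
    rw [Finset.sum_comm]
    simp only [sum_toCircle, map_eq_zero_iff _ hB, sub_eq_zero]
    simp [← Finset.sum_filter, Fintype.card_subtype, mul_comm, eq_comm]
  rw [hleft, card_eq_of_pairing ψ hA hB] at hright
  exact_mod_cast mul_left_cancel₀ (Nat.cast_ne_zero.mpr Nat.card_pos.ne') hright

end FiniteDuality

/-! ### Duality between the root system and its dual -/

section TorusPairing

variable {ι V T : Type*} [AddCommGroup V] [Module ℝ V] [AddCommGroup T] [Module ℝ T]
  {P : RootPairing ι ℝ V T} {N : ℕ}

lemma exists_intCast_eq_mul_pair {q : T} (hq : q ∈ P.corootSpan ℤ) {u : V}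
    (hu : u ∈ adjointOrder P.flip N) : ∃ z : ℤ, N * pair P u q = z := by
  induction hq using Submodule.span_induction with
  | mem x hx =>
    obtain ⟨i, rfl⟩ := hx
    exact exists_intCast_eq_mul_pair_root hu i
  | zero => exact ⟨0, by simp [pair]⟩
  | add x y _ _ hx hy =>
    obtain ⟨a, ha⟩ := hx
    obtain ⟨b, hb⟩ := hy
    exact ⟨a + b, by rw [Int.cast_add, ← ha, ← hb, pair, map_add, mul_add]; rfl⟩
  | smul n x _ hx =>
    obtain ⟨a, ha⟩ := hx
    exact ⟨n * a, by rw [Int.cast_mul, ← ha, pair, map_zsmul, zsmul_eq_mul, mul_left_comm]; rfl⟩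

lemma mem_corootSpan_of_forall_exists_intCast_eq [P.IsRootSystem] (b : P.Base) {x : T}
    (h : ∀ v ∈ coweightLattice P.flip, ∃ z : ℤ, pair P v x = z) : x ∈ P.corootSpan ℤ := by
  classical
  rw [← b.toCoweightBasis.sum_repr x]
  refine sum_mem fun j _ ↦ ?_
  obtain ⟨z, hz⟩ := h (fundamentalWeight b j) <| (mem_coweightLattice_iff b.flip).mpr fun k ↦
    ⟨if j = k then 1 else 0, (pair_fundamentalWeight b j k).trans (by push_cast; rfl)⟩
  rw [← pair_fundamentalWeight_eq_repr, hz, Int.cast_smul_eq_zsmul,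
    RootPairing.Base.toCoweightBasis_apply]
  exact Submodule.smul_mem _ _ (Submodule.subset_span ⟨j, rfl⟩)

lemma coe_addCircle_eq_zero_iff {r : ℝ} : (r : AddCircle (1 : ℝ)) = 0 ↔ ∃ z : ℤ, r = z := by
  rw [AddCircle.coe_eq_zero_iff]
  exact exists_congr fun z ↦ by rw [zsmul_one, eq_comm]

variable (P N) in
/-- The pairing `(x, u) ↦ N⟨u, x⟩` modulo `1` of the groups of elements of adjoint order `N` of the
tori of a root pairing and of its dual. -/
def torusPairing : TorusEFO P N →+ TorusEFO P.flip N →+ AddCircle (1 : ℝ) :=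
  QuotientAddGroup.lift _
    (AddMonoidHom.mk' (fun x ↦ QuotientAddGroup.lift _
      (AddMonoidHom.mk' (fun u ↦ ((N * pair P u x : ℝ) : AddCircle (1 : ℝ))) fun u u' ↦ by
        rw [← AddCircle.coe_add, ← mul_add]; simp [pair])
      fun _ hu ↦ coe_addCircle_eq_zero_iff.mpr (exists_intCast_eq_mul_pair (P := P.flip) hu x.2))
      fun x x' ↦ by
        ext u
        change ((N * pair P _ _ : ℝ) : AddCircle (1 : ℝ)) = (N * _ : ℝ) + (N * _ : ℝ)
        rw [← AddCircle.coe_add, ← mul_add]; simp [pair])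
    fun _ hx ↦ by
      ext u
      exact coe_addCircle_eq_zero_iff.mpr (exists_intCast_eq_mul_pair hx u.2)

lemma torusPairing_mk (x : adjointOrderSubgroup P N) (u : adjointOrderSubgroup P.flip N) :
    torusPairing P N x u = ((N * pair P u x : ℝ) : AddCircle (1 : ℝ)) := rfl

lemma flip_torusPairing : (torusPairing P N).flip = torusPairing P.flip N := by
  ext u x
  rfl

lemma torusPairing_smul_smul (w : P.weylGroup) (a : TorusEFO P N) (c : TorusEFO P.flip N) :
    torusPairing P N (w • a) (weylGroupFlip P w • c) = torusPairing P N a c := by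
  induction a using QuotientAddGroup.induction_on with | H x =>
  induction c using QuotientAddGroup.induction_on with | H u =>
  rw [smul_mk, smul_mk, torusPairing_mk, torusPairing_mk, coe_smul_adjointOrderSubgroup,
    coe_smul_adjointOrderSubgroup, weylGroupFlip_smul_coweight, pair_smul_smul]

variable [P.IsRootSystem]

lemma injective_torusPairing (b : P.Base) (hN : N ≠ 0) :
    Function.Injective (torusPairing P N) := by
  refine (injective_iff_map_eq_zero _).mpr fun a ha ↦ ?_
  induction a using QuotientAddGroup.induction_on with | H x =>
  refine (QuotientAddGroup.eq_zero_iff x).mpr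
    (mem_corootSpan_of_forall_exists_intCast_eq b fun v hv ↦ ?_)
  let u : adjointOrderSubgroup P.flip N := ⟨(1 / (N : ℝ)) • v, v, hv, rfl⟩
  obtain ⟨z, hz⟩ := coe_addCircle_eq_zero_iff.mp (DFunLike.congr_fun ha (u : TorusEFO P.flip N))
  refine ⟨z, hz ▸ ?_⟩
  rw [smul_pair]
  field_simp
  rfl

lemma injective_flip_torusPairing (b : P.Base) (hN : N ≠ 0) :
    Function.Injective (torusPairing P N).flip :=
  flip_torusPairing (P := P) ▸ injective_torusPairing b.flip hN

end TorusPairing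

section OpenPointsDuality

variable {ι V T : Type*} [Finite ι] [Nonempty ι] [AddCommGroup V] [Module ℝ V] [AddCommGroup T]
  [Module ℝ T] {P : RootPairing ι ℝ V T} [P.IsRootSystem] [P.IsCrystallographic] [P.IsReduced]
  [P.IsIrreducible] (b : P.Base) {N : ℕ}

include b in
lemma card_fixedBy_weylGroupFlip (hN : N ≠ 0) (w : P.weylGroup) :
    Nat.card (MulAction.fixedBy (TorusEFO P.flip N) (weylGroupFlip P w)) =
      Nat.card (MulAction.fixedBy (TorusEFO P N) w) := by
  have := finite_torusEFO b hN
  have := finite_torusEFO b.flip hN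
  exact (card_fixedPoints_eq_of_pairing (torusPairing P N) (injective_torusPairing b hN)
    (injective_flip_torusPairing b hN) (MulAction.bijective (weylGroupFlip P w))
    (torusPairing_smul_smul w)).symm

lemma card_openChamberEFO_flip (hN : N ≠ 0) :
    Nat.card (openChamberEFO b.flip N) = Nat.card (openChamberEFO b N) := by
  have := Module.Finite.of_basis b.toWeightBasis
  have := Module.Finite.of_basis b.toCoweightBasis
  have h := sum_sign_mul_card_fixedBy b.flip hN
  rw [← Equiv.sum_comp (weylGroupFlip P).toEquiv] at h
  simp only [MulEquiv.toEquiv_eq_coe, MulEquiv.coe_toEquiv, sign_weylGroupFlip,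
    card_fixedBy_weylGroupFlip b hN] at h
  rw [sum_sign_mul_card_fixedBy b hN, ← Fintype.card_congr (weylGroupFlip P).toEquiv] at h
  exact_mod_cast (mul_left_cancel₀ (Nat.cast_ne_zero.mpr Fintype.card_ne_zero) h).symm

lemma encard_openPoints_comark (hN : N ≠ 0) :
    (openPoints (comark b) N).encard = (openPoints (mark b) N).encard := by
  have hfin := finite_openChamberEFO b (N := N)
  have hfin' := finite_openChamberEFO b.flip (N := N)
  rw [← encard_openChamberEFO b hN, ← hfin.cast_ncard_eq]
  refine (encard_openChamberEFO b.flip hN).symm.trans (hfin'.cast_ncard_eq.symm.trans ?_)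
  exact congrArg _ (card_openChamberEFO_flip b hN)

lemma one_add_sum_comark : 1 + ∑ j, comark b j = coxeterNumber b := by
  have hiff {N : ℕ} (hN : N ≠ 0) : 1 + ∑ j, comark b j ≤ N ↔ coxeterNumber b ≤ N := by
    rw [coxeterNumber, ← openPoints_nonempty_iff, ← openPoints_nonempty_iff, ← Set.encard_pos,
      ← Set.encard_pos, encard_openPoints_comark b hN]
  exact le_antisymm ((hiff (by rw [coxeterNumber]; omega)).mpr le_rfl)
    ((hiff (by omega)).mp le_rfl)

lemma encard_monomialsLE_eq (M : ℕ) :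
    (monomialsLE b M).encard = (openChamberEFO b (M + coxeterNumber b)).encard := by
  have h : M + coxeterNumber b ≠ 0 := by rw [coxeterNumber]; omega
  rw [encard_monomialsLE, ← encard_openPoints_add, one_add_sum_comark, encard_openPoints_comark b h,
    encard_openChamberEFO b h]

end OpenPointsDuality

/-! ### The vanishing of the `S`-functions -/

section SFunction

open RootPairing

variable {ι V T : Type*} [AddCommGroup V] [Module ℝ V] [AddCommGroup T] [Module ℝ T]
  {P : RootPairing ι ℝ V T}

lemma exp_two_pi_I_eq_one_iff (r : ℝ) :
    Complex.exp (2 * Real.pi * Complex.I * r) = 1 ↔ ∃ z : ℤ, r = z := by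
  rw [Complex.exp_eq_one_iff]
  refine exists_congr fun z ↦ ?_
  rw [mul_comm (z : ℂ), mul_right_inj' Complex.two_pi_I_ne_zero]
  exact_mod_cast Iff.rfl

lemma exp_two_pi_I_sub_intCast (r : ℝ) (z : ℤ) :
    Complex.exp (2 * Real.pi * Complex.I * (r - z : ℝ)) =
      Complex.exp (2 * Real.pi * Complex.I * r) := by
  have hz := (exp_two_pi_I_eq_one_iff z).mpr ⟨z, rfl⟩
  rw [Complex.ofReal_sub, mul_sub, Complex.exp_sub, hz, div_one]

lemma sign_mul_self [Module.Finite ℝ V] (w : P.weylGroup) : sign P w * sign P w = 1 := by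
  induction w using weylGroup_induction with
  | ofIdx i => rw [sign_ofIdx, neg_one_mul, neg_neg]
  | one => rw [sign_one, one_mul]
  | mul w w' h h' => rw [sign_mul, mul_mul_mul_comm, h, h', one_mul]

variable [P.IsRootSystem]

lemma pair_rho (b : P.Base) (k : b.support) : pair P (rho b) (P.coroot k) = 1 := by
  classical
  simp [rho, sum_pair, pair_fundamentalWeight]

lemma pair_dominantWeight (b : P.Base) (l : b.support →₀ ℕ) (k : b.support) :
    pair P (dominantWeight b l) (P.coroot k) = l k := by
  classical
  simp [dominantWeight, sum_pair, smul_pair, pair_fundamentalWeight]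

variable [Finite ι]

lemma sFunction_smul [Module.Finite ℝ V] (w : P.weylGroup) (μ : V) (x : T) :
    sFunction P (w • μ) x = sign P w * sFunction P μ x := by
  simp only [sFunction, Finset.mul_sum]
  refine Fintype.sum_equiv (Equiv.mulRight w) _ _ fun g ↦ ?_
  have hsign : sign P g = sign P w * sign P (g * w) := by
    rw [sign_mul, mul_left_comm, sign_mul_self, mul_one]
  rw [Equiv.coe_mulRight, mul_smul, ← mul_assoc, ← Complex.ofReal_mul, ← hsign]

/-- Replacing the summation variable `w` by `w sᵢ` changes the exponents by integers, and the sign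
of every term. -/
lemma sFunction_eq_zero_of_pair_coroot [Module.Finite ℝ V] {μ : V} {x : T} {N : ℕ} {i : ι}
    (hμ : pair P μ (P.coroot i) = N) (hx : ∀ k, ∃ z : ℤ, N * pair P (P.root k) x = z) :
    sFunction P μ x = 0 := by
  refine self_eq_neg.mp ?_
  conv_rhs => rw [sFunction, ← Finset.sum_neg_distrib]
  refine Fintype.sum_equiv (Equiv.mulRight (weylGroup.ofIdx P i)) _ _ fun w ↦ ?_
  obtain ⟨z, hz⟩ := hx (w • i)
  rw [Equiv.coe_mulRight, sign_mul, sign_ofIdx, mul_smul, ofIdx_smul_weight, reflection_eq, hμ,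
    smul_sub, smul_comm, ← root_smul, sub_pair, smul_pair, hz, exp_two_pi_I_sub_intCast]
  push_cast
  ring

variable (b : P.Base) [Nonempty ι]

lemma pair_dominantWeight_add_rho_highestCoroot (l : b.support →₀ ℕ) :
    pair P (dominantWeight b l + rho b) (P.coroot (highestRoot b.flip)) =
      (mDegree b l + ∑ j, comark b j : ℕ) := by
  have h : pair P (dominantWeight b l + rho b) (P.coroot (highestRoot b.flip)) =
      ∑ j : b.support, comark b j * pair P (dominantWeight b l + rho b) (P.coroot j) :=
    pair_highestRoot (P := P.flip) b.flip _
  simp [h, add_pair, pair_rho, pair_dominantWeight, mDegree_eq_sum, mul_add,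
    Finset.sum_add_distrib]

variable [P.IsCrystallographic] [P.IsReduced] [P.IsIrreducible]

lemma sFunction_eq_zero (l : b.support →₀ ℕ) {M : ℕ} (hl : mDegree b l = M + 1) {x : T}
    (hx : x ∈ adjointOrder P (M + coxeterNumber b)) :
    sFunction P (dominantWeight b l + rho b) x = 0 := by
  have : Module.Finite ℝ V := Module.Finite.of_basis b.toWeightBasis
  have hN : mDegree b l + ∑ j, comark b j = M + coxeterNumber b := by
    rw [hl, ← one_add_sum_comark b, add_assoc]
  exact sFunction_eq_zero_of_pair_coroot
    (hN ▸ pair_dominantWeight_add_rho_highestCoroot b l) (exists_intCast_eq_mul_pair_root hx)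

end SFunction

section Dominant

open RootPairing

variable {ι V T : Type*} [AddCommGroup V] [Module ℝ V] [AddCommGroup T] [Module ℝ T]
  {P : RootPairing ι ℝ V T} (b : P.Base)

lemma exists_dominant_smul [Finite ι] [P.IsRootSystem] (μ : V) :
    ∃ w : P.weylGroup, ∀ j : b.support, 0 ≤ pair P (w • μ) (P.coroot j) := by
  obtain ⟨w, hw⟩ := Finite.exists_max fun w : P.weylGroup ↦ pair P (w • μ) (coRho b)
  refine ⟨w, fun j ↦ ?_⟩
  have hj := hw (weylGroup.ofIdx P j * w)
  rwa [mul_smul, ofIdx_smul_weight, reflection_eq, sub_pair, smul_pair, pair_root_coRho,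
    Base.height_one_of_mem_support j.2, Int.cast_one, mul_one, sub_le_self_iff] at hj

/-- The cone of the sums of simple roots. -/
def rootCone : AddSubmonoid V := AddSubmonoid.closure (P.root '' b.support)

variable {b}

lemma root_mem_rootCone [Finite ι] [P.IsCrystallographic] {i : ι} (hi : b.IsPos i) :
    P.root i ∈ rootCone b := by
  have hsimple {j : ι} (hj : j ∈ b.support) : P.root j ∈ rootCone b :=
    AddSubmonoid.subset_closure (Set.mem_image_of_mem _ hj)
  refine hi.induction_on_add (p := fun i ↦ P.root i ∈ rootCone b) (fun _ ↦ hsimple)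
    fun i j k hk hi hj ↦ ?_
  rw [hk]
  exact add_mem hi (hsimple hj)

lemma eq_zero_or_pos_of_mem_rootCone {f : V →+ ℝ} (hf : ∀ j : b.support, 0 < f (P.root j)) {v : V}
    (hv : v ∈ rootCone b) : v = 0 ∨ 0 < f v := by
  induction hv using AddSubmonoid.closure_induction with
  | mem v hv =>
    obtain ⟨j, hj, rfl⟩ := hv
    exact .inr (hf ⟨j, hj⟩)
  | zero => exact .inl rfl
  | add u v _ _ hu hv =>
    rw [map_add]
    rcases hu with rfl | hu
    · simpa using hv
    rcases hv with rfl | hv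
    · simp [hu]
    · exact .inr (add_pos hu hv)

variable (b) in
lemma isPointed_rootCone [P.IsRootSystem] : (rootCone b).IsPointed := by
  let f : V →+ ℝ := (P.toLinearMap.flip (coRho b)).toAddMonoidHom
  have hf (j : b.support) : 0 < f (P.root j) := by
    have h : f (P.root j) = b.height j := pair_root_coRho b j
    rw [h, Base.height_one_of_mem_support j.2, Int.cast_one]
    exact one_pos
  intro v hv hv'
  refine (eq_zero_or_pos_of_mem_rootCone hf hv).resolve_right fun h ↦ ?_
  rcases eq_zero_or_pos_of_mem_rootCone hf hv' with h' | h'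
  · rw [neg_eq_zero.mp h', map_zero] at h
    exact lt_irrefl _ h
  · rw [map_neg] at h'
    linarith

lemma eq_zero_of_mem_rootCone_of_pair_nonpos [Finite ι] [P.IsRootSystem] {v : V}
    (hv : v ∈ rootCone b) (h : ∀ j : b.support, pair P v (P.coroot j) ≤ 0) : v = 0 := by
  let := Fintype.ofFinite ι
  have hle {u : V} (hu : u ∈ rootCone b) : P.RootForm u v ≤ 0 := by
    induction hu using AddSubmonoid.closure_induction with
    | mem u hu =>
      obtain ⟨j, hj, rfl⟩ := hu
      have hform : 2 * P.RootForm (P.root j) v =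
          P.RootForm (P.root j) (P.root j) * pair P v (P.coroot j) :=
        two_mul_corootForm_coroot (P := P.flip) j v
      have hneg : P.RootForm (P.root j) (P.root j) * pair P v (P.coroot j) ≤ 0 :=
        mul_nonpos_of_nonneg_of_nonpos (corootForm_self_nonneg (P := P.flip) _) (h ⟨j, hj⟩)
      linarith
    | zero => simp
    | add u u' _ _ hu hu' => simpa using add_nonpos hu hu'
  by_contra hv0
  exact (hle hv).not_gt (corootForm_self_pos (P := P.flip) hv0)

variable [Fintype ι] [P.IsCrystallographic] [P.IsReduced] (j : b.support)

@[to_additive]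
lemma prod_reflectionPerm_erase [DecidableEq ι] [DecidablePred b.IsPos] {β : Type*} [CommMonoid β]
    (f : ι → β) :
    ∏ i ∈ (Finset.univ.filter b.IsPos).erase j, f (P.reflectionPerm j i) =
      ∏ i ∈ (Finset.univ.filter b.IsPos).erase j, f i := by
  have hmem : ∀ i ∈ (Finset.univ.filter b.IsPos).erase (j : ι),
      P.reflectionPerm j i ∈ (Finset.univ.filter b.IsPos).erase (j : ι) := by
    intro i hi
    simp only [Finset.mem_erase, Finset.mem_filter_univ] at hi ⊢
    refine ⟨fun h ↦ ?_, hi.2.reflectionPerm j.2 hi.1⟩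
    rw [← P.reflectionPerm_self j i, h] at hi
    exact (Base.IsPos.neg_iff_not b _).mp hi.2 (b.isPos_of_mem_support j.2)
  exact Finset.prod_nbij' (P.reflectionPerm j) (P.reflectionPerm j) hmem hmem (by simp) (by simp)
    (by simp)

lemma reflection_sum_isPos_root [DecidablePred b.IsPos] :
    P.reflection j (∑ i with b.IsPos i, P.root i) =
      ∑ i with b.IsPos i, P.root i - (2 : ℝ) • P.root j := by
  classical
  have hj : (j : ι) ∈ Finset.univ.filter b.IsPos := by
    simpa using b.isPos_of_mem_support j.2
  rw [← Finset.add_sum_erase _ _ hj, map_add, map_sum, P.reflection_apply_self]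
  simp only [← root_reflectionPerm]
  rw [sum_reflectionPerm_erase j fun i ↦ P.root i]
  module

variable (b) in
lemma sum_isPos_root [P.IsRootSystem] [DecidablePred b.IsPos] :
    ∑ i with b.IsPos i, P.root i = (2 : ℝ) • rho b := by
  refine eq_of_forall_pair_simpleRoot_eq (P := P.flip) b.flip fun j ↦ ?_
  change pair P (∑ i with b.IsPos i, P.root i) (P.coroot j) = pair P ((2 : ℝ) • rho b) (P.coroot j)
  have h := reflection_sum_isPos_root (b := b) j
  rw [reflection_eq, sub_right_inj] at h
  rw [smul_pair, pair_rho b j, mul_one]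
  exact smul_left_injective ℝ (P.ne_zero j) h

end Dominant

/-! ### Leading terms and the Laplacian on the group algebra of `𝔱*` -/

section GroupAlgebra

open AddMonoidAlgebra

variable {V : Type*}

/-- The diagonal operator `e^v ↦ q(v) e^v` on the group algebra of `V`. -/
def diagOp (q : V → ℂ) : AddMonoidAlgebra ℂ V →ₗ[ℂ] AddMonoidAlgebra ℂ V where
  toFun f := .ofCoeff <| Finsupp.onFinset f.coeff.support (fun v ↦ q v * f.coeff v) fun _ hv ↦
    Finsupp.mem_support_iff.mpr (right_ne_zero_of_mul hv)
  map_add' f g := by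
    ext v
    simp [mul_add]
  map_smul' c f := by
    ext v
    simp [mul_left_comm]

@[simp]
lemma coeff_diagOp (q : V → ℂ) (f : AddMonoidAlgebra ℂ V) (v : V) :
    (diagOp q f).coeff v = q v * f.coeff v := rfl

@[simp]
lemma diagOp_single (q : V → ℂ) (v : V) (a : ℂ) :
    diagOp q (single v a) = single v (q v * a) := by
  classical
  ext w
  by_cases h : v = w <;> simp [h]

variable [AddCommGroup V] [Module ℝ V] {B : V →ₗ[ℝ] V →ₗ[ℝ] ℂ}

variable (B) in
/-- The Laplacian of the form `B`: a multiple of the second order operator that it defines, when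
`e^v` is read as the function `x ↦ e^{2πi⟨v, x⟩}`. -/
def laplacian : AddMonoidAlgebra ℂ V →ₗ[ℂ] AddMonoidAlgebra ℂ V := diagOp fun v ↦ B v v

variable (B) in
/-- The product of the gradients of `f` and `g`, up to a scalar, encoded as the defect of the
Leibniz rule for the Laplacian. -/
def gradProd (f g : AddMonoidAlgebra ℂ V) : AddMonoidAlgebra ℂ V :=
  laplacian B (f * g) - f * laplacian B g - g * laplacian B f

lemma laplacian_mul (f g : AddMonoidAlgebra ℂ V) :
    laplacian B (f * g) = gradProd B f g + f * laplacian B g + g * laplacian B f := by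
  rw [gradProd]
  ring

lemma gradProd_add_left (f f' g : AddMonoidAlgebra ℂ V) :
    gradProd B (f + f') g = gradProd B f g + gradProd B f' g := by
  simp only [gradProd, add_mul, mul_add, map_add]
  ring

lemma gradProd_sub_left (f f' g : AddMonoidAlgebra ℂ V) :
    gradProd B (f - f') g = gradProd B f g - gradProd B f' g := by
  simp only [gradProd, sub_mul, mul_sub, map_sub]
  ring

lemma gradProd_add_right (f g g' : AddMonoidAlgebra ℂ V) :
    gradProd B f (g + g') = gradProd B f g + gradProd B f g' := by
  simp only [gradProd, add_mul, mul_add, map_add]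
  ring

lemma gradProd_zero_left (g : AddMonoidAlgebra ℂ V) : gradProd B 0 g = 0 := by
  simp [gradProd]

variable (hB : ∀ u v, B u v = B v u)
include hB

lemma gradProd_single_left (u : V) (a : ℂ) (g : AddMonoidAlgebra ℂ V) :
    gradProd B (single u a) g = 2 * (single u a * diagOp (B u) g) := by
  induction g using AddMonoidAlgebra.induction_linear with
  | zero => simp [gradProd]
  | add f g hf hg => rw [gradProd_add_right, hf, hg, map_add, mul_add, mul_add]
  | single v c =>
    simp only [two_mul, gradProd, laplacian, single_mul_single, diagOp_single, map_add,
      LinearMap.add_apply, add_comm v u, ← single_sub, ← single_add, hB v u]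
    ring_nf

lemma gradProd_mul_left (f f' g : AddMonoidAlgebra ℂ V) :
    gradProd B (f * f') g = f * gradProd B f' g + f' * gradProd B f g := by
  induction f using AddMonoidAlgebra.induction_linear with
  | zero => simp [gradProd_zero_left]
  | add f₁ f₂ h₁ h₂ => rw [add_mul, gradProd_add_left, h₁, h₂, gradProd_add_left]; ring
  | single u a =>
    induction f' using AddMonoidAlgebra.induction_linear with
    | zero => simp [gradProd_zero_left]
    | add f₁ f₂ h₁ h₂ => rw [mul_add, gradProd_add_left, h₁, h₂, gradProd_add_left]; ring
    | single v c =>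
      have hadd : diagOp (B (u + v)) g = diagOp (B u) g + diagOp (B v) g := by
        ext w
        simp [add_mul]
      simp only [single_mul_single, gradProd_single_left hB, hadd]
      rw [← single_mul_single]
      ring

lemma gradProd_one_left (g : AddMonoidAlgebra ℂ V) : gradProd B 1 g = 0 := by
  simpa using gradProd_mul_left hB 1 1 g

lemma gradProd_prod_left {κ : Type*} (s : Finset κ) {f h : κ → AddMonoidAlgebra ℂ V}
    {g : AddMonoidAlgebra ℂ V} (hf : ∀ i ∈ s, gradProd B (f i) g = f i * h i) :
    gradProd B (∏ i ∈ s, f i) g = (∏ i ∈ s, f i) * ∑ i ∈ s, h i := by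
  classical
  induction s using Finset.induction_on with
  | empty => simp [gradProd_one_left hB]
  | insert i s hi ih =>
    rw [Finset.prod_insert hi, Finset.sum_insert hi, gradProd_mul_left hB,
      ih fun k hk ↦ hf k (Finset.mem_insert_of_mem hk), hf i (Finset.mem_insert_self i s)]
    ring

end GroupAlgebra

section LeadingTerm

open AddMonoidAlgebra

variable {V : Type*} [AddCommGroup V] {C : AddSubmonoid V}

/-- `e^v` occurs in `f` with coefficient `a`, and the exponents of `f` all lie in `v - C`. -/
structure HasLeadingTerm (C : AddSubmonoid V) (f : AddMonoidAlgebra ℂ V) (v : V) (a : ℂ) :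
    Prop where
  coeff_eq : f.coeff v = a
  sub_mem : ∀ ⦃μ⦄, f.coeff μ ≠ 0 → v - μ ∈ C

lemma HasLeadingTerm.mul (hC : C.IsPointed) {f g : AddMonoidAlgebra ℂ V} {v w : V} {a c : ℂ}
    (hf : HasLeadingTerm C f v a) (hg : HasLeadingTerm C g w c) :
    HasLeadingTerm C (f * g) (v + w) (a * c) where
  coeff_eq := by
    rw [← hf.coeff_eq, ← hg.coeff_eq]
    refine coeff_mul_add_of_uniqueAdd fun x y hx hy hxy ↦ ?_
    have hvx := hf.sub_mem (Finsupp.mem_support_iff.mp hx)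
    have hwy := hg.sub_mem (Finsupp.mem_support_iff.mp hy)
    have hneg : -(v - x) = w - y := by
      rw [neg_sub, sub_eq_sub_iff_add_eq_add, hxy, add_comm]
    have hzero := hC _ hvx (hneg ▸ hwy)
    rw [hzero, neg_zero] at hneg
    exact ⟨(sub_eq_zero.mp hzero).symm, (sub_eq_zero.mp hneg.symm).symm⟩
  sub_mem μ hμ := by
    classical
    obtain ⟨x, hx, y, hy, rfl⟩ := Finset.mem_add.mp
      (support_coeff_mul_subset f g (Finsupp.mem_support_iff.mpr hμ))
    rw [← sub_add_sub_comm]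
    exact C.add_mem (hf.sub_mem (Finsupp.mem_support_iff.mp hx))
      (hg.sub_mem (Finsupp.mem_support_iff.mp hy))

lemma hasLeadingTerm_one : HasLeadingTerm C 1 0 1 where
  coeff_eq := by simp [one_def]
  sub_mem μ hμ := by
    classical
    by_cases h : 0 = μ
    · simp [← h]
    · simp [one_def, h] at hμ

lemma HasLeadingTerm.prod (hC : C.IsPointed) {κ : Type*} (s : Finset κ)
    {f : κ → AddMonoidAlgebra ℂ V} {v : κ → V} (h : ∀ i ∈ s, HasLeadingTerm C (f i) (v i) 1) :
    HasLeadingTerm C (∏ i ∈ s, f i) (∑ i ∈ s, v i) 1 := by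
  classical
  induction s using Finset.induction_on with
  | empty => simpa using hasLeadingTerm_one
  | insert i s hi ih =>
    rw [Finset.prod_insert hi, Finset.sum_insert hi, ← one_mul (1 : ℂ)]
    exact (h i (Finset.mem_insert_self i s)).mul hC
      (ih fun k hk ↦ h k (Finset.mem_insert_of_mem hk))

end LeadingTerm

section WeylAction

open AddMonoidAlgebra RootPairing

variable {ι V T : Type*} [AddCommGroup V] [Module ℝ V] [AddCommGroup T] [Module ℝ T]
  {P : RootPairing ι ℝ V T}

variable (P) in
/-- The evaluation of the elements of the group algebra of `𝔱*`, as trigonometric polynomials, at a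
point of `𝔱`. -/
def evalAt (x : T) : AddMonoidAlgebra ℂ V →ₐ[ℂ] ℂ :=
  AddMonoidAlgebra.lift ℂ ℂ V
    { toFun v := Complex.exp (2 * Real.pi * Complex.I * (pair P v.toAdd x : ℂ))
      map_one' := by simp [pair]
      map_mul' v w := by simp [pair, mul_add, Complex.exp_add] }

@[simp]
lemma evalAt_single (x : T) (v : V) (a : ℂ) :
    evalAt P x (single v a) = a * Complex.exp (2 * Real.pi * Complex.I * (pair P v x : ℂ)) := by
  rw [evalAt, lift_single, smul_eq_mul]
  rfl

/-- The action of the Weyl group on the group algebra of `𝔱*`. -/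
def weylAct (w : P.weylGroup) : AddMonoidAlgebra ℂ V →ₐ[ℂ] AddMonoidAlgebra ℂ V :=
  mapDomainAlgHom ℂ ℂ (DistribSMul.toAddMonoidHom V w)

@[simp]
lemma weylAct_single (w : P.weylGroup) (v : V) (a : ℂ) :
    weylAct w (single v a) = single (w • v) a := by
  simp [weylAct, mapDomain_single]

lemma coeff_weylAct_smul (w : P.weylGroup) (f : AddMonoidAlgebra ℂ V) (v : V) :
    (weylAct w f).coeff (w • v) = f.coeff v := by
  rw [weylAct, mapDomainAlgHom_apply, coeff_mapDomain]
  exact Finsupp.mapDomain_apply (MulAction.injective w) _ _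

lemma weylAct_one (f : AddMonoidAlgebra ℂ V) : weylAct (1 : P.weylGroup) f = f := by
  ext v
  simpa using coeff_weylAct_smul (1 : P.weylGroup) f v

lemma weylAct_mul (w w' : P.weylGroup) (f : AddMonoidAlgebra ℂ V) :
    weylAct (w * w') f = weylAct w (weylAct w' f) := by
  induction f using AddMonoidAlgebra.induction_linear with
  | zero => simp
  | add f g hf hg => rw [map_add, map_add, map_add, hf, hg]
  | single v a => simp [mul_smul]

variable (P) in
/-- The elements of the group algebra of `𝔱*` on which the Weyl group acts by the sign. -/
def IsAntisymm (f : AddMonoidAlgebra ℂ V) : Prop :=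
  ∀ w : P.weylGroup, weylAct w f = (sign P w : ℂ) • f

variable {f : AddMonoidAlgebra ℂ V}

lemma isAntisymm_of_weylAct_ofIdx [Finite ι] [P.IsCrystallographic] [P.IsReduced]
    [Module.Finite ℝ V] (b : P.Base)
    (h : ∀ j : b.support, weylAct (weylGroup.ofIdx P j) f = -f) : IsAntisymm P f := by
  intro w
  obtain ⟨l, rfl⟩ := exists_word_eq b w
  induction l with
  | nil =>
    have hnil : word b [] = 1 := rfl
    rw [hnil, weylAct_one, sign_one, Complex.ofReal_one, one_smul]
  | cons j l ih =>
    rw [word_cons, weylAct_mul, ih, map_smul, h, sign_mul, sign_ofIdx, smul_neg]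
    simp

lemma IsAntisymm.mul_of_invariant {χ : AddMonoidAlgebra ℂ V} (hf : IsAntisymm P f)
    (hχ : ∀ w : P.weylGroup, weylAct w χ = χ) : IsAntisymm P (f * χ) := fun w ↦ by
  rw [map_mul, hf, hχ, smul_mul_assoc]

lemma IsAntisymm.coeff_smul_ne_zero (hf : IsAntisymm P f) (w : P.weylGroup) {v : V}
    (hv : f.coeff v ≠ 0) : f.coeff (w • v) ≠ 0 := by
  rw [← coeff_weylAct_smul w, hf] at hv
  exact right_ne_zero_of_mul hv

lemma IsAntisymm.pair_coroot_ne_zero [Module.Finite ℝ V] (hf : IsAntisymm P f) {v : V}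
    (hv : f.coeff v ≠ 0) (i : ι) : pair P v (P.coroot i) ≠ 0 := by
  intro h
  have hfix : weylGroup.ofIdx P i • v = v := by
    rw [ofIdx_smul_weight, reflection_eq, h, zero_smul, sub_zero]
  have hcoeff := coeff_weylAct_smul (weylGroup.ofIdx P i) f v
  rw [hf, sign_ofIdx, hfix] at hcoeff
  exact hv (self_eq_neg.mp (by simpa using hcoeff.symm))

variable [Finite ι] [P.IsRootSystem]

lemma sum_sign_mul_evalAt_weylAct (x : T) (f : AddMonoidAlgebra ℂ V) :
    ∑ w : P.weylGroup, sign P w * evalAt P x (weylAct w f) =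
      f.coeff.sum fun v a ↦ a * sFunction P v x := by
  induction f using AddMonoidAlgebra.induction_linear with
  | zero => simp
  | add f g hf hg =>
    simp only [map_add, mul_add, Finset.sum_add_distrib, hf, hg, coeff_add]
    rw [Finsupp.sum_add_index' (by simp) fun _ _ _ ↦ add_mul _ _ _]
  | single v a =>
    simp only [weylAct_single, evalAt_single, coeff_single]
    rw [Finsupp.sum_single_index (zero_mul _), sFunction, Finset.mul_sum]
    exact Finset.sum_congr rfl fun w _ ↦ mul_left_comm _ _ _

lemma IsAntisymm.evalAt_eq_zero [Module.Finite ℝ V] (hf : IsAntisymm P f) {x : T}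
    (h : ∀ v, f.coeff v ≠ 0 → sFunction P v x = 0) : evalAt P x f = 0 := by
  have hsum : (Fintype.card P.weylGroup : ℂ) * evalAt P x f = 0 := calc
    (Fintype.card P.weylGroup : ℂ) * evalAt P x f =
        ∑ w : P.weylGroup, sign P w * evalAt P x (weylAct w f) := by
      have hterm (w : P.weylGroup) : sign P w * evalAt P x (weylAct w f) = evalAt P x f := by
        rw [hf, map_smul, smul_eq_mul, ← mul_assoc, ← Complex.ofReal_mul, sign_mul_self,
          Complex.ofReal_one, one_mul]
      simp only [hterm, Finset.sum_const, Finset.card_univ, nsmul_eq_mul]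
    _ = 0 := by
      rw [sum_sign_mul_evalAt_weylAct]
      exact Finset.sum_eq_zero fun v hv ↦
        mul_eq_zero_of_right _ (h v (Finsupp.mem_support_iff.mp hv))
  exact (mul_eq_zero.mp hsum).resolve_left (Nat.cast_ne_zero.mpr Fintype.card_ne_zero)

end WeylAction

/-! ### The Weyl denominator -/

section Denominator

open AddMonoidAlgebra RootPairing

variable {ι V T : Type*} [AddCommGroup V] [Module ℝ V] [AddCommGroup T] [Module ℝ T]
  {P : RootPairing ι ℝ V T}

variable (P) in
/-- The factor `e^{α/2} - e^{-α/2}` of the Weyl denominator. -/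
def denFactor (i : ι) : AddMonoidAlgebra ℂ V :=
  single ((1 / 2 : ℝ) • P.root i) 1 - single (-((1 / 2 : ℝ) • P.root i)) 1

lemma weylAct_denFactor (w : P.weylGroup) (i : ι) :
    weylAct w (denFactor P i) = denFactor P (w • i) := by
  simp [denFactor, map_sub, root_smul, smul_comm w]

lemma denFactor_reflectionPerm_self (i : ι) :
    denFactor P (P.reflectionPerm i i) = -denFactor P i := by
  simp [denFactor, root_reflectionPerm]

variable {b : P.Base}

lemma hasLeadingTerm_denFactor [Finite ι] [P.IsCrystallographic] {i : ι} (hi : b.IsPos i) :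
    HasLeadingTerm (rootCone b) (denFactor P i) ((1 / 2 : ℝ) • P.root i) 1 where
  coeff_eq := by
    have hne : (1 / 2 : ℝ) • P.root i ≠ -((1 / 2 : ℝ) • P.root i) := fun h ↦
      P.ne_zero i (by linear_combination (norm := module) h)
    rw [denFactor, coeff_sub, Finsupp.sub_apply, coeff_single, coeff_single,
      Finsupp.single_eq_same, Finsupp.single_eq_of_ne hne, sub_zero]
  sub_mem μ hμ := by
    by_cases hpos : μ = (1 / 2 : ℝ) • P.root i
    · rw [hpos, sub_self]
      exact zero_mem _
    by_cases hneg : μ = -((1 / 2 : ℝ) • P.root i)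
    · have hroot : (1 / 2 : ℝ) • P.root i - μ = P.root i := by
        rw [hneg]
        module
      rw [hroot]
      exact root_mem_rootCone hi
    · rw [denFactor, coeff_sub, Finsupp.sub_apply, coeff_single, coeff_single,
        Finsupp.single_eq_of_ne hpos, Finsupp.single_eq_of_ne hneg, sub_zero] at hμ
      exact absurd rfl hμ

open Classical in
variable (b) in
/-- The Weyl denominator `∏ (e^{α/2} - e^{-α/2})`, over the positive roots `α`. -/
def denominator [Fintype ι] : AddMonoidAlgebra ℂ V := ∏ i with b.IsPos i, denFactor P i

variable (b) in
lemma evalAt_denominator_ne_zero [Fintype ι] {x : T}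
    (hx : ∀ i, ¬ ∃ z : ℤ, pair P (P.root i) x = z) : evalAt P x (denominator b) ≠ 0 := by
  rw [denominator, map_prod]
  refine Finset.prod_ne_zero_iff.mpr fun i _ h ↦ hx i ?_
  rw [denFactor, map_sub, evalAt_single, evalAt_single, sub_eq_zero, one_mul, one_mul] at h
  have hsub : pair P (P.root i) x =
      pair P ((1 / 2 : ℝ) • P.root i) x - pair P (-((1 / 2 : ℝ) • P.root i)) x := by
    rw [← sub_pair]
    congr 1
    module
  rw [← exp_two_pi_I_eq_one_iff, hsub, Complex.ofReal_sub, mul_sub, Complex.exp_sub, h,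
    div_self (Complex.exp_ne_zero _)]

lemma exists_intCast_eq_pair_of_mem_rootCone [P.IsCrystallographic] {v : V} (hv : v ∈ rootCone b)
    (i : ι) : ∃ z : ℤ, pair P v (P.coroot i) = z := by
  have hle : rootCone b ≤ (P.rootSpan ℤ).toAddSubmonoid :=
    AddSubmonoid.closure_le.mpr fun _ ⟨j, _, hj⟩ ↦ Submodule.subset_span ⟨j, hj⟩
  exact exists_intCast_eq_pair_root_of_mem_corootSpan (P := P.flip) (hle hv) i

variable [Fintype ι] [P.IsRootSystem] [P.IsCrystallographic] [P.IsReduced]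

variable (b)

lemma hasLeadingTerm_denominator : HasLeadingTerm (rootCone b) (denominator b) (rho b) 1 := by
  classical
  have hrho : ∑ i with b.IsPos i, (1 / 2 : ℝ) • P.root i = rho b := by
    rw [← Finset.smul_sum, sum_isPos_root, smul_smul]
    norm_num
  rw [← hrho, denominator]
  exact HasLeadingTerm.prod (isPointed_rootCone b) _
    fun i hi ↦ hasLeadingTerm_denFactor (Finset.mem_filter.mp hi).2

lemma isAntisymm_denominator : IsAntisymm P (denominator b) := by
  classical
  have : Module.Finite ℝ V := Module.Finite.of_basis b.toWeightBasis
  refine isAntisymm_of_weylAct_ofIdx b fun j ↦ ?_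
  have hj : (j : ι) ∈ Finset.univ.filter b.IsPos := by
    simpa using b.isPos_of_mem_support j.2
  simp only [denominator, map_prod, weylAct_denFactor, ofIdx_smul_index]
  rw [← Finset.mul_prod_erase _ _ hj, prod_reflectionPerm_erase j (denFactor P),
    denFactor_reflectionPerm_self, neg_mul, Finset.mul_prod_erase _ _ hj]

/-- The dominant exponents `v` of the antisymmetric denominator are strictly dominant, hence
`v - ρ` is dominant, and it lies in minus the root cone. -/
lemma exists_smul_eq_rho {v : V} (hv : (denominator b).coeff v ≠ 0) :
    ∃ w : P.weylGroup, w • v = rho b := by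
  have : Module.Finite ℝ V := Module.Finite.of_basis b.toWeightBasis
  obtain ⟨w, hw⟩ := exists_dominant_smul b v
  have hwv := (isAntisymm_denominator b).coeff_smul_ne_zero w hv
  have hmem := (hasLeadingTerm_denominator b).sub_mem hwv
  refine ⟨w, (sub_eq_zero.mp (eq_zero_of_mem_rootCone_of_pair_nonpos hmem fun j ↦ ?_)).symm⟩
  obtain ⟨z, hz⟩ := exists_intCast_eq_pair_of_mem_rootCone hmem j
  have hpos := (hw j).lt_of_ne' ((isAntisymm_denominator b).pair_coroot_ne_zero hwv j)
  rw [sub_pair, pair_rho] at hz ⊢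
  have hlt : (z : ℝ) < 1 := by linarith
  have hle : (z : ℝ) ≤ 0 := by exact_mod_cast Int.lt_add_one_iff.mp (by exact_mod_cast hlt)
  linarith

end Denominator

section WeylCharacter

open AddMonoidAlgebra RootPairing

variable {ι V T : Type*} [AddCommGroup V] [Module ℝ V] [AddCommGroup T] [Module ℝ T]
  {P : RootPairing ι ℝ V T} {B : V →ₗ[ℝ] V →ₗ[ℝ] ℂ} (hB : ∀ u v, B u v = B v u)

include hB in
/-- In the notation of characters, `A i = ∑ₖ e^{-kα} D`, where `D` is the derivative of `χ` in the
direction of `α`: so `A i` is a quotient of `D` by `1 - e^{-α}`. -/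
lemma gradProd_denFactor {χ : AddMonoidAlgebra ℂ V} {A : ι → AddMonoidAlgebra ℂ V}
    (hA : ∀ i, A i - single (-P.root i) 1 * A i = diagOp (B (P.root i)) χ) (i : ι) :
    gradProd B (denFactor P i) χ = denFactor P i * (A i + A (P.reflectionPerm i i)) := by
  set e : AddMonoidAlgebra ℂ V := single ((1 / 2 : ℝ) • P.root i) 1
  set e' : AddMonoidAlgebra ℂ V := single (-((1 / 2 : ℝ) • P.root i)) 1
  set D := diagOp (B (P.root i)) χ
  have hgrad : gradProd B e χ = e * D := by
    rw [gradProd_single_left hB, ← mul_assoc, mul_comm 2, mul_assoc]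
    congr 1
    ext v
    simp [D, two_mul]
    ring
  have hgrad' : gradProd B e' χ = -(e' * D) := by
    rw [gradProd_single_left hB, ← mul_assoc, mul_comm 2, mul_assoc, ← mul_neg]
    congr 1
    ext v
    simp [D, two_mul]
    ring
  have hee' : e * e' = 1 := by
    simp [e, e', single_mul_single, one_def]
  have hsq : single (P.root i) (1 : ℂ) = e * e := by
    rw [single_mul_single, one_mul]
    congr 1
    module
  have hsq' : single (-P.root i) (1 : ℂ) = e' * e' := by
    rw [single_mul_single, one_mul]
    congr 1
    module
  have hAi : A i - e' * e' * A i = D := hsq' ▸ hA i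
  have hAi' : A (P.reflectionPerm i i) - e * e * A (P.reflectionPerm i i) = -D := by
    have hD : diagOp (B (-P.root i)) χ = -D := by
      ext v
      simp [D]
    rw [← hsq, ← hD]
    simpa [root_reflectionPerm] using hA (P.reflectionPerm i i)
  rw [denFactor, gradProd_sub_left, hgrad, hgrad']
  linear_combination (-e) * hAi + e' * hAi' - (e' * A i - e * A (P.reflectionPerm i i)) * hee'

variable {r : ι → ℝ} (hBr : ∀ i v, B (P.root i) v = (r i * pair P v (P.coroot i) : ℝ))

include hB hBr in
lemma form_smul_smul (w : P.weylGroup) (v : V) : B (w • v) (w • v) = B v v := by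
  induction w using weylGroup_induction generalizing v with
  | ofIdx i =>
    rw [ofIdx_smul_weight, reflection_eq]
    simp only [map_sub, map_smul, LinearMap.sub_apply, LinearMap.smul_apply, hB v (P.root i), hBr,
      pair_root_coroot_self, Complex.real_smul]
    push_cast
    ring
  | one => rw [one_smul]
  | mul w w' h h' => rw [mul_smul, h, h']

include hB hBr in
lemma eq_of_form_eq {b : P.Base} (hr : ∀ i, 0 < r i) {v w : V} (hvw : w - v ∈ rootCone b)
    (h : B v v = B w w) (hv : ∀ j : b.support, 0 ≤ pair P v (P.coroot j))
    (hw : ∀ j : b.support, 0 < pair P w (P.coroot j)) : v = w := by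
  let f : V →+ ℝ := Complex.reAddGroupHom.comp (B.flip (w + v)).toAddMonoidHom
  have hf (j : b.support) : 0 < f (P.root j) := by
    have hfj : f (P.root j) = r j * pair P (w + v) (P.coroot j) :=
      congrArg Complex.re (hBr j (w + v))
    rw [hfj, add_pair]
    exact mul_pos (hr j) (by linarith [hv j, hw j])
  refine (sub_eq_zero.mp ((eq_zero_or_pos_of_mem_rootCone hf hvw).resolve_right ?_)).symm
  have hzero : B (w - v) (w + v) = 0 := by
    simp only [map_sub, map_add, LinearMap.sub_apply]
    rw [h, hB w v]
    ring
  exact (congrArg Complex.re hzero).not_gt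

variable [Fintype ι] (b : P.Base)

open Classical in
lemma sum_eq_sum_isPos {β : Type*} [AddCommMonoid β] (f : ι → β) :
    ∑ i, f i = ∑ i with b.IsPos i, (f i + f (P.reflectionPerm i i)) := by
  have hinv (i : ι) : P.reflectionPerm (P.reflectionPerm i i) (P.reflectionPerm i i) = i :=
    letI := P.indexNeg
    neg_neg i
  have hneg (i : ι) : b.IsPos (P.reflectionPerm i i) ↔ ¬ b.IsPos i := Base.IsPos.neg_iff_not b i
  rw [Finset.sum_add_distrib, ← Finset.sum_filter_add_sum_filter_not _ b.IsPos]
  congr 1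
  exact Finset.sum_nbij' (fun i ↦ P.reflectionPerm i i) (fun i ↦ P.reflectionPerm i i)
    (by simp [hneg]) (by simp [hneg]) (by simp [hinv]) (by simp [hinv]) (by simp [hinv])

variable [P.IsRootSystem] [P.IsCrystallographic] [P.IsReduced]

include hB hBr in
lemma laplacian_denominator :
    laplacian B (denominator b) = B (rho b) (rho b) • denominator b := by
  ext v
  rw [laplacian, coeff_diagOp, coeff_smul, Finsupp.smul_apply, smul_eq_mul]
  rcases eq_or_ne ((denominator b).coeff v) 0 with h | h
  · rw [h, mul_zero, mul_zero]
  · obtain ⟨w, hw⟩ := exists_smul_eq_rho b h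
    rw [← hw, form_smul_smul hB hBr]

variable {χ : AddMonoidAlgebra ℂ V} {A : ι → AddMonoidAlgebra ℂ V} {c : ℂ}
  (hA : ∀ i, A i - single (-P.root i) 1 * A i = diagOp (B (P.root i)) χ)
  (hc : laplacian B χ + ∑ i, A i = c • χ)

include hB hBr hA hc in
lemma laplacian_denominator_mul :
    laplacian B (denominator b * χ) = (c + B (rho b) (rho b)) • (denominator b * χ) := by
  have hgrad : gradProd B (denominator b) χ = denominator b * ∑ i, A i := by
    rw [sum_eq_sum_isPos b, denominator]
    exact gradProd_prod_left hB _ fun i _ ↦ gradProd_denFactor hB hA i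
  rw [laplacian_mul, hgrad, laplacian_denominator hB hBr, eq_sub_of_add_eq hc, add_smul, mul_sub,
    mul_smul_comm, mul_smul_comm, mul_comm χ]
  ring

include hB hBr hA hc in
/-- The argument of the Weyl character formula. The hypotheses on `A` are the identities that the
Casimir operator implies for a character `χ`; by them, the exponents of the product of `χ` with the
Weyl denominator all have the same norm as `l + ρ`, so they are conjugates of `l + ρ`. -/
theorem evalAt_eq_zero_of_casimir (hr : ∀ i, 0 < r i)
    (hχ : ∀ w : P.weylGroup, weylAct w χ = χ) {l : V}
    (hl : ∀ j : b.support, 0 ≤ pair P l (P.coroot j)) {a : ℂ} (ha : a ≠ 0)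
    (htop : HasLeadingTerm (rootCone b) χ l a) {x : T}
    (hx : ∀ i, ¬ ∃ z : ℤ, pair P (P.root i) x = z) (hS : sFunction P (l + rho b) x = 0) :
    evalAt P x χ = 0 := by
  have : Module.Finite ℝ V := Module.Finite.of_basis b.toWeightBasis
  have hform {v : V} (hv : (denominator b * χ).coeff v ≠ 0) : B v v = c + B (rho b) (rho b) := by
    have h := congrArg (fun f ↦ f.coeff v) (laplacian_denominator_mul hB hBr b hA hc)
    exact mul_right_cancel₀ hv h
  have htop' : HasLeadingTerm (rootCone b) (denominator b * χ) (l + rho b) a := by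
    simpa only [one_mul, add_comm] using
      (hasLeadingTerm_denominator b).mul (isPointed_rootCone b) htop
  have hanti : IsAntisymm P (denominator b * χ) := (isAntisymm_denominator b).mul_of_invariant hχ
  have hzero : evalAt P x (denominator b * χ) = 0 := by
    refine hanti.evalAt_eq_zero fun v hv ↦ ?_
    obtain ⟨w, hw⟩ := exists_dominant_smul b v
    have hwv := hanti.coeff_smul_ne_zero w hv
    have heq : w • v = l + rho b := by
      refine eq_of_form_eq hB hBr hr (htop'.sub_mem hwv) ?_ hw fun j ↦ ?_
      · rw [hform hwv, hform (htop'.coeff_eq.trans_ne ha)]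
      · rw [add_pair, pair_rho]
        linarith [hl j]
    rw [← inv_smul_smul w v, heq, sFunction_smul, hS, mul_zero]
  rw [map_mul] at hzero
  exact (mul_eq_zero.mp hzero).resolve_left (evalAt_denominator_ne_zero b hx)

end WeylCharacter

/-! ### The root system of a simple Lie algebra -/

section

variable {ι V T : Type*} [Finite ι] [Nonempty ι] [AddCommGroup V] [Module ℝ V] [AddCommGroup T]
  [Module ℝ T] {P : RootPairing ι ℝ V T} [P.IsCrystallographic] [P.IsReduced] [P.IsIrreducible]
  {b : P.Base} {x : T}

lemma pair_root_ne_intCast_of_mem_openChamber (hx : x ∈ openChamber b) (i : ι) (k : ℤ) :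
    pair P (P.root i) x ≠ k := by
  intro hk
  have hlt := abs_pair_root_lt_one_of_mem_openChamber hx i
  have hne : pair P (P.root i) x ≠ 0 := by
    rcases RootPairing.Base.IsPos.or_neg b i with hi | hi
    · exact (pair_root_pos_of_mem_openChamber hx hi).ne'
    · have hpos := pair_root_pos_of_mem_openChamber hx (i := P.reflectionPerm i i) hi
      rw [pair_root_reflectionPerm_self] at hpos
      linarith
  rw [hk] at hlt hne
  exact hne (by exact_mod_cast Int.abs_lt_one_iff.mp (by exact_mod_cast hlt))

lemma mem_openChamber_iff : x ∈ openChamber b ↔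
    x ∈ chamber b ∧ ∀ i, ¬ ∃ k : ℤ, pair P (P.root i) x = k := by
  refine ⟨fun h ↦ ⟨⟨fun j hj ↦ (h.1 j hj).le, h.2.le⟩,
    fun i ⟨k, hk⟩ ↦ pair_root_ne_intCast_of_mem_openChamber h i k hk⟩,
    fun ⟨h, h'⟩ ↦ ⟨fun j hj ↦ (h.1 j hj).lt_of_ne' fun h0 ↦ h' j ⟨0, ?_⟩,
      h.2.lt_of_ne fun h1 ↦ h' (highestRoot b) ⟨1, ?_⟩⟩⟩
  · rw [h0, Int.cast_zero]
  · rw [h1, Int.cast_one]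

end

section

variable {𝔤 : Type*} [LieRing 𝔤] [LieAlgebra ℂ 𝔤] [FiniteDimensional ℂ 𝔤]
  {H : LieSubalgebra ℂ 𝔤} [H.IsCartanSubalgebra]

lemma not_rootSpace_le {α : LieModule.Weight ℂ H 𝔤} (hα : α.IsNonZero) :
    ¬ (LieAlgebra.rootSpace H α).toSubmodule ≤ H.toSubmodule := by
  intro h
  have hle : LieAlgebra.rootSpace H α ≤ LieAlgebra.rootSpace H (0 : H → ℂ) := by
    rw [LieAlgebra.rootSpace_zero_eq]
    exact h
  exact α.genWeightSpace_ne_bot'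
    ((LieModule.disjoint_genWeightSpace ℂ H 𝔤 hα).eq_bot_of_le hle)

end

section

variable {𝔤 : Type*} [LieRing 𝔤] [LieAlgebra ℂ 𝔤] [FiniteDimensional ℂ 𝔤] [LieAlgebra.IsSimple ℂ 𝔤]
  {H : LieSubalgebra ℂ 𝔤} [H.IsCartanSubalgebra]

lemma coe_pair (v : realDual H) (x : realCartan H) :
    (pair (realRootSystem H) v x : ℂ) = (v : Dual ℂ H) (x : H) :=
  have := RootPairing.IsValuedIn.trans (LieAlgebra.IsKilling.rootSystem H) ℝ ℤ
  RootPairing.restrictScalars_toLinearMap_apply_apply (P := LieAlgebra.IsKilling.rootSystem H) ℝ v x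

lemma coe_pairing (i j : H.root) : (((realRootSystem H).pairing i j : ℝ) : ℂ) =
    (LieAlgebra.IsKilling.rootSystem H).pairing i j :=
  coe_pair ((realRootSystem H).root i) ((realRootSystem H).coroot j)

lemma pairing_eq_zero_iff (i j : H.root) : (realRootSystem H).pairing i j = 0 ↔
    (LieAlgebra.IsKilling.rootSystem H).pairing i j = 0 := by
  rw [← coe_pairing, Complex.ofReal_eq_zero]

instance instIsCrystallographicRealRootSystem : (realRootSystem H).IsCrystallographic where
  exists_value i j := by
    obtain ⟨z, hz⟩ := RootPairing.exists_value (P := LieAlgebra.IsKilling.rootSystem H) (S := ℤ) i j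
    refine ⟨z, ?_⟩
    rw [← coe_pairing, eq_intCast] at hz
    rw [eq_intCast]
    exact_mod_cast hz

instance instIsReducedRealRootSystem : (realRootSystem H).IsReduced where
  eq_or_eq_neg i j h := by
    refine (RootPairing.IsReduced.eq_or_eq_neg (P := LieAlgebra.IsKilling.rootSystem H) i j
      fun hij ↦ h (LinearIndependent.of_comp (realDual H).subtype ?_)).imp Subtype.ext Subtype.ext
    have hcomp : (realDual H).subtype ∘ ![(realRootSystem H).root i, (realRootSystem H).root j] =
        ![(LieAlgebra.IsKilling.rootSystem H).root i, (LieAlgebra.IsKilling.rootSystem H).root j] :=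
      funext (Fin.forall_fin_two.mpr ⟨rfl, rfl⟩)
    rw [hcomp]
    exact hij.restrict_scalars' ℝ

instance instIsIrreducibleRealRootSystem : (realRootSystem H).IsIrreducible := by
  let Q := LieAlgebra.IsKilling.rootSystem H
  have : Nontrivial (realDual H) :=
    ⟨(realRootSystem H).root (Classical.arbitrary _), 0, (realRootSystem H).ne_zero _⟩
  refine RootPairing.IsIrreducible.mk' _ fun q hq hq0 ↦
    RootPairing.eq_top_of_mem_invtSubmodule_of_forall_eq_univ _ q hq0 hq
      fun Φ hΦ hΦq hker ↦ Set.eq_univ_of_forall fun k ↦ ?_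
  have horth : ∀ j ∉ Φ, ∀ i ∈ Φ, Q.pairing i j = 0 := fun j hj i hi ↦
    (pairing_eq_zero_iff i j).mp (hker j hj (hΦq ⟨i, hi, rfl⟩))
  have htop : Submodule.span ℂ (Q.root '' Φ) = ⊤ := by
    refine RootPairing.span_root_image_eq_top_of_forall_orthogonal Q Φ hΦ fun j hj i hi ↦ ?_
    have hij := horth j (fun hj' ↦ hj (Submodule.subset_span ⟨j, hj', rfl⟩)) i hi
    exact ⟨Q.pairing_eq_zero_iff.mp hij, hij⟩
  by_contra hk
  have hle : Submodule.span ℂ (Q.root '' Φ) ≤ LinearMap.ker (Q.coroot' k) :=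
    Submodule.span_le.mpr (Set.image_subset_iff.mpr fun i hi ↦ horth k hk i hi)
  have hkk : Q.pairing k k = 0 := hle (x := Q.root k) (htop ▸ Submodule.mem_top)
  exact two_ne_zero ((Q.pairing_same k).symm.trans hkk)

lemma weight_apply_eq_pair (i : H.root) (x : realCartan H) :
    ((i : LieModule.Weight ℂ H 𝔤) : H → ℂ) (x : H) =
      (pair (realRootSystem H) ((realRootSystem H).root i) x : ℂ) :=
  (coe_pair ((realRootSystem H).root i) x).symm

lemma rootSpace_le_centralizer {x : realCartan H} {α : LieModule.Weight ℂ H 𝔤}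
    (hα : Complex.exp (2 * Real.pi * Complex.I * α (x : H)) = 1) :
    (LieAlgebra.rootSpace H α).toSubmodule ≤ centralizer x :=
  le_iSup₂ (f := fun (α : LieModule.Weight ℂ H 𝔤)
    (_ : Complex.exp (2 * Real.pi * Complex.I * α (x : H)) = 1) ↦
      (LieAlgebra.rootSpace H α).toSubmodule) α hα

lemma toSubmodule_le_centralizer (x : realCartan H) : H.toSubmodule ≤ centralizer x := by
  have : Nontrivial 𝔤 := LieModule.nontrivial_of_isIrreducible ℂ 𝔤 𝔤
  have h := rootSpace_le_centralizer (x := x) (α := 0) (by simp)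
  rw [FunLike.coe_zero, LieAlgebra.rootSpace_zero_eq] at h
  exact h

lemma centralizer_eq_toSubmodule_iff (x : realCartan H) : centralizer x = H.toSubmodule ↔
    ∀ α : LieModule.Weight ℂ H 𝔤, α.IsNonZero →
      Complex.exp (2 * Real.pi * Complex.I * α (x : H)) ≠ 1 := by
  refine ⟨fun h α hα hx ↦ not_rootSpace_le hα (h ▸ rootSpace_le_centralizer hx), fun h ↦
    le_antisymm (iSup₂_le fun α hα ↦ ?_) (toSubmodule_le_centralizer x)⟩
  have hzero : α.IsZero := not_not.mp fun hne ↦ h α hne hα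
  rw [hzero.eq, LieAlgebra.rootSpace_zero_eq]
  exact le_rfl

lemma isRegular_iff (x : realCartan H) :
    IsRegular x ↔ ∀ i, ¬ ∃ k : ℤ, pair (realRootSystem H) ((realRootSystem H).root i) x = k := by
  have hcentralizer : IsRegular x ↔ centralizer x = H.toSubmodule :=
    ⟨fun h ↦ (Submodule.eq_of_le_of_finrank_eq (toSubmodule_le_centralizer x) h.symm).symm,
      fun h ↦ by rw [IsRegular, h]; rfl⟩
  rw [hcentralizer, centralizer_eq_toSubmodule_iff]
  simp only [← exp_two_pi_I_eq_one_iff, ← weight_apply_eq_pair, Subtype.forall, LieSubalgebra.root,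
    Finset.mem_filter_univ, ne_eq]

end

/-! ### Exponentials of nilpotent operators -/

section

attribute [local instance] LieRing.ofAssociativeRing

variable {A : Type*} [Ring A] [Algebra ℚ A]

lemma exp_mulRight_apply {n : A} (hn : IsNilpotent n) (x : A) :
    IsNilpotent.exp (LinearMap.mulRight ℚ n) x = x * IsNilpotent.exp n := by
  obtain ⟨k, hk⟩ := hn
  have hright : LinearMap.mulRight ℚ n ^ k = 0 := by
    rw [LinearMap.pow_mulRight, hk, LinearMap.mulRight_zero_eq_zero]
  simp only [IsNilpotent.exp_eq_sum hk, IsNilpotent.exp_eq_sum hright, Finset.mul_sum,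
    LinearMap.pow_mulRight, LinearMap.sum_apply, LinearMap.smul_apply, LinearMap.mulRight_apply,
    mul_smul_comm]

lemma exp_mul_eq_exp_ad_mul {n : A} (hn : IsNilpotent n) (x : A) : IsNilpotent.exp n * x =
    IsNilpotent.exp (LinearMap.mulLeft ℚ n - LinearMap.mulRight ℚ n) x * IsNilpotent.exp n := by
  have hleft : IsNilpotent (LinearMap.mulLeft ℚ n) := by rwa [LinearMap.isNilpotent_mulLeft_iff]
  have hright : IsNilpotent (LinearMap.mulRight ℚ n) := by rwa [LinearMap.isNilpotent_mulRight_iff]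
  have hcomm := LinearMap.commute_mulLeft_right (R := ℚ) n n
  have hexp := IsNilpotent.exp_add_of_commute (hcomm.symm.sub_right (Commute.refl _))
    hright (hcomm.isNilpotent_sub hleft hright)
  rw [add_sub_cancel] at hexp
  calc IsNilpotent.exp n * x = IsNilpotent.exp (LinearMap.mulLeft ℚ n) x :=
        LinearMap.congr_fun (IsNilpotent.map_exp hn (Algebra.lmul ℚ A)) x
    _ = _ := by rw [hexp, Module.End.mul_apply, exp_mulRight_apply hn]

/-- With `y = [n, x]` and `2 z = [n, y]`, this is `exp n x exp (-n) = exp (ad n) x`, where the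
series ends at the second order. -/
lemma exp_mul_eq_add_mul_exp {n x y z : A} (hn : IsNilpotent n) (hx : ⁅n, x⁆ = y)
    (hy : ⁅n, y⁆ = 2 • z) (hz : ⁅n, z⁆ = 0) :
    IsNilpotent.exp n * x = (x + y + z) * IsNilpotent.exp n := by
  have hleft : IsNilpotent (LinearMap.mulLeft ℚ n) := by rwa [LinearMap.isNilpotent_mulLeft_iff]
  have hright : IsNilpotent (LinearMap.mulRight ℚ n) := by rwa [LinearMap.isNilpotent_mulRight_iff]
  set D := LinearMap.mulLeft ℚ n - LinearMap.mulRight ℚ n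
  have hDnil : IsNilpotent D :=
    (LinearMap.commute_mulLeft_right (R := ℚ) n n).isNilpotent_sub hleft hright
  have hDx : D x = y := hx
  have hDy : D y = 2 • z := hy
  have hDz : D z = 0 := hz
  have hpow : D ^ 3 • x = 0 := by
    rw [Module.End.smul_def, Module.End.pow_apply]
    simp only [Function.iterate_succ, Function.iterate_zero, Function.comp_apply, id_eq, hDx, hDy,
      map_nsmul, hDz, smul_zero]
  have hexp : IsNilpotent.exp D x = x + y + z := by
    rw [← Module.End.smul_def, IsNilpotent.exp_smul_eq_sum hpow hDnil]
    simp only [Finset.sum_range_succ, Finset.sum_range_zero, pow_succ, pow_zero, one_mul,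
      Module.End.smul_def, Module.End.mul_apply, Module.End.one_apply, hDx, hDy, Nat.factorial]
    module
  rw [exp_mul_eq_exp_ad_mul hn, hexp]

lemma exp_mul_eq_sub_mul_exp {n x y : A} (hn : IsNilpotent n) (hx : ⁅x, n⁆ = y) (hy : ⁅n, y⁆ = 0) :
    IsNilpotent.exp n * x = (x - y) * IsNilpotent.exp n := by
  rw [exp_mul_eq_add_mul_exp (y := -y) (z := 0) hn (by rw [← hx, lie_skew])
    (by rw [lie_neg, hy, neg_zero, smul_zero]) (lie_zero n), add_zero, sub_eq_add_neg]

/-- The element `exp e exp (-f) exp e` implements the reflection in the root of `e`. -/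
lemma exists_isUnit_mul_eq {k : Type*} [CommRing k] [Algebra k A] {h e f : A} (he : IsNilpotent e)
    (hf : IsNilpotent f) (hef : ⁅e, f⁆ = h) (hhe : ⁅h, e⁆ = 2 • e) (hhf : ⁅h, f⁆ = -(2 • f)) :
    ∃ θ : A, IsUnit θ ∧ ∀ (x : A) (a : k), ⁅x, e⁆ = a • e → ⁅x, f⁆ = -(a • f) →
      θ * x = (x - a • h) * θ := by
  set u := IsNilpotent.exp e
  set v := IsNilpotent.exp (-f)
  have hu : ∀ (x : A) (a : k), ⁅x, e⁆ = a • e → u * x = (x - a • e) * u := fun x a hx ↦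
    exp_mul_eq_sub_mul_exp he hx ((Commute.refl e).smul_right a).lie_eq
  have hve : v * e = (e + h - f) * v := by
    rw [sub_eq_add_neg]
    refine exp_mul_eq_add_mul_exp hf.neg ?_ ?_ (lie_self _)
    · rw [neg_lie, lie_skew, hef]
    · rw [neg_lie, lie_skew, hhf, smul_neg]
  refine ⟨u * v * u, (he.isUnit_exp.mul hf.neg.isUnit_exp).mul he.isUnit_exp, fun x a hxe hxf ↦ ?_⟩
  have hvx : v * (x - a • e) = (x - a • e - a • h) * v := by
    have hv : v * x = (x - a • f) * v := by
      refine exp_mul_eq_sub_mul_exp hf.neg ?_ ((Commute.refl f).neg_left.smul_right a).lie_eq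
      rw [lie_neg, hxf, neg_neg]
    rw [mul_sub, hv, mul_smul_comm, hve, ← smul_mul_assoc, ← sub_mul]
    congr 1
    module
  have hux : u * (x - a • e - a • h) = (x - a • h) * u := by
    rw [hu (x - a • e - a • h) (-a) ?_]
    · congr 1
      module
    · rw [sub_lie, sub_lie, smul_lie, smul_lie, lie_self, hxe, hhe]
      module
  rw [mul_assoc, hu x a hxe, mul_assoc u v, ← mul_assoc v, hvx, ← mul_assoc, ← mul_assoc, hux]
  simp only [mul_assoc]

end

/-! ### Reflections of weight spaces -/

section

open LieAlgebra.IsKilling (coroot)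
open LieModule (Weight weightSpace toEnd)

attribute [local instance] LieRing.ofAssociativeRing

variable {K 𝔤 : Type*} [Field K] [CharZero K] [LieRing 𝔤] [LieAlgebra K 𝔤] [FiniteDimensional K 𝔤]
  [LieAlgebra.IsKilling K 𝔤] {H : LieSubalgebra K 𝔤} [H.IsCartanSubalgebra]
  [LieModule.IsTriangularizable K H 𝔤] {L : Type*} [AddCommGroup L] [Module K L]
  [LieRingModule 𝔤 L] [LieModule K 𝔤 L] {α : Weight K H 𝔤}

lemma exists_isUnit_mul_toEnd_eq [FiniteDimensional K L] [LieModule.IsTriangularizable K H L]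
    (hα : α.IsNonZero) :
    ∃ θ : Module.End K L, IsUnit θ ∧
      ∀ x : H, θ * toEnd K 𝔤 L x = toEnd K 𝔤 L (x - α x • coroot α : H) * θ := by
  let : Algebra ℚ (Module.End K L) := Algebra.compHom _ (algebraMap ℚ K)
  obtain ⟨h, e, f, ht, he, hf⟩ := LieAlgebra.IsKilling.exists_isSl2Triple_of_weight_isNonZero hα
  have hE := LieModule.isNilpotent_toEnd_of_mem_rootSpace L H hα he
  have hF := LieModule.isNilpotent_toEnd_of_mem_rootSpace (χ := -α) L H hα.neg hf
  obtain ⟨θ, hθ, hθ'⟩ := exists_isUnit_mul_eq (k := K) hE hF rfl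
    (by rw [← LieHom.map_lie, ht.lie_e_f, ← LieHom.map_lie, ht.lie_h_e_nsmul, map_nsmul])
    (by rw [← LieHom.map_lie, ht.lie_e_f, ← LieHom.map_lie, ht.lie_h_f_nsmul, map_neg, map_nsmul])
  refine ⟨θ, hθ, fun x ↦ ?_⟩
  have hxe : ⁅(x : 𝔤), e⁆ = α x • e := LieAlgebra.IsKilling.lie_eq_smul_of_mem_rootSpace he x
  have hxf : ⁅(x : 𝔤), f⁆ = -α x • f := LieAlgebra.IsKilling.lie_eq_smul_of_mem_rootSpace hf x
  rw [hθ' _ (α x) (by rw [← LieHom.map_lie, hxe, map_smul])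
    (by rw [← LieHom.map_lie, hxf, neg_smul, map_neg, map_smul]), ← LieHom.map_lie, ht.lie_e_f,
    ht.h_eq_coroot hα he hf, ← map_smul, ← map_sub]
  rfl

lemma mem_weightSpace_of_mul_toEnd_eq (hα : α.IsNonZero) {θ : Module.End K L}
    (hθ : ∀ x : H, θ * toEnd K 𝔤 L x = toEnd K 𝔤 L (x - α x • coroot α : H) * θ)
    {μ : Dual K H} {m : L} (hm : m ∈ weightSpace L (μ : H → K)) :
    θ m ∈ weightSpace L ((μ - μ (coroot α) • α.toLinear : Dual K H) : H → K) := by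
  rw [LieModule.mem_weightSpace] at hm ⊢
  intro x
  set y := x - α x • coroot α with hy
  have hαy : α y = -α x := by
    rw [← LieModule.Weight.toLinear_apply, hy, map_sub, map_smul, LieModule.Weight.toLinear_apply,
      LieModule.Weight.toLinear_apply, LieAlgebra.IsKilling.root_apply_coroot hα, smul_eq_mul]
    ring
  have hθy := LinearMap.congr_fun (hθ y) m
  rw [hαy, neg_smul, sub_neg_eq_add, hy, sub_add_cancel, ← hy] at hθy
  calc ⁅x, θ m⁆ = θ ⁅y, m⁆ := hθy.symm
    _ = μ y • θ m := by rw [hm, map_smul]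
    _ = _ := by
      congr 1
      rw [hy, map_sub, map_smul, LinearMap.sub_apply, LinearMap.smul_apply, smul_eq_mul,
        smul_eq_mul, mul_comm, LieModule.Weight.toLinear_apply]

lemma finrank_weightSpace_reflection [FiniteDimensional K L]
    [LieModule.IsTriangularizable K H L] (hα : α.IsNonZero) (μ : Dual K H) :
    finrank K (weightSpace L ((μ - μ (coroot α) • α.toLinear : Dual K H) : H → K)) =
      finrank K (weightSpace L (μ : H → K)) := by
  obtain ⟨θ, hθ, hθ'⟩ := exists_isUnit_mul_toEnd_eq (L := L) hα
  have hle (ν : Dual K H) : finrank K (weightSpace L (ν : H → K)) ≤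
      finrank K (weightSpace L ((ν - ν (coroot α) • α.toLinear : Dual K H) : H → K)) :=
    LinearMap.finrank_le_finrank_of_injective
      (f := θ.restrict fun _ ↦ mem_weightSpace_of_mul_toEnd_eq hα hθ') fun _ _ h ↦
        Subtype.ext (((Module.End.isUnit_iff θ).mp hθ).injective (congrArg Subtype.val h))
  have hinv : μ - μ (coroot α) • α.toLinear -
      (μ - μ (coroot α) • α.toLinear) (coroot α) • α.toLinear = μ := by
    ext x
    simp only [LinearMap.sub_apply, LinearMap.smul_apply, LieModule.Weight.toLinear_apply,
      LieAlgebra.IsKilling.root_apply_coroot hα, smul_eq_mul]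
    ring
  have hge := hle (μ - μ (coroot α) • α.toLinear)
  rw [hinv] at hge
  exact hge.antisymm (hle μ)

end

section

variable {K L : Type*} [Field K] [AddCommGroup L] [Module K L] {W W' : Submodule K L}
  {S T : Module.End K L} {c : K}

/-- The trace of the compression of an endomorphism to a subspace, along some complement. For an
endomorphism that preserves the subspace it is the trace of the restriction. -/
def compressionTrace (W : Submodule K L) : Module.End K L →ₗ[K] K :=
  LinearMap.trace K W ∘ₗ LinearMap.compRight K W.subtype.leftInverse ∘ₗ
    LinearMap.lcomp K L W.subtype

lemma compressionTrace_eq_trace_restrict (hT : ∀ w ∈ W, T w ∈ W) :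
    compressionTrace W T = LinearMap.trace K W (T.restrict hT) := by
  refine congrArg (LinearMap.trace K W) (LinearMap.ext fun w ↦ ?_)
  exact LinearMap.leftInverse_apply_of_inj W.ker_subtype ⟨T w, hT w w.2⟩

lemma compressionTrace_eq_mul_finrank [FiniteDimensional K L] (hT : ∀ w ∈ W, T w = c • w) :
    compressionTrace W T = c * finrank K W := by
  have hmem : ∀ w ∈ W, T w ∈ W := fun w hw ↦ hT w hw ▸ W.smul_mem c hw
  have hrestrict : T.restrict hmem = c • LinearMap.id :=
    LinearMap.ext fun w ↦ Subtype.ext (hT w w.2)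
  rw [compressionTrace_eq_trace_restrict hmem, hrestrict, map_smul, LinearMap.trace_id,
    smul_eq_mul]

lemma compressionTrace_mul_comm [FiniteDimensional K L] (hT : ∀ w ∈ W, T w ∈ W')
    (hS : ∀ w ∈ W', S w ∈ W) : compressionTrace W (S * T) = compressionTrace W' (T * S) := by
  rw [compressionTrace_eq_trace_restrict (T := S * T) fun w hw ↦ hS _ (hT w hw),
    compressionTrace_eq_trace_restrict (T := T * S) fun w hw ↦ hT _ (hS w hw)]
  exact LinearMap.trace_comp_comm' (T.restrict hT) (S.restrict hS)

end

/-! ### The Casimir operator -/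

section

variable {R V κ : Type*} [CommRing R] [AddCommGroup V] [Module R V] [Fintype κ] [DecidableEq κ]
  {Φ : LinearMap.BilinForm R V} {u v : κ → V}

lemma sum_apply_smul_of_dual (huv : ∀ i j, Φ (v i) (u j) = if i = j then 1 else 0)
    (hu : Submodule.span R (Set.range u) = ⊤) (z : V) : ∑ i, Φ (v i) z • u i = z := by
  have hlin : ∑ i, (Φ (v i)).smulRight (u i) = LinearMap.id := by
    refine LinearMap.ext_on_range hu fun j ↦ ?_
    simp [huv]
  simpa using LinearMap.congr_fun hlin z

lemma sum_apply_smul_of_dual_right (hΦ : LinearMap.ker Φ = ⊥)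
    (huv : ∀ i j, Φ (v i) (u j) = if i = j then 1 else 0)
    (hu : Submodule.span R (Set.range u) = ⊤) (z : V) : ∑ i, Φ z (u i) • v i = z := by
  refine LinearMap.ker_eq_bot.mp hΦ (LinearMap.ext_on_range hu fun j ↦ ?_)
  simp [huv]

end

section

attribute [local instance] LieRing.ofAssociativeRing

open LieModule (toEnd)

variable {R 𝔤 κ : Type*} [CommRing R] [LieRing 𝔤] [LieAlgebra R 𝔤] [Fintype κ]
  {Φ : LinearMap.BilinForm R 𝔤} {u v : κ → 𝔤}
  {L : Type*} [AddCommGroup L] [Module R L] [LieRingModule 𝔤 L] [LieModule R 𝔤 L]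

variable (R L) in
/-- The operator `∑ u_i v_i` on a representation. It is the Casimir operator if the families `u` and
`v` are dual bases for an invariant form. -/
def casimir (u v : κ → 𝔤) : Module.End R L := ∑ i, toEnd R 𝔤 L (u i) * toEnd R 𝔤 L (v i)

lemma commute_toEnd_casimir (hΦ : Φ.lieInvariant 𝔤) (hu : ∀ z, ∑ i, Φ (v i) z • u i = z)
    (hv : ∀ z, ∑ i, Φ z (u i) • v i = z) (x : 𝔤) :
    Commute (toEnd R 𝔤 L x) (casimir R L u v) := by
  have hxu (i : κ) : toEnd R 𝔤 L ⁅x, u i⁆ = ∑ j, Φ (v j) ⁅x, u i⁆ • toEnd R 𝔤 L (u j) := by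
    conv_lhs => rw [← hu ⁅x, u i⁆, map_sum]
    simp only [map_smul]
  have hxv (i : κ) : toEnd R 𝔤 L ⁅x, v i⁆ = -∑ j, Φ (v i) ⁅x, u j⁆ • toEnd R 𝔤 L (v j) := by
    conv_lhs => rw [← hv ⁅x, v i⁆, map_sum]
    simp only [hΦ x, neg_smul, map_neg, map_smul, Finset.sum_neg_distrib]
  have hderiv (a b : Module.End R L) (y : Module.End R L) :
      ⁅y, a * b⁆ = ⁅y, a⁆ * b + a * ⁅y, b⁆ := by
    simp only [LieRing.of_associative_ring_bracket]
    noncomm_ring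
  rw [commute_iff_lie_eq, casimir, lie_sum]
  simp only [hderiv, ← LieHom.map_lie, hxu, hxv, Finset.sum_add_distrib, Finset.sum_mul, mul_neg,
    Finset.mul_sum, Finset.sum_neg_distrib, smul_mul_assoc, mul_smul_comm]
  rw [Finset.sum_comm, add_neg_cancel]

end

section

variable {K 𝔤 L : Type*} [Field K] [IsAlgClosed K] [LieRing 𝔤] [LieAlgebra K 𝔤] [AddCommGroup L]
  [Module K L] [LieRingModule 𝔤 L] [LieModule K 𝔤 L] [FiniteDimensional K L]
  [LieModule.IsIrreducible K 𝔤 L] {T : Module.End K L}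

lemma exists_eq_algebraMap_of_commute_toEnd
    (hT : ∀ x, Commute (LieModule.toEnd K 𝔤 L x) T) : ∃ c : K, T = algebraMap K _ c := by
  have := LieModule.nontrivial_of_isIrreducible K 𝔤 L
  obtain ⟨c, hc⟩ := Module.End.exists_eigenvalue T
  let N : LieSubmodule K 𝔤 L :=
    { Module.End.eigenspace T c with
      lie_mem {x m} hm := by
        have hm' : T m = c • m := Module.End.mem_eigenspace_iff.mp hm
        refine Module.End.mem_eigenspace_iff.mpr ((LinearMap.congr_fun (hT x) m).symm.trans ?_)
        rw [Module.End.mul_apply, hm', map_smul, LieModule.toEnd_apply_apply] }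
  have hN : N = ⊤ := (eq_bot_or_eq_top N).resolve_left fun h ↦
    hc (congrArg LieSubmodule.toSubmodule h)
  refine ⟨c, LinearMap.ext fun m ↦ Module.End.mem_eigenspace_iff.mp ?_⟩
  exact (hN ▸ LieSubmodule.mem_top m : m ∈ N)

end

section

open LieAlgebra (rootSpace)
open LieModule (Weight)

variable {K 𝔤 : Type*} [Field K] [LieRing 𝔤] [LieAlgebra K 𝔤] [FiniteDimensional K 𝔤]
  [LieAlgebra.IsKilling K 𝔤] {H : LieSubalgebra K 𝔤} [H.IsCartanSubalgebra]

/-- The vector of the Cartan subalgebra that represents a functional for the Killing form. -/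
abbrev dualVec (μ : Dual K H) : H := (LieAlgebra.IsKilling.cartanEquivDual H).symm μ

lemma killingForm_dualVec (μ : Dual K H) (x : H) : killingForm K 𝔤 (dualVec μ) x = μ x :=
  LinearMap.congr_fun ((LieAlgebra.IsKilling.cartanEquivDual H).apply_symm_apply μ) x

lemma apply_dualVec_comm (μ ν : Dual K H) : μ (dualVec ν) = ν (dualVec μ) := by
  rw [← killingForm_dualVec μ, ← killingForm_dualVec ν, LieModule.traceForm_comm]

lemma sum_apply_mul_apply_dualVec_coord {κ : Type*} [Fintype κ] (h : Basis κ K H) (μ : Dual K H) :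
    ∑ k, μ (h k) * μ (dualVec (h.coord k)) = μ (dualVec μ) := by
  conv_rhs => rw [← h.sum_repr (dualVec μ), map_sum]
  refine Finset.sum_congr rfl fun k _ ↦ ?_
  rw [map_smul, smul_eq_mul, mul_comm, apply_dualVec_comm, h.coord_apply]

variable [LieModule.IsTriangularizable K H 𝔤]

lemma exists_killingForm_eq_one (α : Weight K H 𝔤) :
    ∃ e ∈ rootSpace H α, ∃ f ∈ rootSpace H (-α : H → K), killingForm K 𝔤 e f = 1 := by
  obtain ⟨e, he, he0⟩ := α.exists_ne_zero
  obtain ⟨f, hf, hef⟩ : ∃ f ∈ rootSpace H (-α : H → K), killingForm K 𝔤 e f ≠ 0 := by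
    contrapose! he0
    simpa using LieAlgebra.mem_ker_killingForm_of_mem_rootSpace_of_forall_rootSpace_neg K 𝔤 H he he0
  exact ⟨e, he, (killingForm K 𝔤 e f)⁻¹ • f, Submodule.smul_mem _ _ hf, by simp [hef]⟩

/-- A root vector `e_α`. -/
def rootVec (α : Weight K H 𝔤) : 𝔤 := (exists_killingForm_eq_one α).choose

/-- A root vector `e_{-α}`, normalized by `κ(e_α, e_{-α}) = 1` for the Killing form `κ`. -/
def oppVec (α : Weight K H 𝔤) : 𝔤 := (exists_killingForm_eq_one α).choose_spec.2.choose

variable (α : Weight K H 𝔤) (x : H)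

lemma rootVec_mem : rootVec α ∈ rootSpace H α :=
  (exists_killingForm_eq_one α).choose_spec.1

lemma oppVec_mem : oppVec α ∈ rootSpace H (-α : H → K) :=
  (exists_killingForm_eq_one α).choose_spec.2.choose_spec.1

lemma killingForm_rootVec_oppVec : killingForm K 𝔤 (rootVec α) (oppVec α) = 1 :=
  (exists_killingForm_eq_one α).choose_spec.2.choose_spec.2

variable {α} in
lemma killingForm_coe_rootVec (hα : α.IsNonZero) : killingForm K 𝔤 x (rootVec α) = 0 :=
  LieAlgebra.killingForm_apply_eq_zero_of_mem_rootSpace_of_add_ne_zero K 𝔤 H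
    (LieAlgebra.toLieSubmodule_le_rootSpace_zero K 𝔤 H x.2) (rootVec_mem α) (by rwa [zero_add])

variable {α} in
lemma killingForm_oppVec_coe (hα : α.IsNonZero) : killingForm K 𝔤 (oppVec α) x = 0 :=
  LieAlgebra.killingForm_apply_eq_zero_of_mem_rootSpace_of_add_ne_zero K 𝔤 H
    (oppVec_mem α) (LieAlgebra.toLieSubmodule_le_rootSpace_zero K 𝔤 H x.2)
    (by rwa [add_zero, neg_ne_zero])

lemma killingForm_oppVec_rootVec (α β : Weight K H 𝔤) [Decidable (α = β)] :
    killingForm K 𝔤 (oppVec α) (rootVec β) = if α = β then 1 else 0 := by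
  split_ifs with h
  · rw [← h, LieModule.traceForm_comm]
    exact killingForm_rootVec_oppVec α
  · exact LieAlgebra.killingForm_apply_eq_zero_of_mem_rootSpace_of_add_ne_zero K 𝔤 H
      (oppVec_mem α) (rootVec_mem β) fun h0 ↦ h (DFunLike.coe_injective (neg_add_eq_zero.mp h0))

/-- A basis of the Cartan subalgebra, followed by the root vectors `e_α`. -/
def cartanRootFamily {κ : Type*} (h : Basis κ K H) : κ ⊕ H.root → 𝔤 :=
  Sum.elim (fun k ↦ h k) fun i ↦ rootVec (i : Weight K H 𝔤)

/-- The dual family of `cartanRootFamily` for the Killing form. -/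
def dualCartanRootFamily {κ : Type*} (h : Basis κ K H) : κ ⊕ H.root → 𝔤 :=
  Sum.elim (fun k ↦ dualVec (h.coord k)) fun i ↦ oppVec (i : Weight K H 𝔤)

lemma killingForm_dualCartanRootFamily {κ : Type*} [DecidableEq κ] [DecidableEq H.root]
    (h : Basis κ K H) (i j : κ ⊕ H.root) :
    killingForm K 𝔤 (dualCartanRootFamily h i) (cartanRootFamily h j) = if i = j then 1 else 0 := by
  classical
  rcases i with k | i <;> rcases j with l | j
  · simp [dualCartanRootFamily, cartanRootFamily, killingForm_dualVec, Finsupp.single_apply,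
      eq_comm]
  · simpa [dualCartanRootFamily, cartanRootFamily] using
      killingForm_coe_rootVec _ (H.isNonZero_coe_root j)
  · simpa [dualCartanRootFamily, cartanRootFamily] using
      killingForm_oppVec_coe _ (H.isNonZero_coe_root i)
  · simp only [dualCartanRootFamily, cartanRootFamily, Sum.elim_inr, killingForm_oppVec_rootVec,
      Sum.inr.injEq, Subtype.ext_iff]

variable [CharZero K]

lemma rootSpace_le_span_rootVec {α : Weight K H 𝔤} (hα : α.IsNonZero) :
    (rootSpace H α).toSubmodule ≤ K ∙ rootVec α := by
  intro x hx
  have hne : (⟨rootVec α, rootVec_mem α⟩ : rootSpace H α) ≠ 0 := by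
    intro h0
    have hzero : rootVec α = 0 := congrArg Subtype.val h0
    simpa [hzero] using killingForm_rootVec_oppVec α
  obtain ⟨c, hc⟩ := (finrank_eq_one_iff_of_nonzero' _ hne).mp
    (LieAlgebra.IsKilling.finrank_rootSpace_eq_one α hα) ⟨x, hx⟩
  exact Submodule.mem_span_singleton.mpr ⟨c, congrArg Subtype.val hc⟩

lemma span_range_cartanRootFamily {κ : Type*} (h : Basis κ K H) :
    Submodule.span K (Set.range (cartanRootFamily h)) = ⊤ := by
  have htop : ⨆ α : Weight K H 𝔤, (rootSpace H α).toSubmodule = ⊤ :=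
    LieSubmodule.iSup_toSubmodule_eq_top.mpr (LieModule.iSup_genWeightSpace_eq_top' K H 𝔤)
  rw [eq_top_iff, ← htop]
  refine iSup_le fun α ↦ ?_
  rw [cartanRootFamily, Set.Sum.elim_range, Submodule.span_union]
  by_cases hα : α.IsZero
  · rw [hα.eq, LieAlgebra.rootSpace_zero_eq K 𝔤 H]
    refine le_sup_of_le_left fun x hx ↦ ?_
    have hmem : x ∈ (Submodule.span K (Set.range h)).map H.toSubmodule.subtype :=
      ⟨⟨x, hx⟩, h.span_eq ▸ Submodule.mem_top, rfl⟩
    rwa [Submodule.map_span, ← Set.range_comp] at hmem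
  · refine le_sup_of_le_right ((rootSpace_le_span_rootVec hα).trans (Submodule.span_mono ?_))
    exact Set.singleton_subset_iff.mpr ⟨⟨α, by simpa using hα⟩, rfl⟩

end

section

open LieModule (Weight)
open LieAlgebra.IsKilling (coroot)

variable {K 𝔤 : Type*} [Field K] [CharZero K] [LieRing 𝔤] [LieAlgebra K 𝔤] [FiniteDimensional K 𝔤]
  [LieAlgebra.IsKilling K 𝔤] {H : LieSubalgebra K 𝔤} [H.IsCartanSubalgebra]
  [LieModule.IsTriangularizable K H 𝔤] {α : Weight K H 𝔤}

lemma killingForm_coroot_coroot (hα : α.IsNonZero) :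
    killingForm K 𝔤 (coroot α) (coroot α) = 4 * (α (dualVec α.toLinear))⁻¹ := by
  refine (LieAlgebra.IsKilling.traceForm_coroot α (coroot α)).trans ?_
  rw [LieAlgebra.IsKilling.root_apply_coroot hα, nsmul_eq_mul, smul_eq_mul]
  push_cast
  ring

lemma apply_dualVec_toLinear (hα : α.IsNonZero) (μ : Dual K H) :
    μ (dualVec α.toLinear) = 2 / killingForm K 𝔤 (coroot α) (coroot α) * μ (coroot α) := by
  have hne : α (dualVec α.toLinear) ≠ 0 :=
    LieAlgebra.IsKilling.root_apply_cartanEquivDual_symm_ne_zero hα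
  have hμ : μ (coroot α) = 2 * ((α (dualVec α.toLinear))⁻¹ * μ (dualVec α.toLinear)) := by
    rw [coroot, map_nsmul, map_smul, nsmul_eq_mul, smul_eq_mul, Nat.cast_ofNat]
  rw [killingForm_coroot_coroot hα, hμ]
  field_simp
  norm_num

end

section

variable {𝔤 : Type*} [LieRing 𝔤] [LieAlgebra ℂ 𝔤] [FiniteDimensional ℂ 𝔤]
  [LieAlgebra.IsSimple ℂ 𝔤] {H : LieSubalgebra ℂ 𝔤} [H.IsCartanSubalgebra]

variable (H) in
/-- The bilinear form on `𝔱*` dual to the Killing form. -/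
def killingDual : realDual H →ₗ[ℝ] realDual H →ₗ[ℝ] ℂ :=
  LinearMap.mk₂ ℝ (fun u v ↦ (u : Dual ℂ H) (dualVec (v : Dual ℂ H)))
    (fun _ _ _ ↦ rfl) (fun _ _ _ ↦ rfl)
    (fun u v w ↦ by rw [Submodule.coe_add, dualVec, map_add, map_add])
    (fun c u v ↦ by
      have hcv : ((c • v : realDual H) : Dual ℂ H) = (c : ℂ) • (v : Dual ℂ H) := rfl
      rw [hcv, dualVec, map_smul, map_smul]
      rfl)

lemma killingDual_comm (u v : realDual H) : killingDual H u v = killingDual H v u :=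
  apply_dualVec_comm _ _

/-- The square of the length of a co-root for the Killing form. -/
def corootSqLength (i : H.root) : ℝ :=
  ∑ j, pair (realRootSystem H) ((realRootSystem H).root j) ((realRootSystem H).coroot i) ^ 2

lemma corootSqLength_pos (i : H.root) : 0 < corootSqLength i := by
  refine Finset.sum_pos' (fun j _ ↦ sq_nonneg _) ⟨i, Finset.mem_univ _, ?_⟩
  have htwo : pair _ ((realRootSystem H).root i) ((realRootSystem H).coroot i) = 2 :=
    (realRootSystem H).root_coroot_two i
  rw [htwo]
  norm_num

lemma ofReal_corootSqLength (i : H.root) : (corootSqLength i : ℂ) =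
    killingForm ℂ 𝔤 (LieAlgebra.IsKilling.coroot (i : LieModule.Weight ℂ H 𝔤))
      (LieAlgebra.IsKilling.coroot (i : LieModule.Weight ℂ H 𝔤)) := by
  have hsum := LinearMap.congr_fun₂
    (LieAlgebra.IsKilling.restrict_killingForm_eq_sum (K := ℂ) (H := H))
    (LieAlgebra.IsKilling.coroot (i : LieModule.Weight ℂ H 𝔤))
    (LieAlgebra.IsKilling.coroot (i : LieModule.Weight ℂ H 𝔤))
  refine Eq.trans ?_ hsum.symm
  rw [corootSqLength, Complex.ofReal_sum, ← Finset.sum_coe_sort LieSubalgebra.root]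
  simp only [LinearMap.sum_apply]
  refine Finset.sum_congr rfl fun j _ ↦ ?_
  rw [Complex.ofReal_pow, ← weight_apply_eq_pair, sq]
  rfl

lemma killingDual_root (i : H.root) (v : realDual H) :
    killingDual H ((realRootSystem H).root i) v =
      (2 / corootSqLength i * pair (realRootSystem H) v ((realRootSystem H).coroot i) : ℝ) := by
  rw [killingDual_comm, Complex.ofReal_mul, Complex.ofReal_div, ofReal_corootSqLength, coe_pair]
  exact apply_dualVec_toLinear (H.isNonZero_coe_root i) _

end

section

open LieAlgebra (rootSpace)
open LieModule (Weight weightSpace toEnd)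

attribute [local instance] LieRing.ofAssociativeRing

variable {K 𝔤 : Type*} [Field K] [LieRing 𝔤] [LieAlgebra K 𝔤] [FiniteDimensional K 𝔤]
  [LieAlgebra.IsKilling K 𝔤] {H : LieSubalgebra K 𝔤} [H.IsCartanSubalgebra]
  [LieModule.IsTriangularizable K H 𝔤]
  {L : Type*} [AddCommGroup L] [Module K L] [LieRingModule 𝔤 L] [LieModule K 𝔤 L]

lemma compressionTrace_weightSpace_casimir [FiniteDimensional K L] {κ : Type*} [Fintype κ]
    (h : Basis κ K H) (μ : Dual K H) :
    compressionTrace (weightSpace L (μ : H → K)).toSubmodule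
        (casimir K L (cartanRootFamily h) (dualCartanRootFamily h)) =
      μ (dualVec μ) * finrank K (weightSpace L (μ : H → K)) +
        ∑ i : H.root, compressionTrace (weightSpace L (μ : H → K)).toSubmodule
          (toEnd K 𝔤 L (rootVec i.1) * toEnd K 𝔤 L (oppVec i.1)) := by
  have hcartan (k : κ) : compressionTrace (weightSpace L (μ : H → K)).toSubmodule
      (toEnd K 𝔤 L (h k) * toEnd K 𝔤 L (dualVec (h.coord k))) =
      μ (h k) * μ (dualVec (h.coord k)) * finrank K (weightSpace L (μ : H → K)) := by
    refine compressionTrace_eq_mul_finrank fun m hm ↦ ?_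
    have hm' (x : H) : toEnd K 𝔤 L x m = μ x • m := (LieModule.mem_weightSpace _ m).mp hm x
    rw [Module.End.mul_apply, hm', map_smul, hm', smul_smul, mul_comm]
  rw [casimir, Fintype.sum_sum_type, map_add, map_sum, map_sum,
    ← sum_apply_mul_apply_dualVec_coord h, Finset.sum_mul]
  exact congrArg₂ _ (Finset.sum_congr rfl fun k _ ↦ hcartan k) rfl

variable [CharZero K]

lemma lie_mem_weightSpace {χ μ : H → K} {e : 𝔤} (he : e ∈ rootSpace H χ) {m : L}
    (hm : m ∈ weightSpace L μ) : ⁅e, m⁆ ∈ weightSpace L (μ + χ) := by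
  rw [LieModule.mem_weightSpace] at hm ⊢
  intro x
  have hxe : ⁅(x : 𝔤), e⁆ = χ x • e := LieAlgebra.IsKilling.lie_eq_smul_of_mem_rootSpace he x
  have hxm : ⁅(x : 𝔤), m⁆ = μ x • m := hm x
  rw [LieSubalgebra.coe_bracket_of_module, leibniz_lie, hxe, hxm, smul_lie, lie_smul,
    Pi.add_apply, add_smul, add_comm]

variable [FiniteDimensional K L]

lemma compressionTrace_weightSpace_sub (α : Weight K H 𝔤) (μ : Dual K H) :
    compressionTrace (weightSpace L (μ : H → K)).toSubmodule
        (toEnd K 𝔤 L (rootVec α) * toEnd K 𝔤 L (oppVec α)) -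
      compressionTrace (weightSpace L ((μ + α.toLinear : Dual K H) : H → K)).toSubmodule
        (toEnd K 𝔤 L (rootVec α) * toEnd K 𝔤 L (oppVec α)) =
      μ (dualVec α.toLinear) * finrank K (weightSpace L (μ : H → K)) := by
  have hcomm : toEnd K 𝔤 L (rootVec α) * toEnd K 𝔤 L (oppVec α) -
      toEnd K 𝔤 L (oppVec α) * toEnd K 𝔤 L (rootVec α) = toEnd K 𝔤 L (dualVec α.toLinear) := by
    rw [← LieRing.of_associative_ring_bracket, ← LieHom.map_lie,
      LieAlgebra.IsKilling.lie_eq_killingForm_smul_of_mem_rootSpace_of_mem_rootSpace_neg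
        (rootVec_mem α) (oppVec_mem α), killingForm_rootVec_oppVec, one_smul]
  have hneg : ((μ + α.toLinear : Dual K H) : H → K) + -α = μ :=
    add_neg_cancel_right (μ : H → K) α
  have hshift : compressionTrace (weightSpace L ((μ + α.toLinear : Dual K H) : H → K)).toSubmodule
        (toEnd K 𝔤 L (rootVec α) * toEnd K 𝔤 L (oppVec α)) =
      compressionTrace (weightSpace L (μ : H → K)).toSubmodule
        (toEnd K 𝔤 L (oppVec α) * toEnd K 𝔤 L (rootVec α)) :=
    compressionTrace_mul_comm
      (fun m hm ↦ hneg ▸ lie_mem_weightSpace (oppVec_mem α) hm)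
      (fun m hm ↦ lie_mem_weightSpace (rootVec_mem α) hm)
  rw [hshift, ← map_sub, hcomm]
  exact compressionTrace_eq_mul_finrank fun m hm ↦ (LieModule.mem_weightSpace _ m).mp hm _

lemma exists_casimir_eq_algebraMap [IsAlgClosed K] [LieModule.IsIrreducible K 𝔤 L] {κ : Type*}
    [Fintype κ] (h : Basis κ K H) :
    ∃ c : K, casimir K L (cartanRootFamily h) (dualCartanRootFamily h) = algebraMap K _ c := by
  classical
  have hdual := killingForm_dualCartanRootFamily h
  have hspan := span_range_cartanRootFamily h
  exact exists_eq_algebraMap_of_commute_toEnd (commute_toEnd_casimir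
    (LieModule.traceForm_lieInvariant K 𝔤 𝔤) (sum_apply_smul_of_dual hdual hspan)
    (sum_apply_smul_of_dual_right (LieAlgebra.IsKilling.ker_killingForm_eq_bot K 𝔤) hdual hspan))

end

/-! ### The formal character -/

section FormalCharacter

open AddMonoidAlgebra
open RootPairing (weylGroup.ofIdx)
open LieModule (Weight genWeightSpace weightSpace toEnd)

variable {𝔤 : Type*} [LieRing 𝔤] [LieAlgebra ℂ 𝔤] [FiniteDimensional ℂ 𝔤] [LieAlgebra.IsSimple ℂ 𝔤]
  (H : LieSubalgebra ℂ 𝔤) [H.IsCartanSubalgebra]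
  (L : Type*) [AddCommGroup L] [Module ℂ L] [LieRingModule 𝔤 L] [LieModule ℂ 𝔤 L]

/-- The weight space of a real weight. -/
abbrev realWeightSpace (v : realDual H) : LieSubmodule ℂ H L :=
  weightSpace L ((v : Dual ℂ H) : H → ℂ)

variable [FiniteDimensional ℂ L]

lemma finite_realWeightSpace_ne_bot : {v : realDual H | realWeightSpace H L v ≠ ⊥}.Finite := by
  have hfin := LieModule.finite_genWeightSpace_ne_bot ℂ H L
  refine Set.Finite.of_injOn (f := fun v : realDual H ↦ ((v : Dual ℂ H) : H → ℂ)) ?_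
    (fun u _ v _ huv ↦ Subtype.ext (DFunLike.coe_injective huv)) hfin
  exact fun v hv ↦ ne_bot_of_le_ne_bot hv (LieModule.weightSpace_le_genWeightSpace L _)

/-- The generating function `∑_v tr_{L^v}(T) e^v` of the traces of the compressions of an operator
to the weight spaces. -/
def traceSeries (T : Module.End ℂ L) : AddMonoidAlgebra ℂ (realDual H) :=
  .ofCoeff (Finsupp.ofSupportFinite
    (fun v ↦ compressionTrace (realWeightSpace H L v).toSubmodule T)
    ((finite_realWeightSpace_ne_bot H L).subset fun v hv h0 ↦ hv (by
      simp only [h0]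
      rw [compressionTrace_eq_mul_finrank (c := 0) (by simp), zero_mul])))

/-- The formal character `∑_v dim L^v e^v` of a representation. -/
def formalCharacter : AddMonoidAlgebra ℂ (realDual H) := traceSeries H L 1

variable {H L}

lemma coeff_traceSeries (T : Module.End ℂ L) (v : realDual H) : (traceSeries H L T).coeff v =
    compressionTrace (realWeightSpace H L v).toSubmodule T := rfl

lemma coeff_formalCharacter (v : realDual H) :
    (formalCharacter H L).coeff v = finrank ℂ (realWeightSpace H L v) := by
  rw [formalCharacter, coeff_traceSeries,
    compressionTrace_eq_mul_finrank (c := 1) fun m _ ↦ (one_smul ℂ m).symm, one_mul]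
  rfl

lemma coeff_formalCharacter_ne_zero {v : realDual H} :
    (formalCharacter H L).coeff v ≠ 0 ↔ realWeightSpace H L v ≠ ⊥ := by
  rw [coeff_formalCharacter, Nat.cast_ne_zero, ← pos_iff_ne_zero, Module.finrank_pos_iff,
    LieSubmodule.nontrivial_iff_ne_bot]

lemma traceSeries_sub (i : H.root) :
    traceSeries H L (toEnd ℂ 𝔤 L (rootVec i.1) * toEnd ℂ 𝔤 L (oppVec i.1)) -
      single (-(realRootSystem H).root i) 1 *
        traceSeries H L (toEnd ℂ 𝔤 L (rootVec i.1) * toEnd ℂ 𝔤 L (oppVec i.1)) =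
      diagOp (killingDual H ((realRootSystem H).root i)) (formalCharacter H L) := by
  ext v
  rw [coeff_sub, Finsupp.sub_apply, coeff_single_mul_apply, neg_neg, one_mul, add_comm _ v,
    coeff_diagOp, coeff_formalCharacter, killingDual_comm]
  exact compressionTrace_weightSpace_sub _ _

lemma exists_laplacian_formalCharacter_add [LieModule.IsIrreducible ℂ 𝔤 L] :
    ∃ c : ℂ, laplacian (killingDual H) (formalCharacter H L) +
      ∑ i : H.root, traceSeries H L (toEnd ℂ 𝔤 L (rootVec i.1) * toEnd ℂ 𝔤 L (oppVec i.1)) =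
      c • formalCharacter H L := by
  obtain ⟨c, hc⟩ := exists_casimir_eq_algebraMap (L := L) (Module.finBasis ℂ H)
  refine ⟨c, ?_⟩
  ext v
  have htrace := compressionTrace_weightSpace_casimir (L := L) (Module.finBasis ℂ H) (v : Dual ℂ H)
  rw [hc, compressionTrace_eq_mul_finrank fun m _ ↦ Module.algebraMap_end_apply ℂ ℂ L c m] at htrace
  rw [coeff_add, Finsupp.add_apply, laplacian, coeff_diagOp, coeff_sum, Finsupp.finsetSum_apply,
    coeff_smul, Finsupp.smul_apply, coeff_formalCharacter]
  exact htrace.symm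

lemma weylAct_formalCharacter (w : (realRootSystem H).weylGroup) :
    weylAct w (formalCharacter H L) = formalCharacter H L := by
  induction w using weylGroup_induction with
  | ofIdx i =>
    ext v
    obtain ⟨u, rfl⟩ := MulAction.surjective (weylGroup.ofIdx (realRootSystem H) i) v
    have hu : ((weylGroup.ofIdx (realRootSystem H) i • u : realDual H) : Dual ℂ H) =
        (u : Dual ℂ H) - (u : Dual ℂ H) (LieAlgebra.IsKilling.coroot (i : Weight ℂ H 𝔤)) •
          (i : Weight ℂ H 𝔤).toLinear := by
      rw [ofIdx_smul_weight, reflection_eq]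
      exact congrArg (fun c : ℂ ↦ (u : Dual ℂ H) - c • (i : Weight ℂ H 𝔤).toLinear) (coe_pair u _)
    refine (coeff_weylAct_smul _ _ u).trans ?_
    rw [coeff_formalCharacter, coeff_formalCharacter, ← finrank_weightSpace_reflection
      (H.isNonZero_coe_root i), ← hu]
  | one => exact weylAct_one _
  | mul w w' hw hw' => rw [weylAct_mul, hw', hw]

variable {b : (realRootSystem H).Base} {l : realDual H}

lemma IsHighestWeight.hasLeadingTerm (h : IsHighestWeight b l L) :
    HasLeadingTerm (rootCone b) (formalCharacter H L) l (finrank ℂ (realWeightSpace H L l)) where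
  coeff_eq := coeff_formalCharacter l
  sub_mem v hv := by
    obtain ⟨β, hβ, hv'⟩ := h.2 _ (coeff_formalCharacter_ne_zero.mp hv)
    have hsub : l - v = β := by
      rw [sub_eq_iff_eq_add']
      exact Subtype.ext (sub_eq_iff_eq_add.mp hv'.symm)
    rw [hsub]
    refine (AddSubmonoid.closure_le.mpr ?_) hβ
    rintro _ ⟨i, hi, rfl⟩
    exact root_mem_rootCone hi

lemma IsHighestWeight.exists_realDual_eq (h : IsHighestWeight b l L) {μ : Weight ℂ H L}
    (hμ : weightSpace L (μ : H → ℂ) ≠ ⊥) : ∃ v : realDual H, ((v : Dual ℂ H) : H → ℂ) = μ := by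
  obtain ⟨β, -, hβ⟩ := h.2 μ.toLinear hμ
  exact ⟨l - β, congrArg DFunLike.coe hβ.symm⟩

lemma evalAt_formalCharacter (x : realCartan H) :
    evalAt (realRootSystem H) x (formalCharacter H L) =
      ∑ v ∈ (formalCharacter H L).coeff.support, (finrank ℂ (realWeightSpace H L v) : ℂ) *
        Complex.exp (2 * Real.pi * Complex.I * (v : Dual ℂ H) (x : H)) := by
  conv_lhs => rw [← sum_coeff_single (formalCharacter H L), Finsupp.sum, map_sum]
  refine Finset.sum_congr rfl fun v _ ↦ ?_
  rw [evalAt_single, coe_pair, coeff_formalCharacter]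

lemma IsHighestWeight.character_eq (h : IsHighestWeight b l L) (x : realCartan H) :
    character H L x = evalAt (realRootSystem H) x (formalCharacter H L) := by
  rw [evalAt_formalCharacter, character]
  symm
  have hne {v : realDual H} (hv : v ∈ (formalCharacter H L).coeff.support) :
      genWeightSpace L ((v : Dual ℂ H) : H → ℂ) ≠ ⊥ :=
    ne_bot_of_le_ne_bot (coeff_formalCharacter_ne_zero.mp (Finsupp.mem_support_iff.mp hv))
      (LieModule.weightSpace_le_genWeightSpace L _)
  refine Finset.sum_bij_ne_zero (fun v hv _ ↦ ⟨_, hne hv⟩) (fun _ _ _ ↦ Finset.mem_univ _)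
    (fun u _ _ v _ _ huv ↦ ?_) (fun μ _ hμ ↦ ?_) fun _ _ _ ↦ rfl
  · exact Subtype.ext (DFunLike.coe_injective (congrArg (fun μ : Weight ℂ H L ↦ (μ : H → ℂ)) huv))
  · have hμ' : weightSpace L (μ : H → ℂ) ≠ ⊥ := by
      rw [← LieSubmodule.nontrivial_iff_ne_bot, ← Module.finrank_pos_iff (R := ℂ), pos_iff_ne_zero]
      exact fun h0 ↦ hμ (by rw [h0, Nat.cast_zero, zero_mul])
    obtain ⟨v, hv⟩ := h.exists_realDual_eq hμ'
    have hsupp : v ∈ (formalCharacter H L).coeff.support := by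
      rwa [Finsupp.mem_support_iff, coeff_formalCharacter_ne_zero, realWeightSpace, hv]
    refine ⟨v, hsupp, ?_, DFunLike.coe_injective hv⟩
    rw [realWeightSpace, hv]
    exact hv ▸ hμ

lemma character_eq_zero [LieModule.IsIrreducible ℂ 𝔤 L] (b : (realRootSystem H).Base)
    (l : b.support →₀ ℕ) (hL : IsHighestWeight b (dominantWeight b l) L) {x : realCartan H}
    (hx : x ∈ openChamber b)
    (hS : sFunction (realRootSystem H) (dominantWeight b l + rho b) x = 0) :
    character H L x = 0 := by
  obtain ⟨c, hc⟩ := exists_laplacian_formalCharacter_add (H := H) (L := L)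
  rw [hL.character_eq]
  refine evalAt_eq_zero_of_casimir killingDual_comm killingDual_root b traceSeries_sub hc
    (fun i ↦ div_pos two_pos (corootSqLength_pos i)) weylAct_formalCharacter (fun j ↦ ?_) ?_
    hL.hasLeadingTerm (fun i ⟨k, hk⟩ ↦ pair_root_ne_intCast_of_mem_openChamber hx i k hk) hS
  · rw [pair_dominantWeight]
    exact Nat.cast_nonneg _
  · rw [← coeff_formalCharacter]
    exact coeff_formalCharacter_ne_zero.mpr hL.1

end FormalCharacter

end EFO

end

theorem theorem6p1 {𝔤 : Type*} [LieRing 𝔤] [LieAlgebra ℂ 𝔤] [FiniteDimensional ℂ 𝔤]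
    [LieAlgebra.IsSimple ℂ 𝔤] (H : LieSubalgebra ℂ 𝔤) [H.IsCartanSubalgebra]
    (b : (EFO.realRootSystem H).Base) (M : ℕ) :
    -- the regular points of `F` of adjoint order `M + h` are the points of `F°_{M+h}`
    {x ∈ EFO.chamberEFO b (M + EFO.coxeterNumber b) | EFO.IsRegular x} =
        EFO.openChamberEFO b (M + EFO.coxeterNumber b) ∧
      -- they are as many as the monomials of `m`-degree at most `M`, and as the points of `F_M`
      (EFO.openChamberEFO b (M + EFO.coxeterNumber b)).Finite ∧
      (EFO.monomialsLE b M).encard = (EFO.openChamberEFO b (M + EFO.coxeterNumber b)).encard ∧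
      (EFO.openChamberEFO b (M + EFO.coxeterNumber b)).encard = (EFO.chamberEFO b M).encard ∧
      -- they are common zeros of the `S`-functions and characters of `m`-degree `M + 1`
      ∀ x ∈ EFO.openChamberEFO b (M + EFO.coxeterNumber b),
        ∀ l : b.support →₀ ℕ, EFO.mDegree b l = M + 1 →
          EFO.sFunction (EFO.realRootSystem H) (EFO.dominantWeight b l + EFO.rho b) x = 0 ∧
          ∀ (L : Type*) [AddCommGroup L] [Module ℂ L] [LieRingModule 𝔤 L] [LieModule ℂ 𝔤 L]
            [FiniteDimensional ℂ L] [LieModule.IsIrreducible ℂ 𝔤 L],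
            EFO.IsHighestWeight b (EFO.dominantWeight b l) L → EFO.character H L x = 0 := by
  refine ⟨?_, EFO.finite_openChamberEFO b, EFO.encard_monomialsLE_eq b M,
    (EFO.encard_openChamberEFO_add b M).trans (EFO.encard_chamberEFO b M).symm,
    fun x hx l hl ↦ ?_⟩
  · ext x
    simp only [EFO.chamberEFO, EFO.openChamberEFO, Set.mem_ofPred_eq, Set.mem_inter_iff,
      EFO.mem_openChamber_iff, EFO.isRegular_iff]
    tauto
  · have hS := EFO.sFunction_eq_zero b l hl hx.2
    exact ⟨hS, fun L _ _ _ _ _ _ hL ↦ EFO.character_eq_zero b l hL hx.1 hS⟩
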